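/- Let $T_1$ and $T_2$ be finite simplicial complexes whose geometric realizations are homeomorphic to $S^2$, and denote by $G_1$ and $G_2$ their $1$-skeletons, which are finite graphs. Suppose that $G_1$ is a minor of $G_2$, i.e. $G_1$ is isomorphic to a graph obtained from $G_2$ by a finite sequence of operations of the following types (loops and multiple edges being allowed at the intermediate stages): deletion of an edge; collapse of an edge (its two distinct end vertices are identified and that edge is removed); deletion of an isolated vertex. Then there is a simplicial map $f : T_2 \to T_1$ (a map between the vertex sets sending simplices to simplices) of degree $\pm 1$, i.e. such that $f_*[T_2] = \pm [T_1]$ in $H_2(T_1;\mathbb{Z})$, where $[T_i]$ is a generator of $H_2(T_i;\mathbb{Z}) \cong \mathbb{Z}$. In particular $T_1 \preceq T_2$, that is, there is a simplicial map from $T_2$ to $T_1$ of nonzero degree. -/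

import Mathlib

/-! ### Finite simplicial complexes, realizations and simplicial maps

A finite simplicial complex with vertex set `V` is an `AbstractSimplicialComplex V` with `V` finite:
a family of nonempty finite subsets of `V`, closed under nonempty subsets, that contains all
singletons. -/

section Complexes

variable {V : Type*} {W : Type*}

/-- The geometric realization of `T`, as a set of barycentric coordinates: the union, over the faces
`s` of `T`, of the closed simplices spanned by the unit vectors indexed by `s`. -/
def geometricRealization [Fintype V] (T : AbstractSimplicialComplex V) : Set (V → ℝ) :=
  {x | x ∈ stdSimplex ℝ V ∧ ∃ s ∈ T.faces, ∀ v, v ∉ s → x v = 0}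

/-- `T` is a triangulation of the `n`-sphere: its geometric realization is homeomorphic to the unit
sphere of Euclidean `(n+1)`-space. -/
def IsTriangulationOfSphere [Fintype V] (n : ℕ) (T : AbstractSimplicialComplex V) : Prop :=
  Nonempty (geometricRealization T ≃ₜ Metric.sphere (0 : EuclideanSpace ℝ (Fin (n + 1))) 1)

/-- A simplicial map: a map between the vertex sets that sends faces to faces. -/
structure SimplicialMap [DecidableEq W] (T : AbstractSimplicialComplex V)
    (S : AbstractSimplicialComplex W) where
  /-- the map on vertices -/
  toFun : V → W
  map_faces : ∀ s ∈ T.faces, s.image toFun ∈ S.faces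

/-- The 1-skeleton of `T`, as a (multi)graph: its vertices are those of `T`, its edges are the faces
of `T` with two elements, and the ends of an edge are these two elements. -/
def oneSkeleton [DecidableEq V] (T : AbstractSimplicialComplex V) : Graph V (Finset V) where
  vertexSet := Set.univ
  IsLink e x y := x ≠ y ∧ e = {x, y} ∧ e ∈ T.faces
  isLink_symm _ _ := ⟨fun _ _ h => ⟨h.1.symm, by rw [h.2.1, Finset.pair_comm], h.2.2⟩⟩
  eq_or_eq_of_isLink_of_isLink e x y v w h h' := by
    have hx : x ∈ ({v, w} : Finset V) := by rw [← h'.2.1, h.2.1]; simp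
    simpa using hx
  left_mem_of_isLink _ _ _ _ := Set.mem_univ _

end Complexes

/-! ### Graph minors -/

section Minors

variable {α : Type*} {β : Type*} {α' : Type*} {β' : Type*}

/-- One operation on a multigraph: deletion of an edge, collapse of an edge, or deletion of an
isolated vertex. -/
inductive MinorStep [DecidableEq α] : Graph α β → Graph α β → Prop
  | deleteEdge (G : Graph α β) (e : β) (he : e ∈ G.edgeSet) :
      MinorStep G (G.deleteEdges {e})
  /-- The edge `e` is removed and its two ends `x ≠ y` are identified (`y` is renamed to `x`); other
  edges between `x` and `y` become loops, and parallel edges may appear. -/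
  | collapseEdge (G : Graph α β) (e : β) (x y : α) (he : G.IsLink e x y) (hxy : x ≠ y) :
      MinorStep G ((G.deleteEdges {e}).map (fun z => if z = y then x else z))
  | deleteVertex (G : Graph α β) (v : α) (hv : v ∈ G.vertexSet) (hiso : ∀ e, ¬ G.Inc e v) :
      MinorStep G (G.deleteVerts {v})

/-- Isomorphism of multigraphs: compatible bijections between the vertices and between the edges. -/
def MultigraphIso (H : Graph α' β') (G : Graph α β) : Prop :=
  ∃ (φ : H.vertexSet ≃ G.vertexSet) (ψ : H.edgeSet ≃ G.edgeSet),
    ∀ (e : H.edgeSet) (x y : H.vertexSet), H.IsLink e x y ↔ G.IsLink (ψ e) (φ x) (φ y)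

/-- `H` is a minor of `G`: it is isomorphic to a graph obtained from `G` by finitely many
operations. -/
def IsGraphMinor [DecidableEq α] (H : Graph α' β') (G : Graph α β) : Prop :=
  ∃ K : Graph α β, Relation.ReflTransGen MinorStep G K ∧ MultigraphIso H K

end Minors

/-! ### Simplicial homology with integer coefficients -/

section Homology

variable {V : Type*} {W : Type*} [DecidableEq V] [DecidableEq W]

/-- The group of oriented simplicial `n`-chains of `T`: integer valued alternating functions on
`(n+1)`-tuples of vertices, which vanish unless the entries of the tuple span a face. (Alternation
forces them to vanish on tuples with a repeated entry.) The oriented simplex `[v₀, …, vₙ]` is the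
function with value `sign σ` at `(v_{σ 0}, …, v_{σ n})` and `0` at all other tuples. -/
def orientedChains (T : AbstractSimplicialComplex V) (n : ℕ) :
    AddSubgroup ((Fin (n + 1) → V) → ℤ) where
  carrier := {c | (∀ x, c x ≠ 0 → Finset.univ.image x ∈ T.faces) ∧
    ∀ (x : Fin (n + 1) → V) (σ : Equiv.Perm (Fin (n + 1))),
      c (x ∘ σ) = (Equiv.Perm.sign σ : ℤ) * c x}
  zero_mem' := by simp
  add_mem' := by
    rintro a b ⟨ha, ha'⟩ ⟨hb, hb'⟩
    refine ⟨fun x hx => ?_, fun x σ => ?_⟩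
    · by_cases h : a x = 0
      · exact hb x fun h' => hx (by simp [h, h'])
      · exact ha x h
    · simp only [Pi.add_apply, ha', hb']; ring
  neg_mem' := by
    rintro a ⟨ha, ha'⟩
    refine ⟨fun x hx => ha x fun h => hx (by simp [h]), fun x σ => ?_⟩
    simp only [Pi.neg_apply, ha']; ring

/-- The boundary operator `∂ [v₀, …, vₙ₊₁] = ∑ᵢ (-1)ⁱ [v₀, …, v̂ᵢ, …, vₙ₊₁]`. In terms of alternating
functions, `(∂ c)(y₀, …, yₙ) = ∑_v c (v, y₀, …, yₙ)`. -/
def chainBoundary [Fintype V] (T : AbstractSimplicialComplex V) (n : ℕ) :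
    orientedChains T (n + 1) →+ orientedChains T n where
  toFun c := ⟨fun y => ∑ v, c.1 (Fin.cons v y), by
    refine ⟨fun y hy => ?_, fun y σ => ?_⟩
    · obtain ⟨v, -, hv⟩ := Finset.exists_ne_zero_of_sum_ne_zero hy
      refine (T.isRelLowerSet_faces (c.2.1 _ hv)).2 (fun w hw => ?_)
        (Finset.univ_nonempty.image _)
      obtain ⟨i, -, rfl⟩ := Finset.mem_image.1 hw
      exact Finset.mem_image.2 ⟨i.succ, Finset.mem_univ _, by simp⟩
    · rw [Finset.mul_sum]
      refine Finset.sum_congr rfl fun v _ => ?_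
      have h := c.2.2 (Fin.cons v y) (Equiv.Perm.decomposeFin.symm (0, σ))
      rw [Equiv.Perm.decomposeFin.symm_sign] at h
      simp only [if_true, one_mul] at h
      rw [← h]
      refine congrArg c.1 (funext fun i => ?_)
      refine Fin.cases ?_ (fun j => ?_) i <;> simp⟩
  map_zero' := by ext; simp
  map_add' a b := by ext; simp [Finset.sum_add_distrib]

/-- The group of simplicial `n`-cycles. -/
def simplicialCycles [Fintype V] (T : AbstractSimplicialComplex V) :
    (n : ℕ) → AddSubgroup (orientedChains T n)
  | 0 => ⊤
  | n + 1 => (chainBoundary T n).ker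

/-- The group of simplicial `n`-boundaries, inside the group of `n`-cycles. -/
def simplicialBoundaries [Fintype V] (T : AbstractSimplicialComplex V) (n : ℕ) :
    AddSubgroup (simplicialCycles T n) :=
  (chainBoundary T n).range.addSubgroupOf (simplicialCycles T n)

/-- The `n`-th simplicial homology group `H_n(T; ℤ)`. -/
abbrev SimplicialHomology [Fintype V] (T : AbstractSimplicialComplex V) (n : ℕ) : Type _ :=
  simplicialCycles T n ⧸ simplicialBoundaries T n

variable {T : AbstractSimplicialComplex V} {S : AbstractSimplicialComplex W}

/-- The map induced by a simplicial map on chains: `[v₀, …, vₙ]` is sent to `[f v₀, …, f vₙ]`, which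
is `0` if two of the `f vᵢ` coincide. -/
def SimplicialMap.mapChains [Fintype V] (f : SimplicialMap T S) (n : ℕ) :
    orientedChains T n →+ orientedChains S n where
  toFun c := ⟨fun y => ∑ x : Fin (n + 1) → V, if f.toFun ∘ x = y then c.1 x else 0, by
    refine ⟨fun y hy => ?_, fun y σ => ?_⟩
    · obtain ⟨x, -, hx⟩ := Finset.exists_ne_zero_of_sum_ne_zero hy
      rw [ite_ne_right_iff] at hx
      rw [← hx.1, ← Finset.image_image]
      exact f.map_faces _ (c.2.1 x hx.2)
    · rw [Finset.mul_sum]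
      refine (Fintype.sum_equiv (Equiv.arrowCongr σ.symm (Equiv.refl V)) _ _ fun x => ?_).symm
      have hx : (Equiv.arrowCongr σ.symm (Equiv.refl V)) x = x ∘ σ := by
        funext i; simp [Equiv.arrowCongr]
      rw [hx, c.2.2 x σ, ← Function.comp_assoc]
      by_cases h : f.toFun ∘ x = y
      · simp [h]
      · have h' : ¬ (f.toFun ∘ x) ∘ σ = y ∘ σ := fun e => h (σ.surjective.injective_comp_right e)
        rw [if_neg h, if_neg h', mul_zero]⟩
  map_zero' := by ext; simp
  map_add' a b := by
    ext y
    simp only [AddSubgroup.coe_add, Pi.add_apply, ← Finset.sum_add_distrib]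
    refine Finset.sum_congr rfl fun x _ => ?_
    split_ifs <;> simp

variable [Fintype V] [Fintype W]

theorem SimplicialMap.chainBoundary_mapChains (f : SimplicialMap T S) (n : ℕ)
    (c : orientedChains T (n + 1)) :
    chainBoundary S n (f.mapChains (n + 1) c) = f.mapChains n (chainBoundary T n c) := by
  ext y
  change ∑ w : W, ∑ x : Fin (n + 2) → V, (if f.toFun ∘ x = Fin.cons w y then c.1 x else 0) =
    ∑ x : Fin (n + 1) → V, if f.toFun ∘ x = y then ∑ v, c.1 (Fin.cons v x) else 0
  have key : ∀ (v : V) (x : Fin (n + 1) → V) (w : W),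
      f.toFun ∘ (Fin.cons v x : Fin (n + 2) → V) = Fin.cons w y ↔
        f.toFun v = w ∧ f.toFun ∘ x = y := by
    intro v x w
    simp [funext_iff, Fin.forall_fin_succ]
  have hsum : ∀ w : W,
      (∑ x : Fin (n + 2) → V, if f.toFun ∘ x = Fin.cons w y then c.1 x else 0) =
        ∑ v : V, ∑ x : Fin (n + 1) → V,
          if f.toFun v = w ∧ f.toFun ∘ x = y then c.1 (Fin.cons v x) else 0 := by
    intro w
    rw [← Fintype.sum_prod_type']
    refine (Fintype.sum_equiv (Fin.consEquiv fun _ : Fin (n + 2) => V) _ _ fun p => ?_).symm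
    have hp : (Fin.consEquiv fun _ : Fin (n + 2) => V) p = Fin.cons p.1 p.2 := rfl
    rw [hp]
    exact if_congr (key _ _ _).symm rfl rfl
  rw [Finset.sum_congr rfl fun w _ => hsum w, Finset.sum_comm]
  rw [Finset.sum_congr rfl fun v _ => Finset.sum_comm, Finset.sum_comm]
  refine Finset.sum_congr rfl fun x _ => ?_
  by_cases h : f.toFun ∘ x = y <;> simp [h]

/-- The map induced by a simplicial map on cycles. -/
def SimplicialMap.mapCycles (f : SimplicialMap T S) (n : ℕ) :
    simplicialCycles T n →+ simplicialCycles S n :=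
  ((f.mapChains n).comp (simplicialCycles T n).subtype).codRestrict (simplicialCycles S n) (by
    intro c
    cases n with
    | zero => exact AddSubgroup.mem_top _
    | succ n =>
      have hc : chainBoundary T n c.1 = 0 := c.2
      change chainBoundary S n (f.mapChains (n + 1) c.1) = 0
      rw [f.chainBoundary_mapChains, hc, map_zero])

/-- The map `f_* : H_n(T; ℤ) → H_n(S; ℤ)` induced by a simplicial map. -/
def SimplicialMap.mapHomology (f : SimplicialMap T S) (n : ℕ) :
    SimplicialHomology T n →+ SimplicialHomology S n :=
  QuotientAddGroup.map _ _ (f.mapCycles n) (by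
    rintro c ⟨b, hb⟩
    exact ⟨f.mapChains (n + 1) b, by
      rw [f.chainBoundary_mapChains, hb]; rfl⟩)

/-- For a triangulated `n`-sphere, `n ≥ 1`: a fundamental class (orientation), i.e. a generator of
the infinite cyclic group `H_n(T; ℤ)`. -/
def IsFundamentalClass (n : ℕ) (a : SimplicialHomology T n) : Prop :=
  Function.Bijective fun k : ℤ => k • a

/-- For triangulated `n`-spheres `T` and `S`, `n ≥ 1`: the simplicial map `f : T → S` has degree `d`
with respect to some choice of orientations of `T` and of `S`, i.e. `f_* [T] = d [S]`. The degree is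
determined by `f` up to sign, and changes its sign when one of the orientations is reversed. -/
def SimplicialMap.HasDegree (n : ℕ) (f : SimplicialMap T S) (d : ℤ) : Prop :=
  ∃ (a : SimplicialHomology T n) (b : SimplicialHomology S n),
    IsFundamentalClass n a ∧ IsFundamentalClass n b ∧ f.mapHomology n a = d • b

/-- `T` dominates `S` (in symbols, `S ≼ T`), for triangulated `n`-spheres `T` and `S`, `n ≥ 1`:
there is a simplicial map `T → S` of nonzero degree. -/
def SphereDominates (n : ℕ) (T : AbstractSimplicialComplex V) (S : AbstractSimplicialComplex W) :
    Prop :=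
  ∃ (f : SimplicialMap T S) (d : ℤ), d ≠ 0 ∧ f.HasDegree n d

end Homology

/-! Since `G₂` is connected, the branch sets of a minor isomorphic to `G₁` can be enlarged until
they cover all vertices of `T₂`. This gives a surjection `f` on vertices with connected fibres, and
an edge `s e` of `T₂` above each edge `e` of `T₁`. Let `C` be a forest spanning the fibres and `D`
the set of all remaining edges. The map `f` itself is simplicial of degree `1` or `-1`.

Call regions the classes of triangles of `T₂` generated by sharing an edge of `D`. Euler's formula
for both spheres yields at least as many regions as `T₁` has triangles (`card_tri_le_card_region`).
The boundary of a region, read in `T₁`, is a mod 2 cycle. It is nonzero because `C` is a forest, so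
it has at least three edges, while an edge lies in at most two such boundaries. As `3F = 2E` in
`T₁`, equality holds throughout: regions are bounded by 3-cycles, and each `s e` separates two
different regions (`card_support`).

The 3-cycles are thus the cells of a second spherical structure on `G₁`, and it remains to identify
them with the triangles of `T₁`. A cell that is not a face would separate `T₁`, and the cells on one
of its sides would form a forbidden closed chain (`mem_faces_of_cells`). Vanishing of mod 2 `H¹`
shows that `f` sends the vertices of a region into its cell (`image_subset_cell`), so `f` is
simplicial. For the degree, restrict the fundamental cycle to one region: its boundary passes
exactly once over a given edge of the cell (`degree_eq`).

All of this uses only `IsMod2Sphere`, with connectedness expressed by mod 2 functions. That a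
triangulated sphere has these properties is `IsTriangulationOfSphere.isMod2Sphere`. Its local part
(two triangles at each edge, no larger faces) compares logarithms and winding numbers on small
punctured neighbourhoods with those of a punctured disc. Its global part uses connectedness of the
sphere minus finitely many points, and the triviality of double covers of the plane. -/

set_option linter.unusedSectionVars false

/-! ### Mod 2 incidence matrices and Euler's formula. -/

section IncidenceMatrices

open Finset Matrix

/-- The edges of a complex. -/
abbrev Edg {V : Type*} (T : AbstractSimplicialComplex V) : Type _ :=
  {e : Finset V // e ∈ T.faces ∧ e.card = 2}

/-- The triangles of a complex. -/
abbrev Tri {V : Type*} (T : AbstractSimplicialComplex V) : Type _ :=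
  {t : Finset V // t ∈ T.faces ∧ t.card = 3}

noncomputable instance {V : Type*} [Fintype V] (T : AbstractSimplicialComplex V) :
    Fintype (Edg T) := Fintype.ofFinite _

noncomputable instance {V : Type*} [Fintype V] (T : AbstractSimplicialComplex V) :
    Fintype (Tri T) := Fintype.ofFinite _

variable {V : Type*} [Fintype V] [DecidableEq V]

/-- The mod 2 incidence matrix of edges and vertices. -/
def edgeVertexMatrix (T : AbstractSimplicialComplex V) : Matrix (Edg T) V (ZMod 2) :=
  fun e v => if v ∈ e.1 then 1 else 0

/-- The mod 2 incidence matrix of triangles and edges. -/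
def triEdgeMatrix (T : AbstractSimplicialComplex V) : Matrix (Tri T) (Edg T) (ZMod 2) :=
  fun t e => if e.1 ⊆ t.1 then 1 else 0

/-- A pure two dimensional complex with two triangles at each edge. -/
structure IsPseudosurface (T : AbstractSimplicialComplex V) : Prop where
  card_le : ∀ s ∈ T.faces, s.card ≤ 3
  exists_edge : ∀ v : V, ∃ e : Edg T, v ∈ e.1
  two : ∀ e : Edg T, (univ.filter fun t : Tri T => e.1 ⊆ t.1).card = 2

/-- The combinatorial properties of triangulated spheres used below: a pure two dimensional complex,
with two triangles at each edge, and with the mod 2 (co)homology of the sphere. -/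
structure IsMod2Sphere (T : AbstractSimplicialComplex V) : Prop extends IsPseudosurface T where
  nonempty : Nonempty V
  conn : ∀ g : V → ZMod 2, edgeVertexMatrix T *ᵥ g = 0 → ∃ a, g = fun _ => a
  h1 : ∀ φ : Edg T → ZMod 2, triEdgeMatrix T *ᵥ φ = 0 → ∃ g, φ = edgeVertexMatrix T *ᵥ g
  h2 : ∀ c : Tri T → ZMod 2, c ᵥ* triEdgeMatrix T = 0 → ∃ a, c = fun _ => a

theorem zmod2_cases (x : ZMod 2) : x = 0 ∨ x = 1 := by
  revert x; decide

theorem zmod2_eq_one {x : ZMod 2} (h : x ≠ 0) : x = 1 := (zmod2_cases x).resolve_left h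

theorem zmod2_add_eq_zero {x y : ZMod 2} : x + y = 0 ↔ x = y := by
  revert x y; decide

variable (T : AbstractSimplicialComplex V)

theorem edgeVertexMatrix_mulVec (g : V → ZMod 2) (e : Edg T) :
    (edgeVertexMatrix T *ᵥ g) e = ∑ v ∈ e.1, g v := by
  simp [mulVec, dotProduct, edgeVertexMatrix, Finset.sum_ite_mem]

theorem triEdgeMatrix_mulVec (φ : Edg T → ZMod 2) (t : Tri T) :
    (triEdgeMatrix T *ᵥ φ) t = ∑ e with e.1 ⊆ t.1, φ e := by
  simp [mulVec, dotProduct, triEdgeMatrix, Finset.sum_filter]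

theorem vecMul_edgeVertexMatrix (z : Edg T → ZMod 2) (v : V) :
    (z ᵥ* edgeVertexMatrix T) v = ∑ e with v ∈ e.1, z e := by
  simp [vecMul, dotProduct, edgeVertexMatrix, Finset.sum_filter]

theorem vecMul_triEdgeMatrix (c : Tri T → ZMod 2) (e : Edg T) :
    (c ᵥ* triEdgeMatrix T) e = ∑ t with e.1 ⊆ t.1, c t := by
  simp [vecMul, dotProduct, triEdgeMatrix, Finset.sum_filter]

variable {T}

theorem mem_faces_of_subset {s t : Finset V} (ht : t ∈ T.faces) (h : s ⊆ t) (hs : s.Nonempty) :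
    s ∈ T.faces := (T.isRelLowerSet_faces ht).2 h hs

/-- The edge spanned by two vertices of a triangle. -/
def Tri.edge (t : Tri T) {x y : V} (hx : x ∈ t.1) (hy : y ∈ t.1) (h : x ≠ y) : Edg T :=
  ⟨{x, y}, mem_faces_of_subset t.2.1 (by simp [insert_subset_iff, hx, hy]) (by simp),
    card_pair h⟩

theorem Edg.exists_eq (e : Edg T) : ∃ x y, x ≠ y ∧ e.1 = {x, y} := card_eq_two.1 e.2.2

theorem Edg.eq_pair {e : Edg T} {x y : V} (hx : x ∈ e.1) (hy : y ∈ e.1) (h : x ≠ y) :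
    e.1 = {x, y} :=
  (eq_of_subset_of_card_le (by simp [insert_subset_iff, hx, hy])
    (by rw [e.2.2, card_pair h])).symm

theorem Edg.exists_other {e : Edg T} {x : V} (hx : x ∈ e.1) : ∃ y, x ≠ y ∧ e.1 = {x, y} := by
  obtain ⟨a, b, hab, h⟩ := e.exists_eq
  rw [h, mem_insert, mem_singleton] at hx
  rcases hx with rfl | rfl
  · exact ⟨b, hab, h⟩
  · exact ⟨a, hab.symm, h.trans (pair_comm _ _)⟩

theorem sum_edges_of_tri {M : Type*} [AddCommMonoid M] (F : Edg T → M) (t : Tri T) {x y z : V}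
    (hxy : x ≠ y) (hxz : x ≠ z) (hyz : y ≠ z) (h : t.1 = {x, y, z}) :
    ∑ e with e.1 ⊆ t.1, F e =
      F (t.edge (x := x) (y := y) (by simp [h]) (by simp [h]) hxy) +
      F (t.edge (x := x) (y := z) (by simp [h]) (by simp [h]) hxz) +
      F (t.edge (x := y) (y := z) (by simp [h]) (by simp [h]) hyz) := by
  have : (univ.filter fun e : Edg T => e.1 ⊆ t.1) =
      {t.edge (x := x) (y := y) (by simp [h]) (by simp [h]) hxy,
        t.edge (x := x) (y := z) (by simp [h]) (by simp [h]) hxz,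
        t.edge (x := y) (y := z) (by simp [h]) (by simp [h]) hyz} := by
    ext e
    obtain ⟨a, b, hab, he⟩ := e.exists_eq
    simp only [mem_filter, mem_univ, true_and, mem_insert, mem_singleton, Subtype.ext_iff, Tri.edge,
      he, h, insert_subset_iff, singleton_subset_iff]
    constructor
    · rintro ⟨ha | ha | ha, hb | hb | hb⟩ <;> subst ha <;> subst hb <;>
        simp_all [pair_comm]
    · have hp : ∀ p q : V, ({a, b} : Finset V) = {p, q} → a ∈ ({p, q} : Finset V) ∧
          b ∈ ({p, q} : Finset V) := fun p q hpq => by simp [← hpq]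
      rintro (h' | h' | h') <;> have := hp _ _ h' <;> simp only [mem_insert, mem_singleton] at this <;>
        tauto
  have n1 : ({x, y} : Finset V) ≠ {x, z} := fun h' => by
    have : y ∈ ({x, z} : Finset V) := by simp [← h']
    simp at this; tauto
  have n2 : ({x, y} : Finset V) ≠ {y, z} := fun h' => by
    have : x ∈ ({y, z} : Finset V) := by simp [← h']
    simp at this; tauto
  have n3 : ({x, z} : Finset V) ≠ {y, z} := fun h' => by
    have : x ∈ ({y, z} : Finset V) := by simp [← h']
    simp at this; tauto
  rw [this, sum_insert, sum_insert, sum_singleton, add_assoc]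
  · simpa [Subtype.ext_iff, Tri.edge] using n3
  · simpa [Subtype.ext_iff, Tri.edge] using ⟨n1, n2⟩

theorem card_edges_of_tri (t : Tri T) : (univ.filter fun e : Edg T => e.1 ⊆ t.1).card = 3 := by
  obtain ⟨x, y, z, hxy, hxz, hyz, h⟩ := card_eq_three.1 t.2.2
  rw [card_eq_sum_ones, sum_edges_of_tri _ t hxy hxz hyz h]

variable (T) in
theorem triEdgeMatrix_mul_edgeVertexMatrix : triEdgeMatrix T * edgeVertexMatrix T = 0 := by
  ext t v
  obtain ⟨x, y, z, hxy, hxz, hyz, h⟩ := card_eq_three.1 t.2.2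
  have : (triEdgeMatrix T * edgeVertexMatrix T) t v =
      (triEdgeMatrix T *ᵥ fun e => edgeVertexMatrix T e v) t := rfl
  rw [this, triEdgeMatrix_mulVec, sum_edges_of_tri _ t hxy hxz hyz h]
  simp only [edgeVertexMatrix, Tri.edge, mem_insert, mem_singleton, Matrix.zero_apply]
  by_cases h1 : v = x
  · subst h1; simp [hxy, hxz]; decide
  by_cases h2 : v = y
  · subst h2; simp [h1, hyz]; decide
  by_cases h3 : v = z
  · subst h3; simp [h1, h2]; decide
  · simp [h1, h2, h3]

theorem edgeVertexMatrix_mulVec_const (a : ZMod 2) :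
    edgeVertexMatrix T *ᵥ (fun _ => a) = 0 := by
  ext e
  rw [edgeVertexMatrix_mulVec, sum_const, e.2.2, two_nsmul]
  exact CharTwo.add_self_eq_zero a

theorem IsMod2Sphere.const_vecMul (hT : IsMod2Sphere T) (a : ZMod 2) :
    (fun _ => a) ᵥ* triEdgeMatrix T = 0 := by
  ext e
  rw [vecMul_triEdgeMatrix, sum_const, hT.two e, two_nsmul]
  exact CharTwo.add_self_eq_zero a

theorem finrank_range_const (ι : Type*) [Nonempty ι] :
    Module.finrank (ZMod 2) (LinearMap.range (LinearMap.pi fun _ : ι => LinearMap.id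
      (R := ZMod 2) (M := ZMod 2))) = 1 := by
  rw [LinearMap.finrank_range_of_inj, Module.finrank_self]
  intro a b hab
  obtain ⟨i⟩ := ‹Nonempty ι›
  exact congrFun hab i

theorem IsMod2Sphere.nonempty_tri (hT : IsMod2Sphere T) : Nonempty (Tri T) := by
  obtain ⟨v⟩ := hT.nonempty
  obtain ⟨e, -⟩ := hT.exists_edge v
  have := hT.two e
  obtain ⟨t, -⟩ : (univ.filter fun t : Tri T => e.1 ⊆ t.1).Nonempty := by
    rw [← card_pos]; omega
  exact ⟨t⟩

theorem IsMod2Sphere.rank_edgeVertexMatrix (hT : IsMod2Sphere T) :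
    Module.finrank (ZMod 2) (LinearMap.range (edgeVertexMatrix T).mulVecLin) + 1 =
      Fintype.card V := by
  have := hT.nonempty
  rw [← finrank_range_const V, ← Module.finrank_pi (ZMod 2),
    ← (edgeVertexMatrix T).mulVecLin.finrank_range_add_finrank_ker]
  refine congrArg (fun S : Submodule (ZMod 2) (V → ZMod 2) => _ + Module.finrank (ZMod 2) S) ?_
  ext g
  rw [LinearMap.mem_range, LinearMap.mem_ker, mulVecLin_apply]
  constructor
  · rintro ⟨a, rfl⟩
    exact edgeVertexMatrix_mulVec_const a
  · intro h
    obtain ⟨a, rfl⟩ := hT.conn g h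
    exact ⟨a, rfl⟩

theorem IsMod2Sphere.rank_triEdgeMatrix_transpose (hT : IsMod2Sphere T) :
    Module.finrank (ZMod 2) (LinearMap.range (triEdgeMatrix T)ᵀ.mulVecLin) + 1 =
      Fintype.card (Tri T) := by
  have := hT.nonempty_tri
  rw [← finrank_range_const (Tri T), ← Module.finrank_pi (ZMod 2),
    ← (triEdgeMatrix T)ᵀ.mulVecLin.finrank_range_add_finrank_ker]
  refine congrArg (fun S : Submodule (ZMod 2) (Tri T → ZMod 2) => _ + Module.finrank (ZMod 2) S) ?_
  ext g
  rw [LinearMap.mem_range, LinearMap.mem_ker, mulVecLin_apply, mulVec_transpose]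
  constructor
  · rintro ⟨a, rfl⟩
    exact hT.const_vecMul a
  · intro h
    obtain ⟨a, rfl⟩ := hT.h2 g h
    exact ⟨a, rfl⟩

theorem IsMod2Sphere.rank_triEdgeMatrix (hT : IsMod2Sphere T) :
    Module.finrank (ZMod 2) (LinearMap.range (triEdgeMatrix T).mulVecLin) +
      Module.finrank (ZMod 2) (LinearMap.range (edgeVertexMatrix T).mulVecLin) =
      Fintype.card (Edg T) := by
  rw [← Module.finrank_pi (ZMod 2) (ι := Edg T),
    ← (triEdgeMatrix T).mulVecLin.finrank_range_add_finrank_ker]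
  refine congrArg (fun S : Submodule (ZMod 2) (Edg T → ZMod 2) => _ + Module.finrank (ZMod 2) S) ?_
  ext g
  rw [LinearMap.mem_range, LinearMap.mem_ker, mulVecLin_apply]
  constructor
  · rintro ⟨a, rfl⟩
    rw [mulVecLin_apply, mulVec_mulVec, triEdgeMatrix_mul_edgeVertexMatrix, zero_mulVec]
  · intro h
    obtain ⟨a, rfl⟩ := hT.h1 g h
    exact ⟨a, rfl⟩

/-- The mod 2 cochain complex is exact except for the constants at its two ends. The two ranks are
therefore `V - 1` and `F - 1`, and exactness in the middle makes them add up to `E`. -/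
theorem IsMod2Sphere.euler (hT : IsMod2Sphere T) :
    Fintype.card V + Fintype.card (Tri T) = Fintype.card (Edg T) + 2 := by
  have h1 := hT.rank_edgeVertexMatrix
  have h2 := hT.rank_triEdgeMatrix_transpose
  have h3 := hT.rank_triEdgeMatrix
  have h4 : Module.finrank (ZMod 2) (LinearMap.range (triEdgeMatrix T)ᵀ.mulVecLin) =
    Module.finrank (ZMod 2) (LinearMap.range (triEdgeMatrix T).mulVecLin) :=
    rank_transpose (triEdgeMatrix T)
  omega

/-- The first mod 2 homology group vanishes. -/
theorem IsMod2Sphere.exists_eq_vecMul (hT : IsMod2Sphere T) (z : Edg T → ZMod 2)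
    (hz : z ᵥ* edgeVertexMatrix T = 0) : ∃ c, z = c ᵥ* triEdgeMatrix T := by
  have h2 := hT.rank_triEdgeMatrix
  have h4 : Module.finrank (ZMod 2) (LinearMap.range (triEdgeMatrix T)ᵀ.mulVecLin) =
    Module.finrank (ZMod 2) (LinearMap.range (triEdgeMatrix T).mulVecLin) :=
    rank_transpose (triEdgeMatrix T)
  have h5 : Module.finrank (ZMod 2) (LinearMap.range (edgeVertexMatrix T)ᵀ.mulVecLin) =
    Module.finrank (ZMod 2) (LinearMap.range (edgeVertexMatrix T).mulVecLin) :=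
    rank_transpose (edgeVertexMatrix T)
  have h6 := (edgeVertexMatrix T)ᵀ.mulVecLin.finrank_range_add_finrank_ker
  rw [Module.finrank_pi] at h6
  -- One inclusion is `∂∂ = 0`. The dimensions agree because a matrix and its transpose have the
  -- same rank, which turns exactness for cochains into exactness for chains.
  have h7 : LinearMap.range (triEdgeMatrix T)ᵀ.mulVecLin =
      LinearMap.ker (edgeVertexMatrix T)ᵀ.mulVecLin := by
    refine Submodule.eq_of_le_of_finrank_eq ?_ (by omega)
    rintro _ ⟨a, rfl⟩
    rw [LinearMap.mem_ker, mulVecLin_apply, mulVecLin_apply, mulVec_mulVec, ← transpose_mul,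
      triEdgeMatrix_mul_edgeVertexMatrix, transpose_zero, zero_mulVec]
  have h8 : z ∈ LinearMap.ker (edgeVertexMatrix T)ᵀ.mulVecLin := by
    rw [LinearMap.mem_ker, mulVecLin_apply, mulVec_transpose, hz]
  rw [← h7] at h8
  obtain ⟨c, hc⟩ := h8
  exact ⟨c, by rw [← hc, mulVecLin_apply, mulVec_transpose]⟩

theorem IsMod2Sphere.three_mul_card_tri (hT : IsMod2Sphere T) :
    3 * Fintype.card (Tri T) = 2 * Fintype.card (Edg T) := by
  have := sum_card_bipartiteAbove_eq_sum_card_bipartiteBelow (s := (univ : Finset (Tri T)))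
    (t := (univ : Finset (Edg T))) (fun t e => e.1 ⊆ t.1)
  simp only [bipartiteAbove, bipartiteBelow, card_edges_of_tri, hT.two, sum_const, smul_eq_mul,
    card_univ] at this
  omega

/-- The two triangles at an edge. -/
theorem IsPseudosurface.exists_two (hT : IsPseudosurface T) (e : Edg T) :
    ∃ t t' : Tri T, t ≠ t' ∧ (univ.filter fun t : Tri T => e.1 ⊆ t.1) = {t, t'} :=
  card_eq_two.1 (hT.two e)

/-- Exactly two triangles contain `e`, so the boundary coefficient is a sum of two values.
Quantifying over `t` and `t'` avoids having to name these two. -/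
theorem IsPseudosurface.vecMul_eq_zero_iff (hT : IsPseudosurface T) (c : Tri T → ZMod 2) (e : Edg T) :
    (c ᵥ* triEdgeMatrix T) e = 0 ↔ ∀ t t' : Tri T, e.1 ⊆ t.1 → e.1 ⊆ t'.1 → c t = c t' := by
  obtain ⟨t, t', h, h'⟩ := hT.exists_two e
  have hm : ∀ s : Tri T, e.1 ⊆ s.1 ↔ s = t ∨ s = t' := fun s => by
    have : s ∈ (univ.filter fun t : Tri T => e.1 ⊆ t.1) ↔ s ∈ ({t, t'} : Finset (Tri T)) := by
      rw [h']
    simpa using this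
  rw [vecMul_triEdgeMatrix, h', sum_pair h, zmod2_add_eq_zero]
  simp only [hm]
  constructor
  · rintro h _ _ (rfl | rfl) (rfl | rfl) <;> simp [h]
  · intro h
    exact h _ _ (Or.inl rfl) (Or.inr rfl)

theorem IsPseudosurface.exists_tri_of_face (hT : IsPseudosurface T) {s : Finset V} (hs : s ∈ T.faces) :
    ∃ t : Tri T, s ⊆ t.1 := by
  have h0 := (T.isRelLowerSet_faces hs).1
  have h3 := hT.card_le s hs
  have key : ∀ e : Edg T, ∃ t : Tri T, e.1 ⊆ t.1 := fun e => by
    obtain ⟨t, t', -, h'⟩ := hT.exists_two e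
    have : t ∈ (univ.filter fun t : Tri T => e.1 ⊆ t.1) := by simp [h']
    exact ⟨t, (mem_filter.1 this).2⟩
  rw [← card_pos] at h0
  obtain h | h | h : s.card = 1 ∨ s.card = 2 ∨ s.card = 3 := by omega
  · obtain ⟨v, rfl⟩ := card_eq_one.1 h
    obtain ⟨e, he⟩ := hT.exists_edge v
    obtain ⟨t, ht⟩ := key e
    exact ⟨t, by simpa using ht he⟩
  · exact key ⟨s, hs, h⟩
  · exact ⟨⟨s, hs, h⟩, subset_rfl⟩

end IncidenceMatrices

/-! ### Minor models and the regions they cut out. -/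

section SphereModels

open Finset Matrix

/-- In a cycle, every end of an edge lies in another edge. -/
theorem exists_ne_of_cycle {V : Type*} [Fintype V] [DecidableEq V] {T : AbstractSimplicialComplex V}
    {z : Edg T → ZMod 2} (hz : z ᵥ* edgeVertexMatrix T = 0) {e : Edg T} (he : z e ≠ 0) {v : V}
    (hv : v ∈ e.1) : ∃ e', e' ≠ e ∧ v ∈ e'.1 ∧ z e' ≠ 0 := by
  by_contra! h
  have h0 := congrFun hz v
  rw [vecMul_edgeVertexMatrix, sum_eq_single_of_mem e (by simpa using hv)] at h0
  · exact he h0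
  · intro e' he' hne
    exact h e' hne (by simpa using he')

/-- The graph has no loops or multiple edges. A cycle through `ab` leaves `a` and `b` along two
further edges, and these are distinct. If there are no others, they must meet, which closes a
triangle. -/
theorem cycle_support {V : Type*} [Fintype V] [DecidableEq V] {T : AbstractSimplicialComplex V}
    {z : Edg T → ZMod 2} (hz : z ᵥ* edgeVertexMatrix T = 0) (h0 : z ≠ 0) :
    3 ≤ (univ.filter fun e => z e ≠ 0).card ∧ ((univ.filter fun e => z e ≠ 0).card = 3 →
      ∃ τ : Finset V, τ.card = 3 ∧ (∀ e, z e ≠ 0 ↔ e.1 ⊆ τ) ∧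
        ∀ x ∈ τ, ∀ y ∈ τ, x ≠ y → {x, y} ∈ T.faces) := by
  obtain ⟨e, he⟩ := Function.ne_iff.1 h0
  obtain ⟨a, b, hab, eab⟩ := e.exists_eq
  obtain ⟨e', hne', ha', he'⟩ := exists_ne_of_cycle hz he (v := a) (by simp [eab])
  obtain ⟨e'', hne'', hb'', he''⟩ := exists_ne_of_cycle hz he (v := b) (by simp [eab])
  obtain ⟨c, hac, eac⟩ := Edg.exists_other ha'
  obtain ⟨d, hbd, ebd⟩ := Edg.exists_other hb''
  have hcb : c ≠ b := by
    rintro rfl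
    exact hne' (Subtype.ext (eac.trans eab.symm))
  have hda : d ≠ a := by
    rintro rfl
    exact hne'' (Subtype.ext (ebd.trans ((pair_comm _ _).trans eab.symm)))
  have hne : e' ≠ e'' := by
    rintro rfl
    have : a ∈ ({b, d} : Finset V) := by rw [← ebd, eac]; simp
    simp at this; tauto
  have hsub : {e, e', e''} ⊆ univ.filter fun e => z e ≠ 0 := by
    simp only [insert_subset_iff, singleton_subset_iff, mem_filter, mem_univ, true_and]
    exact ⟨he, he', he''⟩
  have hc3 : ({e, e', e''} : Finset (Edg T)).card = 3 :=
    card_eq_three.2 ⟨e, e', e'', hne'.symm, hne''.symm, hne, rfl⟩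
  refine ⟨hc3 ▸ card_le_card hsub, fun h3 => ?_⟩
  have hS := eq_of_subset_of_card_le hsub (by rw [h3, hc3])
  have hmem : ∀ x, z x ≠ 0 ↔ x = e ∨ x = e' ∨ x = e'' := fun x => by
    have : x ∈ ({e, e', e''} : Finset (Edg T)) ↔ x ∈ univ.filter fun e => z e ≠ 0 := by rw [hS]
    simpa using this.symm
  obtain ⟨x, hxe', hcx, hx⟩ := exists_ne_of_cycle hz he' (v := c) (by simp [eac])
  have hcd : c = d := by
    rcases (hmem x).1 hx with rfl | rfl | rfl
    · rw [eab] at hcx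
      simp only [mem_insert, mem_singleton] at hcx
      exact absurd hcx (by tauto)
    · exact absurd rfl hxe'
    · rw [ebd] at hcx
      simp only [mem_insert, mem_singleton] at hcx
      tauto
  subst hcd
  refine ⟨{a, b, c}, card_eq_three.2 ⟨a, b, c, hab, hac, hcb.symm, rfl⟩, fun x => ?_, ?_⟩
  · rw [hmem]
    constructor
    · rintro (rfl | rfl | rfl)
      · rw [eab]; intro; simp; tauto
      · rw [eac]; intro; simp; tauto
      · rw [ebd]; intro; simp; tauto
    · intro h
      obtain ⟨p, q, hpq, hx⟩ := x.exists_eq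
      simp only [Subtype.ext_iff, eab, eac, ebd]
      rw [hx] at h ⊢
      simp only [insert_subset_iff, singleton_subset_iff, mem_insert, mem_singleton] at h
      rcases h with ⟨rfl | rfl | rfl, rfl | rfl | rfl⟩ <;> simp_all [pair_comm]
  · have h1 := e.2.1
    have h2 := e'.2.1
    have h3 := e''.2.1
    rw [eab] at h1
    rw [eac] at h2
    rw [ebd] at h3
    intro p hp q hq hpq
    simp only [mem_insert, mem_singleton] at hp hq
    rcases hp with rfl | rfl | rfl <;> rcases hq with rfl | rfl | rfl <;>
      first | exact absurd rfl hpq | assumption | (rw [pair_comm]; assumption)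

variable {V₁ V₂ : Type*} [Fintype V₁] [DecidableEq V₁] [Fintype V₂] [DecidableEq V₂]

/-- The 1-skeleton of `T₁` as a spanning minor of the 1-skeleton of `T₂`: `f` maps each vertex to the
branch set containing it, `C` spans the branch sets by trees, and `s` selects the retained edges. -/
structure MinorModel (T₁ : AbstractSimplicialComplex V₁) (T₂ : AbstractSimplicialComplex V₂) where
  f : V₂ → V₁
  s : Edg T₁ → Edg T₂
  C : Finset (Edg T₂)
  surj : Function.Surjective f
  image_s : ∀ e, (s e).1.image f = e.1
  C_fiber : ∀ e ∈ C, ∀ u ∈ e.1, ∀ w ∈ e.1, f u = f w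
  C_conn : ∀ g : V₂ → ZMod 2, (∀ e ∈ C, (edgeVertexMatrix T₂ *ᵥ g) e = 0) →
    ∀ u w, f u = f w → g u = g w
  C_acyclic : ∀ z : Edg T₂ → ZMod 2, (∀ e, e ∉ C → z e = 0) →
    z ᵥ* edgeVertexMatrix T₂ = 0 → z = 0

variable {T₁ : AbstractSimplicialComplex V₁} {T₂ : AbstractSimplicialComplex V₂}

/-- A set of edges within the branch sets that connects them contains spanning trees. -/
theorem exists_minorModel (f : V₂ → V₁) (s : Edg T₁ → Edg T₂) (surj : Function.Surjective f)
    (image_s : ∀ e, (s e).1.image f = e.1)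
    (conn : ∀ g : V₂ → ZMod 2, (∀ e : Edg T₂, (∀ u ∈ e.1, ∀ w ∈ e.1, f u = f w) →
      (edgeVertexMatrix T₂ *ᵥ g) e = 0) → ∀ u w, f u = f w → g u = g w) :
    ∃ m : MinorModel T₁ T₂, m.f = f := by
  let P : Finset (Edg T₂) → Prop := fun C => (∀ e ∈ C, ∀ u ∈ e.1, ∀ w ∈ e.1, f u = f w) ∧
    ∀ g : V₂ → ZMod 2, (∀ e ∈ C, (edgeVertexMatrix T₂ *ᵥ g) e = 0) → ∀ u w, f u = f w → g u = g w
  have hP : ∃ C, P C := ⟨univ.filter fun e : Edg T₂ => ∀ u ∈ e.1, ∀ w ∈ e.1, f u = f w,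
    fun e he => (mem_filter.1 he).2, fun g hg => conn g fun e he => hg e (by simpa using he)⟩
  obtain ⟨C, ⟨hC1, hC2⟩, hmin⟩ := exists_minimal_of_wellFoundedLT P hP
  refine ⟨⟨f, s, C, surj, image_s, hC1, hC2, fun z hz hcyc => ?_⟩, rfl⟩
  by_contra h0
  obtain ⟨e, he⟩ := Function.ne_iff.1 h0
  have heC : e ∈ C := by
    by_contra h
    exact he (hz e h)
  -- A cycle pairs to zero with the coboundary of `g`. When that coboundary vanishes on the rest of
  -- `C`, only the term at `e` is left, so it vanishes at `e` too: an edge on a cycle is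
  -- dispensable, against minimality.
  have : P (C.erase e) := by
    refine ⟨fun e' he' => hC1 e' (mem_of_mem_erase he'), fun g hg => hC2 g fun e' he' => ?_⟩
    by_cases h : e' = e
    · subst h
      have h1 : z ⬝ᵥ (edgeVertexMatrix T₂ *ᵥ g) = 0 := by
        rw [dotProduct_mulVec, hcyc, zero_dotProduct]
      rw [dotProduct, sum_eq_single e'] at h1
      · exact (mul_eq_zero.1 h1).resolve_left he
      · intro x _ hx
        by_cases hxC : x ∈ C
        · rw [hg x (mem_erase.2 ⟨hx, hxC⟩), mul_zero]
        · rw [hz x hxC, zero_mul]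
      · simp
    · exact hg e' (mem_erase.2 ⟨h, he'⟩)
  exact (notMem_erase e C) (hmin this (erase_subset _ _) heC)

namespace MinorModel

variable (m : MinorModel T₁ T₂)

theorem s_injective : Function.Injective m.s := fun e e' h =>
  Subtype.ext (by rw [← m.image_s, ← m.image_s, h])

theorem injOn_s (e : Edg T₁) : Set.InjOn m.f (m.s e).1 :=
  card_image_iff.1 (by rw [m.image_s, e.2.2, (m.s e).2.2])

theorem s_notMem_C (e : Edg T₁) : m.s e ∉ m.C := fun h => by
  obtain ⟨a, b, hab, he⟩ := (m.s e).exists_eq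
  exact hab (m.injOn_s e (by simp [he]) (by simp [he])
    (m.C_fiber _ h a (by simp [he]) b (by simp [he])))

/-- The deleted edges. -/
noncomputable def D : Finset (Edg T₂) := univ.filter fun e => e ∉ m.C ∧ ∀ e₁, m.s e₁ ≠ e

theorem mem_D {e : Edg T₂} : e ∈ m.D ↔ e ∉ m.C ∧ ∀ e₁, m.s e₁ ≠ e := by simp [D]

theorem card_edges : m.C.card + m.D.card + Fintype.card (Edg T₁) = Fintype.card (Edg T₂) := by
  have h : (univ.image m.s).card = Fintype.card (Edg T₁) := by
    rw [card_image_of_injective _ m.s_injective, card_univ]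
  rw [← h, ← card_univ (α := Edg T₂), ← card_union_of_disjoint, ← card_union_of_disjoint]
  · congr 1
    ext e
    simp only [mem_union, m.mem_D, mem_image, mem_univ, true_and, iff_true]
    by_cases h1 : e ∈ m.C
    · simp [h1]
    · by_cases h2 : ∃ a, m.s a = e
      · simp [h2]
      · left; right; push Not at h2; exact ⟨h1, h2⟩
  · rw [disjoint_left]
    intro e he he'
    obtain ⟨e₁, -, rfl⟩ := mem_image.1 he'
    rcases mem_union.1 he with h | h
    · exact m.s_notMem_C _ h
    · exact (m.mem_D.1 h).2 _ rfl
  · rw [disjoint_left]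
    intro e he he'
    exact (m.mem_D.1 he').1 he

/-- A function whose coboundary vanishes on `C` factors through `m.f`. Hence the coboundary
restricted to `C` has kernel of dimension at most `card V₁`, and its rank is at most `C.card`. -/
theorem card_vertices : Fintype.card V₂ ≤ m.C.card + Fintype.card V₁ := by
  let L : (V₂ → ZMod 2) →ₗ[ZMod 2] (m.C → ZMod 2) :=
    (LinearMap.funLeft (ZMod 2) (ZMod 2) (Subtype.val : m.C → Edg T₂)) ∘ₗ
      (edgeVertexMatrix T₂).mulVecLin
  have h1 := L.finrank_range_add_finrank_ker
  have h2 : Module.finrank (ZMod 2) (LinearMap.range L) ≤ m.C.card := by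
    refine (Submodule.finrank_le _).trans ?_
    rw [Module.finrank_pi, Fintype.card_coe]
  have h3 : LinearMap.ker L ≤ LinearMap.range (LinearMap.funLeft (ZMod 2) (ZMod 2) m.f) := by
    intro g hg
    have hg' := m.C_conn g fun e he => congrFun (LinearMap.mem_ker.1 hg) ⟨e, he⟩
    choose r hr using m.surj
    exact ⟨g ∘ r, funext fun w => hg' _ _ (hr _)⟩
  have h4 := (Submodule.finrank_mono h3).trans (LinearMap.finrank_range_le _)
  rw [Module.finrank_pi] at h1 h4
  omega

/-- Two triangles are merged when they share a deleted edge. -/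
def MergeRel (t t' : Tri T₂) : Prop := ∃ e ∈ m.D, e.1 ⊆ t.1 ∧ e.1 ⊆ t'.1

/-- The regions that remain after the deletion of the edges in `D`. -/
def Region : Type _ := Quot m.MergeRel

/-- The region containing a triangle. -/
def region (t : Tri T₂) : m.Region := Quot.mk _ t

theorem region_eq {t t' : Tri T₂} {e : Edg T₂} (he : e ∈ m.D) (h : e.1 ⊆ t.1) (h' : e.1 ⊆ t'.1) :
    m.region t = m.region t' := Quot.sound ⟨e, he, h, h'⟩

theorem region_surjective : Function.Surjective m.region := Quot.mk_surjective

instance : Finite m.Region := Finite.of_surjective _ m.region_surjective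

noncomputable instance : Fintype m.Region := Fintype.ofFinite _

noncomputable instance : DecidableEq m.Region := Classical.decEq _

/-- The dual of the count for vertices: a 2-chain without boundary on `D` is constant on regions. -/
theorem card_tri (hT₂ : IsMod2Sphere T₂) :
    Fintype.card (Tri T₂) ≤ m.D.card + Fintype.card m.Region := by
  let L : (Tri T₂ → ZMod 2) →ₗ[ZMod 2] (m.D → ZMod 2) :=
    (LinearMap.funLeft (ZMod 2) (ZMod 2) (Subtype.val : m.D → Edg T₂)) ∘ₗ
      (triEdgeMatrix T₂).vecMulLinear
  have h1 := L.finrank_range_add_finrank_ker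
  have h2 : Module.finrank (ZMod 2) (LinearMap.range L) ≤ m.D.card := by
    refine (Submodule.finrank_le _).trans ?_
    rw [Module.finrank_pi, Fintype.card_coe]
  have h3 : LinearMap.ker L ≤ LinearMap.range (LinearMap.funLeft (ZMod 2) (ZMod 2) m.region) := by
    intro c hc
    refine ⟨Quot.lift c ?_, rfl⟩
    rintro t t' ⟨e, he, h, h'⟩
    exact (hT₂.vecMul_eq_zero_iff c e).1 (congrFun (LinearMap.mem_ker.1 hc) ⟨e, he⟩) t t' h h'
  have h4 := (Submodule.finrank_mono h3).trans (LinearMap.finrank_range_le _)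
  rw [Module.finrank_pi] at h1 h4
  omega

/-- The number of regions is at least `F₂ - |D| = F₂ - E₂ + E₁ + |C|`, hence at least `F₂ - E₂ + V₂
+ E₁ - V₁`. By Euler's formula on both sides this is `2 + E₁ - V₁ = F₁`. -/
theorem card_tri_le_card_region (hT₁ : IsMod2Sphere T₁) (hT₂ : IsMod2Sphere T₂) :
    Fintype.card (Tri T₁) ≤ Fintype.card m.Region := by
  have h1 := hT₁.euler
  have h2 := hT₂.euler
  have h3 := m.card_tri hT₂
  have h4 := m.card_vertices
  have h5 := m.card_edges
  omega

/-- The mod 2 chain of `T₂` given by a combination of regions. -/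
def regionChain (c : m.Region → ZMod 2) : Tri T₂ → ZMod 2 := fun t => c (m.region t)

/-- The boundary of a combination of regions, as a chain of `T₁`. -/
noncomputable def bd (c : m.Region → ZMod 2) : Edg T₁ → ZMod 2 := fun e =>
  (m.regionChain c ᵥ* triEdgeMatrix T₂) (m.s e)

theorem bd_eq_zero_iff (hT₂ : IsMod2Sphere T₂) (c : m.Region → ZMod 2) (e : Edg T₁) :
    m.bd c e = 0 ↔ ∀ t t' : Tri T₂, (m.s e).1 ⊆ t.1 → (m.s e).1 ⊆ t'.1 →
      c (m.region t) = c (m.region t') :=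
  hT₂.vecMul_eq_zero_iff _ _

theorem regionChain_D (hT₂ : IsMod2Sphere T₂) (c : m.Region → ZMod 2) {e : Edg T₂} (he : e ∈ m.D) :
    (m.regionChain c ᵥ* triEdgeMatrix T₂) e = 0 :=
  (hT₂.vecMul_eq_zero_iff _ _).2 fun _ _ h h' => congrArg c (m.region_eq he h h')

/-- The boundary in `T₂` of a combination of regions never meets `D`. If it also misses the edges `s
e`, it is a cycle inside the forest `C`, hence zero, and only constant 2-chains are closed. -/
theorem const_of_bd_eq_zero (hT₂ : IsMod2Sphere T₂) (c : m.Region → ZMod 2) (h : m.bd c = 0) :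
    ∃ a, c = fun _ => a := by
  have h0 : m.regionChain c ᵥ* triEdgeMatrix T₂ = 0 := by
    refine m.C_acyclic _ (fun e he => ?_) ?_
    · by_cases hs : ∃ e₁, m.s e₁ = e
      · obtain ⟨e₁, rfl⟩ := hs
        exact congrFun h e₁
      · push Not at hs
        exact m.regionChain_D hT₂ c (m.mem_D.2 ⟨he, hs⟩)
    · rw [vecMul_vecMul, triEdgeMatrix_mul_edgeVertexMatrix, vecMul_zero]
  obtain ⟨a, ha⟩ := hT₂.h2 _ h0
  refine ⟨a, funext fun p => ?_⟩
  obtain ⟨t, rfl⟩ := m.region_surjective p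
  exact congrFun ha t

theorem mulVec_comp_C (h : V₁ → ZMod 2) {e : Edg T₂} (he : e ∈ m.C) :
    (edgeVertexMatrix T₂ *ᵥ (h ∘ m.f)) e = 0 := by
  obtain ⟨a, b, hab, h'⟩ := e.exists_eq
  rw [edgeVertexMatrix_mulVec, h', sum_pair hab, Function.comp, Function.comp,
    m.C_fiber e he a (by simp [h']) b (by simp [h'])]
  exact CharTwo.add_self_eq_zero _

theorem mulVec_comp_s (h : V₁ → ZMod 2) (e : Edg T₁) :
    (edgeVertexMatrix T₂ *ᵥ (h ∘ m.f)) (m.s e) = (edgeVertexMatrix T₁ *ᵥ h) e := by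
  rw [edgeVertexMatrix_mulVec, edgeVertexMatrix_mulVec, ← m.image_s, sum_image (m.injOn_s e)]
  rfl

/-- Pair with a function `h` on `V₁`. The coboundary of `h ∘ m.f` vanishes on `C` and equals that of
`h` on the edges `s e`, while the region chain has no boundary on `D`. So the pairing can be
computed in `T₂`, where `∂∂ = 0`. -/
theorem bd_cycle (hT₂ : IsMod2Sphere T₂) (c : m.Region → ZMod 2) :
    m.bd c ᵥ* edgeVertexMatrix T₁ = 0 := by
  have key : ∀ h : V₁ → ZMod 2, (m.bd c ᵥ* edgeVertexMatrix T₁) ⬝ᵥ h = 0 := by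
    intro h
    have h0 : (m.regionChain c ᵥ* triEdgeMatrix T₂) ⬝ᵥ (edgeVertexMatrix T₂ *ᵥ (h ∘ m.f)) = 0 := by
      rw [dotProduct_mulVec, vecMul_vecMul, triEdgeMatrix_mul_edgeVertexMatrix, vecMul_zero,
        zero_dotProduct]
    rw [← dotProduct_mulVec, ← h0]
    refine Fintype.sum_of_injective m.s m.s_injective _ _ (fun e he => ?_) (fun e => ?_)
    · by_cases heC : e ∈ m.C
      · rw [m.mulVec_comp_C h heC, mul_zero]
      · rw [m.regionChain_D hT₂ c (m.mem_D.2 ⟨heC, fun e₁ h' => he ⟨e₁, h'⟩⟩), zero_mul]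
    · rw [m.mulVec_comp_s]; rfl
  ext v
  simpa using key (Pi.single v 1)

theorem bd_eq_sum (c : m.Region → ZMod 2) (e : Edg T₁) :
    m.bd c e = ∑ p, c p * m.bd (Pi.single p 1) e := by
  simp only [bd, vecMul_triEdgeMatrix, mul_sum, regionChain]
  rw [sum_comm]
  refine sum_congr rfl fun t _ => ?_
  rw [sum_eq_single (m.region t)]
  · simp
  · intro p _ hp
    simp [hp.symm]
  · simp

/-- Otherwise the indicator of `p` is constant, so `p` is the only region. But there are at least as
many regions as triangles of `T₁`, of which there are at least two. -/
theorem bd_single_ne_zero (hT₁ : IsMod2Sphere T₁) (hT₂ : IsMod2Sphere T₂) (p : m.Region) :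
    m.bd (Pi.single p 1) ≠ 0 := by
  intro h
  obtain ⟨a, ha⟩ := m.const_of_bd_eq_zero hT₂ _ h
  have hsub : ∀ q, q = p := fun q => by
    by_contra hq
    have h1 := congrFun ha p
    have h2 := congrFun ha q
    rw [Pi.single_eq_same] at h1
    rw [Pi.single_eq_of_ne hq, ← h1] at h2
    exact zero_ne_one h2
  have h1 : Fintype.card m.Region ≤ 1 := Fintype.card_le_one_iff.2 fun a b => by
    rw [hsub a, hsub b]
  have h2 := m.card_tri_le_card_region hT₁ hT₂
  obtain ⟨v⟩ := hT₁.nonempty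
  obtain ⟨e, -⟩ := hT₁.exists_edge v
  have h3 := hT₁.two e
  have h4 := card_le_univ (univ.filter fun t : Tri T₁ => e.1 ⊆ t.1)
  omega

/-- At most the two regions at the edge `s e` have `e` in their boundary. -/
theorem card_region_edge (hT₂ : IsMod2Sphere T₂) (e : Edg T₁) :
    (univ.filter fun p => m.bd (Pi.single p 1) e ≠ 0).card ≤ 2 ∧
      ((univ.filter fun p => m.bd (Pi.single p 1) e ≠ 0).card = 2 → ∀ t t' : Tri T₂, t ≠ t' →
        (m.s e).1 ⊆ t.1 → (m.s e).1 ⊆ t'.1 → m.region t ≠ m.region t') := by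
  obtain ⟨t, t', hne, h'⟩ := hT₂.exists_two (m.s e)
  have hm : ∀ x : Tri T₂, (m.s e).1 ⊆ x.1 ↔ x = t ∨ x = t' := fun x => by
    have : x ∈ (univ.filter fun t : Tri T₂ => (m.s e).1 ⊆ t.1) ↔ x ∈ ({t, t'} : Finset _) := by
      rw [h']
    simpa using this
  have hsub : (univ.filter fun p => m.bd (Pi.single p 1) e ≠ 0) ⊆ {m.region t, m.region t'} := by
    intro p hp
    by_contra hp'
    simp only [mem_insert, mem_singleton, not_or] at hp'
    refine (mem_filter.1 hp).2 ((m.bd_eq_zero_iff hT₂ _ _).2 ?_)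
    simp only [hm]
    rintro _ _ (rfl | rfl) (rfl | rfl) <;>
      simp [Ne.symm hp'.1, Ne.symm hp'.2]
  refine ⟨(card_le_card hsub).trans card_le_two, fun h2 => ?_⟩
  have hne' : m.region t ≠ m.region t' := fun h => by
    have := card_le_card hsub
    rw [h, pair_eq_singleton, card_singleton] at this
    omega
  simp only [hm]
  rintro _ _ hx (rfl | rfl) (rfl | rfl)
  · exact absurd rfl hx
  · exact hne'
  · exact hne'.symm
  · exact absurd rfl hx

/-- Double counting of incidences between `R` regions and edges of `T₁`: `3F₁ ≤ 3R ≤ incidences ≤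
2E₁ = 3F₁`, so every local inequality is an equality. -/
theorem card_support (hT₁ : IsMod2Sphere T₁) (hT₂ : IsMod2Sphere T₂) :
    (∀ p, (univ.filter fun e => m.bd (Pi.single p 1) e ≠ 0).card = 3) ∧
      ∀ e, (univ.filter fun p => m.bd (Pi.single p 1) e ≠ 0).card = 2 := by
  have h1 : ∀ p ∈ univ, 3 ≤ (univ.filter fun e => m.bd (Pi.single p 1) e ≠ 0).card := fun p _ =>
    (cycle_support (m.bd_cycle hT₂ _) (m.bd_single_ne_zero hT₁ hT₂ p)).1
  have h2 : ∀ e ∈ univ, (univ.filter fun p => m.bd (Pi.single p 1) e ≠ 0).card ≤ 2 := fun e _ =>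
    (m.card_region_edge hT₂ e).1
  have h3 := sum_card_bipartiteAbove_eq_sum_card_bipartiteBelow (s := (univ : Finset m.Region))
    (t := (univ : Finset (Edg T₁))) (fun p e => m.bd (Pi.single p 1) e ≠ 0)
  simp only [bipartiteAbove, bipartiteBelow] at h3
  have h4 := sum_le_sum h1
  have h5 := sum_le_sum h2
  have h6 := hT₁.three_mul_card_tri
  have h7 := m.card_tri_le_card_region hT₁ hT₂
  simp only [sum_const, smul_eq_mul, card_univ] at h4 h5
  have h8 := (sum_eq_sum_iff_of_le h1).1 (by simp only [sum_const, smul_eq_mul, card_univ]; omega)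
  have h9 := (sum_eq_sum_iff_of_le h2).1 (by simp only [sum_const, smul_eq_mul, card_univ]; omega)
  exact ⟨fun p => (h8 p (mem_univ _)).symm, fun e => h9 e (mem_univ _)⟩

/-- The regions are bounded by 3-cycles. -/
theorem exists_cells (hT₁ : IsMod2Sphere T₁) (hT₂ : IsMod2Sphere T₂) :
    ∃ τ : m.Region → Finset V₁, ∀ p, (τ p).card = 3 ∧
      (∀ e, m.bd (Pi.single p 1) e ≠ 0 ↔ e.1 ⊆ τ p) ∧
        ∀ x ∈ τ p, ∀ y ∈ τ p, x ≠ y → {x, y} ∈ T₁.faces := by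
  choose τ hτ using fun p => (cycle_support (m.bd_cycle hT₂ _)
    (m.bd_single_ne_zero hT₁ hT₂ p)).2 ((m.card_support hT₁ hT₂).1 p)
  exact ⟨τ, hτ⟩

end MinorModel
end SphereModels

/-! ### Connected links, and why the cells are faces. -/

section FacialTriangles

open Finset Matrix

variable {V : Type*} [Fintype V] [DecidableEq V] {T : AbstractSimplicialComplex V}

theorem Tri.exists_eq_of_mem (t : Tri T) {v : V} (hv : v ∈ t.1) :
    ∃ x y, v ≠ x ∧ v ≠ y ∧ x ≠ y ∧ t.1 = {v, x, y} := by
  obtain ⟨a, b, c, hab, hac, hbc, h⟩ := card_eq_three.1 t.2.2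
  rw [h] at hv
  simp only [mem_insert, mem_singleton] at hv
  rcases hv with rfl | rfl | rfl
  · exact ⟨b, c, hab, hac, hbc, h⟩
  · exact ⟨a, c, hab.symm, hbc, hac, h.trans (insert_comm _ _ _)⟩
  · exact ⟨a, b, hac.symm, hbc.symm, hab, by rw [h, pair_comm b, insert_comm]⟩

/-- A mod 2 chain without boundary at a vertex is constant around that vertex: the link of a vertex
is connected. -/
theorem IsMod2Sphere.eq_of_boundary_eq_zero_at (hT : IsMod2Sphere T) (d : Tri T → ZMod 2) (v : V)
    (hv : ∀ e : Edg T, v ∈ e.1 → (d ᵥ* triEdgeMatrix T) e = 0) {t t' : Tri T} (ht : v ∈ t.1)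
    (ht' : v ∈ t'.1) : d t = d t' := by
  classical
  have hd : ∀ e : Edg T, v ∈ e.1 → ∀ t t' : Tri T, e.1 ⊆ t.1 → e.1 ⊆ t'.1 → d t = d t' :=
    fun e he => (hT.vecMul_eq_zero_iff d e).1 (hv e he)
  -- `φ` carries the common value of `d` on each edge at `v` and is zero elsewhere. It is a cocycle
  -- because a triangle at `v` has exactly two edges at `v`, with equal values.
  let φ : Edg T → ZMod 2 := fun e => if v ∈ e.1 ∧ ∃ t : Tri T, e.1 ⊆ t.1 ∧ d t = 1 then 1 else 0
  have hφ : ∀ (e : Edg T) (t : Tri T), v ∈ e.1 → e.1 ⊆ t.1 → φ e = d t := by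
    intro e t he het
    rcases zmod2_cases (d t) with h | h
    · rw [h]
      refine if_neg ?_
      rintro ⟨-, t', ht', h'⟩
      rw [hd e he t t' het ht', h'] at h
      exact one_ne_zero h
    · rw [h]
      exact if_pos ⟨he, t, het, h⟩
  have hφ' : ∀ e : Edg T, v ∉ e.1 → φ e = 0 := fun e he => if_neg fun h => he h.1
  obtain ⟨g, hg⟩ := hT.h1 φ (by
    ext t
    rw [triEdgeMatrix_mulVec]
    by_cases hvt : v ∈ t.1
    · obtain ⟨x, y, hx, hy, hxy, h⟩ := t.exists_eq_of_mem hvt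
      rw [sum_edges_of_tri _ t hx hy hxy h, hφ _ t, hφ _ t, hφ', add_zero]
      · exact CharTwo.add_self_eq_zero _
      all_goals simp [Tri.edge, h, insert_subset_iff, hx, hy]
    · refine sum_eq_zero fun e he => hφ' e fun h => hvt ((mem_filter.1 he).2 h))
  have hadd : ∀ (t : Tri T) (x y : V) (hx : x ∈ t.1) (hy : y ∈ t.1) (h : x ≠ y),
      φ (t.edge hx hy h) = g x + g y := by
    intro t x y hx hy h
    rw [hg, edgeVertexMatrix_mulVec, Tri.edge, sum_pair h]
  have hg1 : ∀ (t : Tri T) (x y : V), x ∈ t.1 → y ∈ t.1 → x ≠ v → y ≠ v → g x = g y := by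
    intro t x y hx hy hxv hyv
    by_cases h : x = y
    · rw [h]
    · rw [← zmod2_add_eq_zero, ← hadd t x y hx hy h]
      exact hφ' _ (by simp [Tri.edge, hxv.symm, hyv.symm])
  -- The potential `g` of `φ` is constant on the vertices of a triangle other than `v`; this value
  -- is `k`. Every edge has an end different from `v`, so `k` agrees on adjacent triangles and is a
  -- constant `a`. At `v` this gives `d t = g v + a`.
  let k : Tri T → ZMod 2 := fun t => if ∃ x ∈ t.1, x ≠ v ∧ g x = 1 then 1 else 0
  have hk : ∀ (t : Tri T) (x : V), x ∈ t.1 → x ≠ v → k t = g x := by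
    intro t x hx hxv
    rcases zmod2_cases (g x) with h | h
    · rw [h]
      refine if_neg ?_
      rintro ⟨y, hy, hyv, h'⟩
      rw [hg1 t x y hx hy hxv hyv, h'] at h
      exact one_ne_zero h
    · rw [h]
      exact if_pos ⟨x, hx, hxv, h⟩
  obtain ⟨a, ha⟩ := hT.h2 k (by
    ext e
    refine (hT.vecMul_eq_zero_iff k e).2 fun t t' ht ht' => ?_
    obtain ⟨x, y, hxy, he⟩ := e.exists_eq
    obtain ⟨x, hx, hxv⟩ : ∃ x ∈ e.1, x ≠ v := by
      by_cases h : x = v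
      · exact ⟨y, by simp [he], fun h' => hxy (h.trans h'.symm)⟩
      · exact ⟨x, by simp [he], h⟩
    rw [hk t x (ht hx) hxv, hk t' x (ht' hx) hxv])
  have hda : ∀ t : Tri T, v ∈ t.1 → d t = g v + a := by
    intro t ht
    obtain ⟨x, y, hx, hy, hxy, h⟩ := t.exists_eq_of_mem ht
    have hxt : x ∈ t.1 := by simp [h]
    rw [← hφ (t.edge ht hxt hx) t (by simp [Tri.edge])
      (by simp [Tri.edge, h, insert_subset_iff]), hadd, ← hk t x hxt hx.symm, ha]
  rw [hda t ht, hda t' ht']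

theorem card_edges_subset_le (τ : Finset V) (hτ : τ.card = 3) :
    (univ.filter fun e : Edg T => e.1 ⊆ τ).card ≤ 3 := by
  have : ((univ.filter fun e : Edg T => e.1 ⊆ τ).map (Function.Embedding.subtype _)) ⊆
      τ.powersetCard 2 := by
    intro s hs
    obtain ⟨e, he, rfl⟩ := mem_map.1 hs
    exact mem_powersetCard.2 ⟨(mem_filter.1 he).2, e.2.2⟩
  have h := card_le_card this
  rw [card_map, card_powersetCard, hτ] at h
  exact h

/-- A nonzero cycle has at least three edges, and three vertices span at most three. -/
theorem eq_zero_or_eq_of_cycle_subset {τ : Finset V} (hτ : τ.card = 3) {w : Edg T → ZMod 2}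
    (hw : w ᵥ* edgeVertexMatrix T = 0) (hsupp : ∀ e, w e ≠ 0 → e.1 ⊆ τ) :
    w = 0 ∨ w = fun e => if e.1 ⊆ τ then 1 else 0 := by
  by_cases h0 : w = 0
  · exact Or.inl h0
  · right
    have h1 := (cycle_support hw h0).1
    have h2 : (univ.filter fun e => w e ≠ 0) = univ.filter fun e : Edg T => e.1 ⊆ τ :=
      eq_of_subset_of_card_le (fun e he => by simpa using hsupp e (by simpa using he))
        ((card_edges_subset_le τ hτ).trans h1)
    ext e
    have : e ∈ (univ.filter fun e => w e ≠ 0) ↔ e ∈ univ.filter fun e : Edg T => e.1 ⊆ τ := by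
      rw [h2]
    simp only [mem_filter, mem_univ, true_and] at this
    by_cases h : e.1 ⊆ τ
    · rw [if_pos h]; exact zmod2_eq_one (this.2 h)
    · rw [if_neg h]; by_contra h'; exact h (this.1 h')

/-- If the 1-skeleton of a triangulated sphere has a second family of 3-cycles that forms a sphere,
then these cycles bound triangles of the triangulation. -/
theorem IsMod2Sphere.mem_faces_of_cells (hT : IsMod2Sphere T) {P : Type*} [Fintype P]
    [DecidableEq P] (τ : P → Finset V) (hcard : ∀ p, (τ p).card = 3)
    (hpair : ∀ p, ∀ x ∈ τ p, ∀ y ∈ τ p, x ≠ y → {x, y} ∈ T.faces)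
    (htwo : ∀ e : Edg T, (univ.filter fun p => e.1 ⊆ τ p).card = 2)
    (hcyc : ∀ p, (fun e : Edg T => if e.1 ⊆ τ p then (1 : ZMod 2) else 0) ᵥ*
      edgeVertexMatrix T = 0)
    (hconst : ∀ c : P → ZMod 2, (∀ e : Edg T, ∑ p with e.1 ⊆ τ p, c p = 0) → ∃ a, c = fun _ => a)
    (p₀ : P) : τ p₀ ∈ T.faces := by
  classical
  by_contra hface
  set z : Edg T → ZMod 2 := fun e => if e.1 ⊆ τ p₀ then 1 else 0 with hz
  obtain ⟨d, hd⟩ := hT.exists_eq_vecMul z (hcyc p₀)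
  -- The chain `d` jumps only across edges of `τ p₀`, so each vertex off `τ p₀` lies on a definite
  -- side.
  have hside : ∀ v ∉ τ p₀, ∀ t t' : Tri T, v ∈ t.1 → v ∈ t'.1 → d t = d t' := by
    intro v hv t t' ht ht'
    refine hT.eq_of_boundary_eq_zero_at d v (fun e he => ?_) ht ht'
    rw [← hd]
    exact if_neg fun h => hv (h he)
  have hout : ∀ t : Tri T, ∃ v ∈ t.1, v ∉ τ p₀ := by
    intro t
    by_contra! h
    have : t.1 = τ p₀ := eq_of_subset_of_card_le h (by rw [hcard, t.2.2])
    exact hface (this ▸ t.2.1)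
  have htri : ∀ v : V, ∃ t : Tri T, v ∈ t.1 := fun v => by
    obtain ⟨e, he⟩ := hT.exists_edge v
    obtain ⟨t, ht⟩ := hT.exists_tri_of_face e.2.1
    exact ⟨t, ht he⟩
  have hcell : ∀ v : V, ∃ p, v ∈ τ p := fun v => by
    obtain ⟨e, he⟩ := hT.exists_edge v
    obtain ⟨p, hp⟩ := card_pos.1 (by rw [htwo e]; norm_num :
      0 < (univ.filter fun p => e.1 ⊆ τ p).card)
    exact ⟨p, (mem_filter.1 hp).2 he⟩
  -- The side of a cell. It is well defined because any two of its vertices are adjacent; `p₀` has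
  -- no vertex off `τ p₀` and gets the default `0`.
  let q : P → ZMod 2 := fun p =>
    if ∃ v ∈ τ p, v ∉ τ p₀ ∧ ∃ t : Tri T, v ∈ t.1 ∧ d t = 1 then 1 else 0
  have hq : ∀ p, ∀ v ∈ τ p, v ∉ τ p₀ → ∀ t : Tri T, v ∈ t.1 → q p = d t := by
    intro p v hv hv' t ht
    rcases zmod2_cases (d t) with h | h
    · rw [h]
      refine if_neg ?_
      rintro ⟨x, hx, hx', t', ht', h'⟩
      have : d t = d t' := by
        by_cases hxv : v = x
        · subst hxv; exact hside v hv' t t' ht ht'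
        · obtain ⟨t'', h''⟩ := hT.exists_tri_of_face (hpair p v hv x hx hxv)
          rw [hside v hv' t t'' ht (h'' (by simp)), hside x hx' t'' t' (h'' (by simp)) ht']
      rw [this, h'] at h
      exact one_ne_zero h
    · rw [h]
      exact if_pos ⟨v, hv, hv', t, ht, h⟩
  -- The boundary of the union of the cells on side `1`. At an edge with an end off `τ p₀`, both
  -- cells lie on the side of that end and cancel, so `w` lives on `τ p₀`.
  let w : Edg T → ZMod 2 := fun e => ∑ p with e.1 ⊆ τ p, q p
  have hwcyc : w ᵥ* edgeVertexMatrix T = 0 := by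
    have : w = ∑ p, q p • fun e : Edg T => if e.1 ⊆ τ p then (1 : ZMod 2) else 0 := by
      ext e
      simp [w, sum_filter]
    rw [this, Matrix.sum_vecMul]
    refine sum_eq_zero fun p _ => ?_
    rw [smul_vecMul, hcyc, smul_zero]
  have hwsupp : ∀ e, w e ≠ 0 → e.1 ⊆ τ p₀ := by
    intro e he v hv
    by_contra hv'
    apply he
    obtain ⟨t, ht⟩ := htri v
    have : ∀ p ∈ univ.filter (fun p => e.1 ⊆ τ p), q p = d t := fun p hp =>
      hq p v ((mem_filter.1 hp).2 hv) hv' t ht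
    change ∑ p with e.1 ⊆ τ p, q p = 0
    rw [sum_congr rfl this, sum_const, htwo, two_nsmul]
    exact CharTwo.add_self_eq_zero _
  have hq0 : q p₀ = 0 := if_neg fun ⟨v, hv, hv', _⟩ => hv' hv
  obtain ⟨a, b, c, hab, hac, hbc, habc⟩ := card_eq_three.1 (hcard p₀)
  have hz0 : z ≠ 0 := fun h => by
    have hf := hpair p₀ a (by simp [habc]) b (by simp [habc]) hab
    have := congrFun h ⟨{a, b}, hf, card_pair hab⟩
    rw [hz] at this
    simp [habc, insert_subset_iff] at this
  have hval : ∀ r : ZMod 2, ∃ t : Tri T, d t = r := by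
    intro r
    by_contra! h
    refine hz0 ?_
    rw [hd]
    ext e
    refine (hT.vecMul_eq_zero_iff d e).2 fun t t' _ _ => ?_
    have h1 := h t
    have h2 := h t'
    have key : ∀ r x y : ZMod 2, x ≠ r → y ≠ r → x = y := by decide
    exact key _ _ _ h1 h2
  -- Both sides contain a cell other than `p₀`: `d` takes both values since its boundary `z` is
  -- nonzero, and each triangle of `T` has a vertex off `τ p₀` because `τ p₀` is not a face.
  have hqval : ∀ r : ZMod 2, ∃ p, p ≠ p₀ ∧ q p = r := by
    intro r
    obtain ⟨t, ht⟩ := hval r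
    obtain ⟨v, hv, hv'⟩ := hout t
    obtain ⟨p, hp⟩ := hcell v
    exact ⟨p, fun h => hv' (h ▸ hp), by rw [hq p v hp hv' t hv, ht]⟩
  obtain ⟨p1, -, hp1⟩ := hqval 1
  obtain ⟨p2, hp2', hp2⟩ := hqval 0
  -- Either the cells on side `1` form a closed chain, or they do after adding `p₀`. The first chain
  -- contains `p1` but not `p₀`, the second contains `p₀` but not `p2`, so neither is constant.
  rcases eq_zero_or_eq_of_cycle_subset (hcard p₀) hwcyc hwsupp with h | h
  · obtain ⟨a, ha⟩ := hconst q (fun e => congrFun h e)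
    have h1 := congrFun ha p1
    have h2 := congrFun ha p₀
    rw [hp1] at h1
    rw [hq0, ← h1] at h2
    exact zero_ne_one h2
  · obtain ⟨a, ha⟩ := hconst (q + Pi.single p₀ 1) (fun e => by
      have h1 : (∑ p with e.1 ⊆ τ p, q p) = z e := congrFun h e
      simp only [Pi.add_apply, sum_add_distrib]
      rw [h1]
      have : ∑ p with e.1 ⊆ τ p, (Pi.single p₀ 1 : P → ZMod 2) p = z e := by
        simp [Pi.single_apply, hz]
      rw [this]
      exact CharTwo.add_self_eq_zero _)
    have h1 := congrFun ha p2
    have h2 := congrFun ha p₀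
    rw [Pi.add_apply, hp2, Pi.single_eq_of_ne hp2', add_zero] at h1
    rw [Pi.add_apply, hq0, Pi.single_eq_same, zero_add, ← h1] at h2
    exact one_ne_zero h2

end FacialTriangles

/-! ### The branch map is simplicial. -/

section Simpliciality

open Finset Matrix

variable {V₁ V₂ : Type*} [Fintype V₁] [DecidableEq V₁] [Fintype V₂] [DecidableEq V₂]
  {T₁ : AbstractSimplicialComplex V₁} {T₂ : AbstractSimplicialComplex V₂}

namespace MinorModel

variable (m : MinorModel T₁ T₂)

/-- If the region met the fibre over some `v` outside its cell, the edges leaving that fibre within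
the region would form a cocycle. Its potential descends to `T₁` and is constant there, so no edge of
the region leaves the fibre. The whole region then collapses to `v`, although its boundary maps onto
the cell. -/
theorem image_subset_cell (hT₁ : IsMod2Sphere T₁) (hT₂ : IsMod2Sphere T₂)
    {τ : Finset V₁} {p : m.Region} (hcard : τ.card = 3)
    (hpair : ∀ x ∈ τ, ∀ y ∈ τ, x ≠ y → {x, y} ∈ T₁.faces)
    (hτ : ∀ e, m.bd (Pi.single p 1) e ≠ 0 ↔ e.1 ⊆ τ) (t : Tri T₂) (ht : m.region t = p)
    {x : V₂} (hx : x ∈ t.1) : m.f x ∈ τ := by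
  classical
  by_contra hv
  set v := m.f x with hvx
  let h : V₁ → ZMod 2 := Pi.single v 1
  let cut : Edg T₂ → ZMod 2 := edgeVertexMatrix T₂ *ᵥ (h ∘ m.f)
  let φ : Edg T₂ → ZMod 2 := fun e => if ∃ t : Tri T₂, e.1 ⊆ t.1 ∧ m.region t = p then cut e else 0
  have hS : ∀ e₁, (∃ t t' : Tri T₂, (m.s e₁).1 ⊆ t.1 ∧ (m.s e₁).1 ⊆ t'.1 ∧ m.region t = p ∧
      m.region t' ≠ p) → e₁.1 ⊆ τ := by
    rintro e₁ ⟨t, t', h1, h2, h3, h4⟩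
    rw [← hτ]
    intro h0
    have := (m.bd_eq_zero_iff hT₂ _ _).1 h0 t t' h1 h2
    rw [h3, Pi.single_eq_same, Pi.single_eq_of_ne h4] at this
    exact one_ne_zero this
  have hcutS : ∀ e₁ : Edg T₁, e₁.1 ⊆ τ → cut (m.s e₁) = 0 := by
    intro e₁ he₁
    change (edgeVertexMatrix T₂ *ᵥ (h ∘ m.f)) (m.s e₁) = 0
    rw [m.mulVec_comp_s, edgeVertexMatrix_mulVec]
    exact sum_eq_zero fun u hu => Pi.single_eq_of_ne (fun h' => hv (by rw [← h']; exact he₁ hu)) _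
  -- On the region, `φ` is the coboundary `cut`. An edge shared with a triangle outside is not in
  -- `D`, hence is in `C` or of the form `s e₁` with `e₁` in the cell, and `cut` vanishes on both
  -- kinds.
  have hφ : triEdgeMatrix T₂ *ᵥ φ = 0 := by
    have hcut : triEdgeMatrix T₂ *ᵥ cut = 0 := by
      rw [mulVec_mulVec, triEdgeMatrix_mul_edgeVertexMatrix, zero_mulVec]
    ext t'
    by_cases hp : m.region t' = p
    · rw [← hcut, triEdgeMatrix_mulVec, triEdgeMatrix_mulVec]
      exact sum_congr rfl fun e he => if_pos ⟨t', (mem_filter.1 he).2, hp⟩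
    · rw [triEdgeMatrix_mulVec]
      refine sum_eq_zero fun e he => ?_
      have het' := (mem_filter.1 he).2
      by_cases hex : ∃ t : Tri T₂, e.1 ⊆ t.1 ∧ m.region t = p
      · refine (if_pos hex).trans ?_
        obtain ⟨t'', h1, h2⟩ := hex
        by_cases hC : e ∈ m.C
        · exact m.mulVec_comp_C h hC
        · by_cases hs : ∃ e₁, m.s e₁ = e
          · obtain ⟨e₁, rfl⟩ := hs
            exact hcutS e₁ (hS e₁ ⟨t'', t', h1, het', h2, hp⟩)
          · push Not at hs
            exact absurd ((m.region_eq (m.mem_D.2 ⟨hC, hs⟩) het' h1).trans h2) hp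
      · exact if_neg hex
  obtain ⟨g, hg⟩ := hT₂.h1 φ hφ
  have hgC : ∀ u w, m.f u = m.f w → g u = g w := m.C_conn g fun e he => by
    rw [← hg]
    by_cases hex : ∃ t : Tri T₂, e.1 ⊆ t.1 ∧ m.region t = p
    · exact (if_pos hex).trans (m.mulVec_comp_C h he)
    · exact if_neg hex
  obtain ⟨r, hr⟩ : ∃ r : V₁ → V₂, ∀ v, m.f (r v) = v := ⟨_, Function.surjInv_eq m.surj⟩
  have hgf : g = (g ∘ r) ∘ m.f := funext fun w => hgC _ _ (hr _).symm
  -- The two regions at `s e₁` are distinct. So if the region `p` touches `s e₁`, this edge is on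
  -- its boundary and `e₁` lies in the cell.
  have hφS : ∀ e₁, φ (m.s e₁) = 0 := by
    intro e₁
    by_cases hex : ∃ t : Tri T₂, (m.s e₁).1 ⊆ t.1 ∧ m.region t = p
    · refine (if_pos hex).trans ?_
      obtain ⟨t, ht, htp⟩ := hex
      obtain ⟨a, b, hab, hab'⟩ := hT₂.exists_two (m.s e₁)
      have hm : ∀ x : Tri T₂, (m.s e₁).1 ⊆ x.1 ↔ x = a ∨ x = b := fun x => by
        have : x ∈ (univ.filter fun t : Tri T₂ => (m.s e₁).1 ⊆ t.1) ↔ x ∈ ({a, b} : Finset _) := by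
          rw [hab']
        simpa using this
      have hne := (m.card_region_edge hT₂ e₁).2 ((m.card_support hT₁ hT₂).2 e₁) a b hab
        ((hm a).2 (Or.inl rfl)) ((hm b).2 (Or.inr rfl))
      refine hcutS e₁ (hS e₁ ?_)
      rcases (hm t).1 ht with rfl | rfl
      · exact ⟨t, b, ht, (hm b).2 (Or.inr rfl), htp, fun h' => hne (htp.trans h'.symm)⟩
      · exact ⟨t, a, ht, (hm a).2 (Or.inl rfl), htp, fun h' => hne (h'.trans htp.symm)⟩
    · exact if_neg hex
  obtain ⟨a, ha⟩ := hT₁.conn (g ∘ r) (by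
    ext e₁
    rw [← m.mulVec_comp_s, ← hgf, ← hg, hφS]; rfl)
  have hφ0 : φ = 0 := by
    rw [hg, hgf, ha]
    exact edgeVertexMatrix_mulVec_const a
  have hinside : ∀ t : Tri T₂, m.region t = p → (∃ u ∈ t.1, m.f u = v) → ∀ w ∈ t.1, m.f w = v := by
    rintro t ht ⟨u, hu, huv⟩ w hw
    by_contra hwv
    have huw : u ≠ w := by rintro rfl; exact hwv huv
    have h1 := congrFun hφ0 (t.edge hu hw huw)
    have h2 : φ (t.edge hu hw huw) = cut (t.edge hu hw huw) :=
      if_pos ⟨t, by simp [Tri.edge, insert_subset_iff, hu, hw], ht⟩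
    rw [h2] at h1
    change (edgeVertexMatrix T₂ *ᵥ (h ∘ m.f)) _ = 0 at h1
    rw [edgeVertexMatrix_mulVec, Tri.edge, sum_pair huw] at h1
    simp only [Function.comp, h, huv, Pi.single_eq_same, Pi.single_eq_of_ne hwv, add_zero] at h1
    exact one_ne_zero h1
  -- Triangles merged through `D` share vertices, so being contained in the fibre over `v` spreads
  -- from one triangle to the whole region.
  let Q : m.Region → Prop := Quot.lift (fun t => m.region t = p → ∀ w ∈ t.1, m.f w = v) (by
    rintro t t' ⟨e, he, h1, h2⟩
    have htt' := m.region_eq he h1 h2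
    obtain ⟨u, u', -, hu⟩ := e.exists_eq
    have hue : u ∈ e.1 := by simp [hu]
    refine propext ⟨fun H hp => ?_, fun H hp => ?_⟩
    · exact hinside t' hp ⟨u, h2 hue, H (htt'.trans hp) u (h1 hue)⟩
    · exact hinside t hp ⟨u, h1 hue, H (htt'.symm.trans hp) u (h2 hue)⟩)
  have hQ : Q p := by
    rw [← ht]
    exact fun hp => hinside t hp ⟨x, hx, rfl⟩
  obtain ⟨a, b, c, hab, -, -, habc⟩ := card_eq_three.1 hcard
  let e₁ : Edg T₁ := ⟨{a, b}, hpair a (by simp [habc]) b (by simp [habc]) hab, card_pair hab⟩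
  have he₁ : e₁.1 ⊆ τ := by simp [e₁, habc, insert_subset_iff]
  obtain ⟨t', ht', ht'p⟩ : ∃ t' : Tri T₂, (m.s e₁).1 ⊆ t'.1 ∧ m.region t' = p := by
    by_contra! hno
    refine (hτ e₁).2 he₁ ((m.bd_eq_zero_iff hT₂ _ _).2 fun t t' h1 h2 => ?_)
    rw [Pi.single_eq_of_ne (hno t h1), Pi.single_eq_of_ne (hno t' h2)]
  have hQ' : ∀ w ∈ t'.1, m.f w = v := by
    have : Q (m.region t') := ht'p ▸ hQ
    exact this ht'p
  have himg : ∀ y ∈ e₁.1, y = v := by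
    intro y hy
    rw [← m.image_s] at hy
    obtain ⟨w, hw, rfl⟩ := mem_image.1 hy
    exact hQ' w (ht' hw)
  exact hab ((himg a (by simp [e₁])).trans (himg b (by simp [e₁])).symm)

/-- The regions correspond to triangles of `T₁`, and the branch map is simplicial. -/
theorem exists_faces (hT₁ : IsMod2Sphere T₁) (hT₂ : IsMod2Sphere T₂) :
    ∃ τ : m.Region → Tri T₁, (∀ t, t.1.image m.f ⊆ (τ (m.region t)).1) ∧
      (∀ (p : m.Region) (e : Edg T₁), (∃ t t' : Tri T₂, (m.s e).1 ⊆ t.1 ∧ (m.s e).1 ⊆ t'.1 ∧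
        m.region t = p ∧ m.region t' ≠ p) → e.1 ⊆ (τ p).1) ∧ Function.Injective τ := by
  obtain ⟨τ, hτ⟩ := m.exists_cells hT₁ hT₂
  have hbd : ∀ p e, m.bd (Pi.single p 1) e = if e.1 ⊆ τ p then 1 else 0 := by
    intro p e
    by_cases h : e.1 ⊆ τ p
    · rw [if_pos h]; exact zmod2_eq_one (((hτ p).2.1 e).2 h)
    · rw [if_neg h]; by_contra h'; exact h (((hτ p).2.1 e).1 h')
  have hface := hT₁.mem_faces_of_cells τ (fun p => (hτ p).1) (fun p => (hτ p).2.2)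
    (fun e => by simpa only [(hτ _).2.1] using (m.card_support hT₁ hT₂).2 e)
    (fun p => by simpa only [← hbd] using m.bd_cycle hT₂ (Pi.single p 1))
    (fun c hc => m.const_of_bd_eq_zero hT₂ c (by
      ext e
      rw [bd_eq_sum]
      simpa [hbd, sum_filter] using hc e))
  refine ⟨fun p => ⟨τ p, hface p, (hτ p).1⟩, fun t y hy => ?_, fun p e ⟨t, t', h1, h2, h3, h4⟩ => ?_,
    fun p q hpq => ?_⟩
  · obtain ⟨x, hx, rfl⟩ := mem_image.1 hy
    exact m.image_subset_cell hT₁ hT₂ (hτ _).1 (hτ _).2.2 (hτ _).2.1 t rfl hx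
  · rw [← (hτ p).2.1]
    intro h0
    have := (m.bd_eq_zero_iff hT₂ _ _).1 h0 t t' h1 h2
    rw [h3, Pi.single_eq_same, Pi.single_eq_of_ne h4] at this
    exact one_ne_zero this
  -- Two regions with the same cell have a closed sum, so there are no other regions. Every edge,
  -- and then every triangle, of `T₁` would lie in this one cell.
  · by_contra hne
    have h1 : τ p = τ q := congrArg Subtype.val hpq
    obtain ⟨a, ha⟩ := m.const_of_bd_eq_zero hT₂ (Pi.single p 1 + Pi.single q 1) (by
      ext e
      rw [bd_eq_sum]
      simp only [Pi.add_apply, add_mul, sum_add_distrib, Pi.single_apply, ite_mul, one_mul, zero_mul,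
        sum_ite_eq', mem_univ, if_true]
      rw [hbd, hbd, h1]
      exact CharTwo.add_self_eq_zero _)
    have h2 : ∀ r, r = p ∨ r = q := by
      intro r
      by_contra! hr
      have h3 := congrFun ha p
      have h4 := congrFun ha r
      rw [Pi.add_apply, Pi.single_eq_same, Pi.single_eq_of_ne hne, add_zero] at h3
      rw [Pi.add_apply, Pi.single_eq_of_ne hr.1, Pi.single_eq_of_ne hr.2, add_zero, ← h3] at h4
      exact zero_ne_one h4
    have h3 : ∀ e : Edg T₁, e.1 ⊆ τ p := by
      intro e
      obtain ⟨r, hr⟩ := card_pos.1 (by rw [(m.card_support hT₁ hT₂).2 e]; norm_num :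
        0 < (univ.filter fun p => m.bd (Pi.single p 1) e ≠ 0).card)
      have hr' := ((hτ r).2.1 e).1 (mem_filter.1 hr).2
      rcases h2 r with rfl | rfl
      · exact hr'
      · rw [h1]; exact hr'
    have h4 : ∀ t : Tri T₁, t.1 = τ p := by
      intro t
      refine eq_of_subset_of_card_le (fun v _ => ?_) (by rw [(hτ p).1, t.2.2])
      obtain ⟨e, he⟩ := hT₁.exists_edge v
      exact h3 e he
    obtain ⟨v⟩ := hT₁.nonempty
    obtain ⟨e, -⟩ := hT₁.exists_edge v
    obtain ⟨t, t', htt', -⟩ := hT₁.exists_two e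
    exact htt' (Subtype.ext ((h4 t).trans (h4 t').symm))

/-- The branch map, as a simplicial map. -/
def toSimplicialMap (hT₁ : IsMod2Sphere T₁) (hT₂ : IsMod2Sphere T₂) : SimplicialMap T₂ T₁ where
  toFun := m.f
  map_faces s hs := by
    obtain ⟨τ, hτ, -⟩ := m.exists_faces hT₁ hT₂
    obtain ⟨t, ht⟩ := hT₂.exists_tri_of_face hs
    exact mem_faces_of_subset (τ (m.region t)).2.1 ((image_subset_image ht).trans (hτ t))
      ((T₂.isRelLowerSet_faces hs).1.image _)

end MinorModel
end Simpliciality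

/-! ### From sequences of minor operations to minor models. -/

section MinorsToModels

open Finset Matrix

/-- A minor `K` of `G` as a partial map `r` to the vertices of `K` with connected fibers. -/
structure IsBranchMap {α β γ δ : Type*} (G : Graph α β) (K : Graph γ δ) (ι : δ → β)
    (r : α → Option γ) : Prop where
  nonempty : ∀ x ∈ K.vertexSet, ∃ u ∈ G.vertexSet, r u = some x
  conn : ∀ (x : γ) (g : α → ZMod 2),
    (∀ e u w, G.IsLink e u w → r u = some x → r w = some x → g u = g w) →
      ∀ u w, r u = some x → r w = some x → g u = g w
  link : ∀ e x y, K.IsLink e x y → ∃ u w, G.IsLink (ι e) u w ∧ r u = some x ∧ r w = some y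

theorem exists_branchMap {α β : Type*} [DecidableEq α] {G K : Graph α β}
    (h : Relation.ReflTransGen MinorStep G K) :
    ∃ r, IsBranchMap G K id r := by
  induction h with
  | refl =>
    refine ⟨some, fun x hx => ⟨x, hx, rfl⟩, fun x g _ u w hu hw => ?_,
      fun e x y h => ⟨x, y, h, rfl, rfl⟩⟩
    rw [Option.some.inj (hu.trans hw.symm)]
  | tail _ hstep ih =>
    obtain ⟨r, hr⟩ := ih
    cases hstep with
    | deleteEdge e he =>
      exact ⟨r, hr.nonempty, hr.conn, fun e x y h => hr.link e x y h.1⟩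
    | @collapseEdge e x y he hxy =>
      obtain ⟨u₀, w₀, hlink, hu₀, hw₀⟩ := hr.link e x y he
      -- The fibres over `x` and `y` are united. They are joined by the edge from `u₀` to `w₀` that
      -- represents the collapsed edge `e`.
      refine ⟨fun u => (r u).map fun z => if z = y then x else z, ?_, ?_, ?_⟩
      · rintro _ ⟨a, ha, rfl⟩
        obtain ⟨u, hu, hru⟩ := hr.nonempty a ha
        exact ⟨u, hu, by rw [hru]; rfl⟩
      · intro z g hg
        have h1 : ∀ a, (if a = y then x else a) = z →
            ∀ u w, r u = some a → r w = some a → g u = g w := fun a ha =>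
          hr.conn a g fun e u w hl hu hw =>
            hg e u w hl (by rw [hu, ← ha]; rfl) (by rw [hw, ← ha]; rfl)
        have h2 : x = z → g u₀ = g w₀ := fun h =>
          hg e u₀ w₀ hlink (by rw [hu₀, ← h]; simp) (by rw [hw₀, ← h]; simp)
        intro u w hu hw
        obtain ⟨a, ha, ha'⟩ := Option.map_eq_some_iff.1 hu
        obtain ⟨b, hb, hb'⟩ := Option.map_eq_some_iff.1 hw
        by_cases hab : a = b
        · subst hab; exact h1 a ha' u w ha hb
        by_cases hay : a = y
        · subst hay
          have hba : b ≠ a := Ne.symm hab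
          have hz := ha'
          have hbz := hb'
          rw [if_pos rfl] at hz
          rw [if_neg hba, ← hz] at hbz
          subst hbz
          rw [h1 a ha' u w₀ ha hw₀, ← h2 hz, h1 b hb' u₀ w hu₀ hb]
        · have hz := ha'
          rw [if_neg hay] at hz
          by_cases hby : b = y
          · subst hby
            have hbz := hb'
            rw [if_pos rfl] at hbz
            have hax : a = x := hz.trans hbz.symm
            subst hax
            rw [h1 a ha' u u₀ ha hu₀, h2 hz, h1 b hb' w₀ w hw₀ hb]
          · rw [if_neg hby] at hb'
            exact absurd (hz.trans hb'.symm) hab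
      · rintro e' _ _ ⟨a, b, hab, rfl, rfl⟩
        obtain ⟨u, w, hl, hu, hw⟩ := hr.link e' a b hab.1
        exact ⟨u, w, hl, by rw [hu]; rfl, by rw [hw]; rfl⟩
    | deleteVertex v hv hiso =>
      -- The map `r` is not modified, so it may still take the deleted vertex as a value; only
      -- `nonempty` and `link` are restricted to what remains.
      refine ⟨r, fun x hx => hr.nonempty x ?_, hr.conn, fun e x y h => hr.link e x y ?_⟩
      · rw [Graph.vertexSet_deleteVerts] at hx
        exact hx.1
      · exact ((Graph.deleteVerts_isLink _ _).1 h).1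

/-- Branch sets of a connected graph can be extended to a partition of its vertices. -/
theorem exists_total_branchMap {α γ : Type*} [Fintype α] [DecidableEq α] (Adj : α → α → Prop)
    (symm : ∀ u w, Adj u w → Adj w u)
    (hconn : ∀ g : α → ZMod 2, (∀ u w, Adj u w → g u = g w) → ∀ u w, g u = g w) (n : ℕ) :
    ∀ r : α → Option γ, (univ.filter fun u => (r u).isNone).card = n → (∃ u x, r u = some x) →
      (∀ g : α → ZMod 2, (∀ u w x, Adj u w → r u = some x → r w = some x → g u = g w) →
        ∀ u w x, r u = some x → r w = some x → g u = g w) →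
      ∃ f : α → γ, (∀ u x, r u = some x → f u = x) ∧
        ∀ g : α → ZMod 2, (∀ u w, Adj u w → f u = f w → g u = g w) →
          ∀ u w, f u = f w → g u = g w := by
  induction n with
  | zero =>
    intro r hr _ hc
    rw [card_eq_zero, filter_eq_empty_iff] at hr
    have hr' : ∀ u, ∃ x, r u = some x := fun u => by
      have := hr (mem_univ u)
      rwa [Option.isNone_iff_eq_none, ← ne_eq, Option.ne_none_iff_exists'] at this
    choose f hf using hr'
    refine ⟨f, fun u x h => Option.some.inj ((hf u).symm.trans h), fun g hg u w huw => ?_⟩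
    refine hc g (fun u w x hl hu hw => hg u w hl ?_) u w _ (hf u) (huw ▸ hf w)
    rw [hf] at hu hw
    exact Option.some.inj (hu.trans hw.symm)
  | succ n ih =>
    intro r hr ⟨u₁, x₁, hx₁⟩ hc
    obtain ⟨u₂, hu₂⟩ : (univ.filter fun u => (r u).isNone).Nonempty := card_pos.1 (by omega)
    have hu₂ : (r u₂).isNone = true := (mem_filter.1 hu₂).2
    -- If no unassigned vertex had an assigned neighbour, the indicator of the unassigned ones would
    -- be constant by connectedness, against `u₁` and `u₂`.
    obtain ⟨u, w, x, hl, hu, hw⟩ : ∃ u w x, Adj u w ∧ r u = none ∧ r w = some x := by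
      by_contra! hno
      have := hconn (fun u => if (r u).isNone then 1 else 0) (fun u w hl => by
        cases hu : r u with
        | none =>
          cases hw : r w with
          | none => rfl
          | some x => exact absurd hw (hno u w x hl hu)
        | some x =>
          cases hw : r w with
          | none => exact absurd hu (hno w u x (symm _ _ hl) hw)
          | some x => rfl) u₁ u₂
      rw [hx₁, hu₂] at this
      simp at this
    have hwu : w ≠ u := by rintro rfl; rw [hu] at hw; cases hw
    -- The vertex `u` joins the branch set of its neighbour `w`, which stays connected.
    obtain ⟨f, hf, hf'⟩ := ih (Function.update r u (some x)) (by
        have : (univ.filter fun v => (Function.update r u (some x) v).isNone) =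
            (univ.filter fun v => (r v).isNone).erase u := by
          ext v
          by_cases hv : v = u
          · subst hv; simp
          · simp [hv]
        rw [this, card_erase_of_mem (by simp [hu]), hr]; rfl)
      ⟨u, x, by simp⟩ (by
        intro g hg
        have h1 := hc g fun a b y hl ha hb => hg a b y hl
          (by rw [Function.update_of_ne]; · exact ha
              rintro rfl; rw [hu] at ha; cases ha)
          (by rw [Function.update_of_ne]; · exact hb
              rintro rfl; rw [hu] at hb; cases hb)
        have h2 : g u = g w := hg u w x hl (by simp) (by rw [Function.update_of_ne hwu, hw])
        intro a b y ha hb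
        by_cases hau : a = u <;> by_cases hbu : b = u
        · rw [hau, hbu]
        · subst hau
          rw [Function.update_self] at ha
          rw [Function.update_of_ne hbu] at hb
          rw [h2, h1 w b y (hw.trans ha) hb]
        · subst hbu
          rw [Function.update_self] at hb
          rw [Function.update_of_ne hau] at ha
          rw [h2, h1 w a y (hw.trans hb) ha]
        · rw [Function.update_of_ne hau] at ha
          rw [Function.update_of_ne hbu] at hb
          exact h1 a b y ha hb)
    refine ⟨f, fun v y hv => hf v y ?_, hf'⟩
    rw [Function.update_of_ne]
    · exact hv
    · rintro rfl; rw [hu] at hv; cases hv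

variable {V₁ V₂ : Type*} [Fintype V₁] [DecidableEq V₁] [Fintype V₂] [DecidableEq V₂]
  {T₁ : AbstractSimplicialComplex V₁} {T₂ : AbstractSimplicialComplex V₂}

theorem edgeVertexMatrix_mulVec_eq_zero (g : V₂ → ZMod 2) {e : Edg T₂} {u w : V₂}
    (hu : u ∈ e.1) (hw : w ∈ e.1) (h : (edgeVertexMatrix T₂ *ᵥ g) e = 0) : g u = g w := by
  by_cases huw : u = w
  · rw [huw]
  · rw [edgeVertexMatrix_mulVec, Edg.eq_pair hu hw huw, sum_pair huw, zmod2_add_eq_zero] at h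
    exact h

theorem nonempty_minorModel (hT₁ : IsMod2Sphere T₁) (hT₂ : IsMod2Sphere T₂)
    (hminor : IsGraphMinor (oneSkeleton T₁) (oneSkeleton T₂)) : Nonempty (MinorModel T₁ T₂) := by
  obtain ⟨K, hK, φ, ψ, hiso⟩ := hminor
  obtain ⟨r, hr⟩ := exists_branchMap hK
  let ι : V₁ → V₂ := fun v => (φ ⟨v, Set.mem_univ v⟩).1
  have hι : Function.Injective ι := fun a b h =>
    congrArg Subtype.val (φ.injective (Subtype.ext h))
  -- Values of `r` that are no longer vertices of `K` are outside the image of `ι` and become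
  -- `none`; their fibres are absorbed by other branch sets below.
  let r₁ : V₂ → Option V₁ := fun u => (r u).bind (Function.partialInv ι)
  have hr₁ : ∀ u v, r₁ u = some v ↔ r u = some (ι v) := by
    intro u v
    simp only [r₁, Option.bind_eq_some_iff]
    constructor
    · rintro ⟨x, hx, h⟩
      rw [hx, (Function.Injective.isPartialInv hι _ _).1 h]
    · intro h
      exact ⟨ι v, h, (Function.Injective.isPartialInv hι _ _).2 rfl⟩
  have hne : ∀ v, ∃ u, r₁ u = some v := fun v => by
    obtain ⟨u, -, hu⟩ := hr.nonempty (ι v) (φ _).2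
    exact ⟨u, (hr₁ u v).2 hu⟩
  obtain ⟨v₀⟩ := hT₁.nonempty
  let Adj : V₂ → V₂ → Prop := fun u w => u ≠ w ∧ {u, w} ∈ T₂.faces
  have hAdj : ∀ g : V₂ → ZMod 2, (∀ u w, Adj u w → g u = g w) → ∀ u w, g u = g w := by
    intro g hg u w
    obtain ⟨a, rfl⟩ := hT₂.conn g (by
      ext e
      obtain ⟨x, y, hxy, he⟩ := e.exists_eq
      rw [edgeVertexMatrix_mulVec, he, sum_pair hxy]
      exact zmod2_add_eq_zero.2 (hg x y ⟨hxy, he ▸ e.2.1⟩))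
    rfl
  obtain ⟨f, hf, hf'⟩ := exists_total_branchMap Adj
    (fun u w h => ⟨h.1.symm, by rw [pair_comm]; exact h.2⟩) hAdj _ r₁ rfl
    (by obtain ⟨u, hu⟩ := hne v₀; exact ⟨u, v₀, hu⟩) (by
      intro g hg u w x hu hw
      exact hr.conn (ι x) g (fun e u w hl hu' hw' => hg u w x ⟨hl.1, hl.2.1 ▸ hl.2.2⟩
        ((hr₁ u x).2 hu') ((hr₁ w x).2 hw')) u w ((hr₁ u x).1 hu) ((hr₁ w x).1 hw))
  have hs : ∀ e : Edg T₁, ∃ e' : Edg T₂, e'.1.image f = e.1 := by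
    intro e
    obtain ⟨a, b, hab, he⟩ := e.exists_eq
    have hl : (oneSkeleton T₁).IsLink e.1 a b := ⟨hab, he, e.2.1⟩
    obtain ⟨u, w, ⟨huw, h1, h2⟩, hu, hw⟩ := hr.link _ _ _
      ((hiso ⟨e.1, hl.edge_mem⟩ ⟨a, Set.mem_univ a⟩ ⟨b, Set.mem_univ b⟩).1 hl)
    refine ⟨⟨_, h2, by rw [h1, card_pair huw]⟩, ?_⟩
    refine (congrArg (image f) h1).trans ?_
    rw [he, image_insert, image_singleton, hf u a ((hr₁ u a).2 hu), hf w b ((hr₁ w b).2 hw)]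
  choose s hs using hs
  obtain ⟨m, -⟩ := exists_minorModel f s (fun v => by
    obtain ⟨u, hu⟩ := hne v
    exact ⟨u, hf u v hu⟩) hs (by
    intro g hg
    refine hf' g fun u w hl huw => ?_
    refine edgeVertexMatrix_mulVec_eq_zero g (e := ⟨{u, w}, hl.2, card_pair hl.1⟩)
      (by simp) (by simp) (hg _ ?_)
    simp [huw])
  exact ⟨m⟩

end MinorsToModels

/-! ### Orientability and uniqueness of the integral cycle. -/

section Orientation

open Finset Matrix

variable {V : Type*} [Fintype V] [DecidableEq V] {T : AbstractSimplicialComplex V}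

theorem IsMod2Sphere.exists_third_vertices (hT : IsMod2Sphere T) {x y : V} (hxy : x ≠ y)
    (h : {x, y} ∈ T.faces) :
    ∃ z w, z ≠ w ∧ ∀ v, (v ≠ x ∧ v ≠ y ∧ {v, x, y} ∈ T.faces) ↔ v = z ∨ v = w := by
  obtain ⟨t, t', hne, htt'⟩ := hT.exists_two ⟨{x, y}, h, card_pair hxy⟩
  have hm : ∀ s : Tri T, {x, y} ⊆ s.1 ↔ s = t ∨ s = t' := fun s => by
    have : s ∈ (univ.filter fun t : Tri T => {x, y} ⊆ t.1) ↔ s ∈ ({t, t'} : Finset (Tri T)) := by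
      rw [← htt']
    simpa using this
  have hthird : ∀ s : Tri T, {x, y} ⊆ s.1 → ∃ z, z ≠ x ∧ z ≠ y ∧ s.1 = {z, x, y} := by
    intro s hs
    have hc : (s.1 \ {x, y}).card = 1 := by
      rw [card_sdiff_of_subset hs, s.2.2, card_pair hxy]
    obtain ⟨z, hz⟩ := card_eq_one.1 hc
    have hz' : z ∈ s.1 \ {x, y} := by simp [hz]
    rw [mem_sdiff, mem_insert, mem_singleton, not_or] at hz'
    refine ⟨z, hz'.2.1, hz'.2.2, ?_⟩
    rw [← sdiff_union_of_subset hs, hz]; rfl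
  obtain ⟨z, hzx, hzy, hz⟩ := hthird t ((hm t).2 (Or.inl rfl))
  obtain ⟨w, hwx, hwy, hw⟩ := hthird t' ((hm t').2 (Or.inr rfl))
  refine ⟨z, w, ?_, fun v => ⟨?_, ?_⟩⟩
  · rintro rfl
    exact hne (Subtype.ext (hz.trans hw.symm))
  · rintro ⟨hvx, hvy, hv⟩
    have hc : ({v, x, y} : Finset V).card = 3 := card_eq_three.2 ⟨v, x, y, hvx, hvy, hxy, rfl⟩
    have hv' : ∀ a : V, ({v, x, y} : Finset V) = {a, x, y} → v = a := by
      intro a ha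
      have : v ∈ ({a, x, y} : Finset V) := by rw [← ha]; simp
      simp only [mem_insert, mem_singleton] at this
      tauto
    rcases (hm ⟨_, hv, hc⟩).1 (by simp) with h' | h'
    · left; exact hv' z ((congrArg Subtype.val h').trans hz)
    · right; exact hv' w ((congrArg Subtype.val h').trans hw)
  · rintro (rfl | rfl)
    · exact ⟨hzx, hzy, hz ▸ t.2.1⟩
    · exact ⟨hwx, hwy, hw ▸ t'.2.1⟩

theorem filter_edges_of_tri {t : Tri T} {v x y : V} (hx : v ≠ x) (hy : v ≠ y) (hxy : x ≠ y)
    (h : t.1 = {v, x, y}) {M : Type*} [AddCommMonoid M] (F : Edg T → M) :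
    ∑ e with v ∈ e.1 ∧ e.1 ⊆ t.1, F e =
      F (t.edge (x := v) (y := x) (by simp [h]) (by simp [h]) hx) +
      F (t.edge (x := v) (y := y) (by simp [h]) (by simp [h]) hy) := by
  have : ∑ e with v ∈ e.1 ∧ e.1 ⊆ t.1, F e = ∑ e with e.1 ⊆ t.1, if v ∈ e.1 then F e else 0 := by
    rw [← sum_filter, filter_filter]
    simp only [and_comm]
  rw [this, sum_edges_of_tri _ t hx hy hxy h]
  simp [Tri.edge, hx, hy]

theorem sum_edges_sum_tri {M : Type*} [AddCommMonoid M] (v : V) (F : Tri T → Edg T → M) :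
    ∑ e with v ∈ e.1, ∑ t with e.1 ⊆ t.1, F t e =
      ∑ t with v ∈ t.1, ∑ e with v ∈ e.1 ∧ e.1 ⊆ t.1, F t e := by
  rw [sum_comm' (t' := univ.filter fun t : Tri T => v ∈ t.1)
    (s' := fun t => univ.filter fun e : Edg T => v ∈ e.1 ∧ e.1 ⊆ t.1)]
  intro e t
  simp only [mem_filter, mem_univ, true_and]
  exact ⟨fun h => ⟨h, h.2 h.1⟩, fun h => h.1⟩

/-- A triangle at `v` has two edges at `v`, and an edge at `v` lies in two triangles. -/
theorem IsMod2Sphere.card_tri_at (hT : IsMod2Sphere T) (v : V) :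
    (univ.filter fun t : Tri T => v ∈ t.1).card = (univ.filter fun e : Edg T => v ∈ e.1).card := by
  have h := sum_edges_sum_tri (T := T) v fun _ _ => 1
  have h1 : ∀ t ∈ univ.filter (fun t : Tri T => v ∈ t.1),
      ∑ e : Edg T with v ∈ e.1 ∧ e.1 ⊆ t.1, 1 = 2 := by
    intro t ht
    obtain ⟨x, y, hx, hy, hxy, h⟩ := t.exists_eq_of_mem (mem_filter.1 ht).2
    rw [filter_edges_of_tri hx hy hxy h]
  rw [sum_congr rfl h1] at h
  simp only [sum_const, smul_eq_mul, mul_one, hT.two] at h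
  omega

/-- The triangles can be oriented coherently relative to a given tournament on the vertices. -/
theorem IsMod2Sphere.exists_coherent (hT : IsMod2Sphere T) (l : V → V → ZMod 2)
    (hl : ∀ x y, x ≠ y → l x y + l y x = 1) :
    ∃ α : Finset V → ZMod 2, ∀ x y z w, x ≠ y → z ≠ w → z ≠ x → z ≠ y → w ≠ x → w ≠ y →
      {z, x, y} ∈ T.faces → {w, x, y} ∈ T.faces →
        α {z, x, y} + α {w, x, y} = 1 + (l z x + l z y) + (l w x + l w y) := by
  classical
  let μ : Tri T → Edg T → ZMod 2 := fun t e => ∑ z ∈ t.1 \ e.1, ∑ w ∈ e.1, l z w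
  have hμ : ∀ (t : Tri T) (e : Edg T) (x y z : V), x ≠ y → z ≠ x → z ≠ y → e.1 = {x, y} →
      t.1 = {z, x, y} → μ t e = l z x + l z y := by
    intro t e x y z hxy hzx hzy he ht
    have : t.1 \ e.1 = {z} := by
      rw [ht, he]
      ext a
      simp only [mem_sdiff, mem_insert, mem_singleton]
      constructor
      · tauto
      · rintro rfl; tauto
    simp only [μ]
    rw [this, sum_singleton, he, sum_pair hxy]
  -- `κ e` is the required difference of `α` across `e`. Such an `α` exists when `κ` is a boundary,
  -- so by vanishing of `H₁` it suffices that `κ` be a cycle.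
  let κ : Edg T → ZMod 2 := fun e => 1 + ∑ t with e.1 ⊆ t.1, μ t e
  obtain ⟨a, ha⟩ := hT.exists_eq_vecMul κ (by
    ext v
    rw [vecMul_edgeVertexMatrix, sum_add_distrib, sum_edges_sum_tri v μ]
    let ν : Edg T → ZMod 2 := fun e => ∑ w ∈ e.1.erase v, l w v
    -- In a triangle `{v, x, y}` the terms `l x y + l y x` give `1`, and what remains depends only
    -- on the edges at `v`. Each such edge is counted twice, and the ones cancel since as many
    -- triangles as edges meet at `v`.
    have h1 : ∀ t ∈ univ.filter (fun t : Tri T => v ∈ t.1),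
        ∑ e with v ∈ e.1 ∧ e.1 ⊆ t.1, μ t e = 1 + ∑ e with v ∈ e.1 ∧ e.1 ⊆ t.1, ν e := by
      intro t ht
      obtain ⟨x, y, hx, hy, hxy, h⟩ := t.exists_eq_of_mem (mem_filter.1 ht).2
      rw [filter_edges_of_tri hx hy hxy h, filter_edges_of_tri hx hy hxy h,
        hμ t _ v x y hx hy.symm hxy.symm rfl (by rw [h]; grind),
        hμ t _ v y x hy hx.symm hxy rfl (by rw [h]; grind)]
      have e1 : ({v, x} : Finset V).erase v = {x} := by grind
      have e2 : ({v, y} : Finset V).erase v = {y} := by grind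
      simp only [ν, Tri.edge, e1, e2, sum_singleton]
      rw [← hl x y hxy]
      ring
    rw [sum_congr rfl h1, sum_add_distrib, ← sum_edges_sum_tri v fun _ e => ν e]
    simp only [sum_const, hT.two, hT.card_tri_at, two_nsmul, CharTwo.add_self_eq_zero, nsmul_zero,
      add_zero, Pi.zero_apply])
  refine ⟨fun s => if h : s ∈ T.faces ∧ s.card = 3 then a ⟨s, h⟩ else 0, ?_⟩
  intro x y z w hxy hzw hzx hzy hwx hwy hz hw
  have hcz : ({z, x, y} : Finset V).card = 3 := card_eq_three.2 ⟨z, x, y, hzx, hzy, hxy, rfl⟩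
  have hcw : ({w, x, y} : Finset V).card = 3 := card_eq_three.2 ⟨w, x, y, hwx, hwy, hxy, rfl⟩
  beta_reduce
  rw [dif_pos ⟨hz, hcz⟩, dif_pos ⟨hw, hcw⟩]
  let e : Edg T := ⟨{x, y}, mem_faces_of_subset hz (by simp) (by simp), card_pair hxy⟩
  let t : Tri T := ⟨_, hz, hcz⟩
  let t' : Tri T := ⟨_, hw, hcw⟩
  have htt' : t ≠ t' := fun h => by
    have h' : ({z, x, y} : Finset V) = {w, x, y} := congrArg Subtype.val h
    have : z ∈ ({w, x, y} : Finset V) := by rw [← h']; simp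
    simp only [mem_insert, mem_singleton] at this
    tauto
  have hfil : (univ.filter fun t : Tri T => e.1 ⊆ t.1) = {t, t'} := by
    symm
    refine eq_of_subset_of_card_le ?_ (by rw [hT.two, card_pair htt'])
    simp [insert_subset_iff, e, t, t']
  have h := congrFun ha e
  rw [vecMul_triEdgeMatrix, hfil, sum_pair htt'] at h
  simp only [κ] at h
  rw [hfil, sum_pair htt', hμ t e x y z hxy hzx hzy rfl rfl, hμ t' e x y w hxy hwx hwy rfl rfl,
    ← add_assoc] at h
  exact h.symm

/-- The coherent orientation of a sphere, as an alternating function. -/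
structure IsOrientation (T : AbstractSimplicialComplex V) (o : V → V → V → ℤ) : Prop where
  distinct : ∀ x y z, o x y z ≠ 0 → x ≠ y ∧ x ≠ z ∧ y ≠ z ∧ {x, y, z} ∈ T.faces
  unit : ∀ x y z, x ≠ y → x ≠ z → y ≠ z → {x, y, z} ∈ T.faces → o x y z = 1 ∨ o x y z = -1
  swap : ∀ x y z, o y x z = -o x y z
  swap' : ∀ x y z, o x z y = -o x y z
  cycle : ∀ x y, ∑ v, o v x y = 0

theorem IsMod2Sphere.exists_orientation (hT : IsMod2Sphere T) : ∃ o, IsOrientation T o := by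
  classical
  let l : V → V → ZMod 2 := fun x y => if Fintype.equivFin V x < Fintype.equivFin V y then 1 else 0
  have hl : ∀ x y, x ≠ y → l x y + l y x = 1 := by
    intro x y hxy
    rcases lt_or_gt_of_ne ((Fintype.equivFin V).injective.ne hxy) with h | h <;>
      simp [l, h, h.not_gt]
  obtain ⟨α, hα⟩ := hT.exists_coherent l hl
  let sg : ZMod 2 → ℤ := fun a => if a = 0 then 1 else -1
  have hsg1 : ∀ a, sg a = 1 ∨ sg a = -1 := by decide
  have hsg2 : ∀ a b, a + b = 1 → sg b = -sg a := by decide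
  -- The values of `l` record the parity of the ordering of the triple, and `α` chooses the sign of
  -- the triangle. Exchanging neighbouring entries reverses exactly one `l`.
  let o : V → V → V → ℤ := fun x y z =>
    if x ≠ y ∧ x ≠ z ∧ y ≠ z ∧ {x, y, z} ∈ T.faces then sg (l x y + l x z + l y z + α {x, y, z}) else 0
  have htwo : ∀ a : ZMod 2, a + a = 0 := CharTwo.add_self_eq_zero
  refine ⟨o, fun x y z h => ?_, fun x y z h1 h2 h3 h4 => ?_, fun x y z => ?_, fun x y z => ?_,
    fun x y => ?_⟩
  · by_contra h'
    exact h (if_neg h')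
  · simp only [o]
    rw [if_pos ⟨h1, h2, h3, h4⟩]
    exact hsg1 _
  · by_cases h : x ≠ y ∧ x ≠ z ∧ y ≠ z ∧ {x, y, z} ∈ T.faces
    · have h' : y ≠ x ∧ y ≠ z ∧ x ≠ z ∧ {y, x, z} ∈ T.faces :=
        ⟨h.1.symm, h.2.2.1, h.2.1, by rw [insert_comm]; exact h.2.2.2⟩
      simp only [o]
      rw [if_pos h, if_pos h', insert_comm y x]
      refine hsg2 _ _ ?_
      rw [← hl x y h.1]
      linear_combination htwo (l x z) + htwo (l y z) + htwo (α {x, y, z})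
    · have h' : ¬ (y ≠ x ∧ y ≠ z ∧ x ≠ z ∧ {y, x, z} ∈ T.faces) := fun h' => h
        ⟨h'.1.symm, h'.2.2.1, h'.2.1, by rw [insert_comm]; exact h'.2.2.2⟩
      simp only [o]
      rw [if_neg h, if_neg h', neg_zero]
  · by_cases h : x ≠ y ∧ x ≠ z ∧ y ≠ z ∧ {x, y, z} ∈ T.faces
    · have h' : x ≠ z ∧ x ≠ y ∧ z ≠ y ∧ {x, z, y} ∈ T.faces :=
        ⟨h.2.1, h.1, h.2.2.1.symm, by rw [pair_comm]; exact h.2.2.2⟩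
      simp only [o]
      rw [if_pos h, if_pos h', pair_comm z y]
      refine hsg2 _ _ ?_
      rw [← hl y z h.2.2.1]
      linear_combination htwo (l x z) + htwo (l x y) + htwo (α {x, y, z})
    · have h' : ¬ (x ≠ z ∧ x ≠ y ∧ z ≠ y ∧ {x, z, y} ∈ T.faces) := fun h' => h
        ⟨h'.2.1, h'.1, h'.2.2.1.symm, by rw [pair_comm]; exact h'.2.2.2⟩
      simp only [o]
      rw [if_neg h, if_neg h', neg_zero]
  · by_cases hxy : x ≠ y ∧ {x, y} ∈ T.faces
    · obtain ⟨z, w, hzw, hzw'⟩ := hT.exists_third_vertices hxy.1 hxy.2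
      have hz := (hzw' z).2 (Or.inl rfl)
      have hw := (hzw' w).2 (Or.inr rfl)
      have : ∑ v, o v x y = ∑ v ∈ {z, w}, o v x y := by
        symm
        refine sum_subset (subset_univ _) fun v _ hv => if_neg fun h => hv ?_
        simpa using (hzw' v).1 ⟨h.1, h.2.1, h.2.2.2⟩
      rw [this, sum_pair hzw]
      simp only [o]
      rw [if_pos ⟨hz.1, hz.2.1, hxy.1, hz.2.2⟩, if_pos ⟨hw.1, hw.2.1, hxy.1, hw.2.2⟩,
        hsg2 (l z x + l z y + l x y + α {z, x, y}) (l w x + l w y + l x y + α {w, x, y}),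
        add_neg_cancel]
      linear_combination hα x y z w hxy.1 hzw hz.1 hz.2.1 hw.1 hw.2.1 hz.2.2 hw.2.2 +
        htwo (l z x) + htwo (l z y) + htwo (l w x) + htwo (l w y) + htwo (l x y)
    · refine sum_eq_zero fun v _ => if_neg fun h => hxy ⟨h.2.2.1, ?_⟩
      exact mem_faces_of_subset h.2.2.2 (by simp) (by simp)

/-- Every integral cycle is a multiple of the orientation. -/
theorem IsMod2Sphere.exists_eq_mul (hT : IsMod2Sphere T) {o c : V → V → V → ℤ}
    (ho : IsOrientation T o) (hc : ∀ x y z, c x y z ≠ 0 → x ≠ y ∧ x ≠ z ∧ y ≠ z ∧ {x, y, z} ∈ T.faces)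
    (swap : ∀ x y z, c y x z = -c x y z) (swap' : ∀ x y z, c x z y = -c x y z)
    (cycle : ∀ x y, ∑ v, c v x y = 0) : ∃ k : ℤ, ∀ x y z, c x y z = k * o x y z := by
  classical
  -- A product of two alternating functions is symmetric, so `g` depends only on the triangle. As
  -- `o` is `1` or `-1` on triangles, `c = g * o`, and `g` should be the constant multiplier.
  let g : V → V → V → ℤ := fun x y z => c x y z * o x y z
  have g1 : ∀ x y z, g y x z = g x y z := fun x y z => by
    simp only [g, swap x y z, ho.swap x y z]; ring
  have g2 : ∀ x y z, g x z y = g x y z := fun x y z => by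
    simp only [g, swap' x y z, ho.swap' x y z]; ring
  have hsq : ∀ x y z, x ≠ y → x ≠ z → y ≠ z → {x, y, z} ∈ T.faces → o x y z * o x y z = 1 := by
    intro x y z h1 h2 h3 h4
    rcases ho.unit x y z h1 h2 h3 h4 with h | h <;> rw [h] <;> norm_num
  have hadj : ∀ x y z w, x ≠ y → z ≠ x → z ≠ y → w ≠ x → w ≠ y → {z, x, y} ∈ T.faces →
      {w, x, y} ∈ T.faces → g z x y = g w x y := by
    intro x y z w hxy hzx hzy hwx hwy hz hw
    have he : {x, y} ∈ T.faces := mem_faces_of_subset hz (by simp) (by simp)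
    obtain ⟨p, q, hpq, hpq'⟩ := hT.exists_third_vertices hxy he
    have hsum : ∀ F : V → V → V → ℤ, (∀ x y z, F x y z ≠ 0 → x ≠ y ∧ x ≠ z ∧ y ≠ z ∧
        {x, y, z} ∈ T.faces) → ∑ v, F v x y = F p x y + F q x y := by
      intro F hF
      rw [← sum_pair (f := fun v => F v x y) hpq]
      symm
      refine sum_subset (subset_univ _) fun v _ hv => ?_
      by_contra h0
      have := hF v x y h0
      exact hv (by simpa using (hpq' v).1 ⟨this.1, this.2.1, this.2.2.2⟩)
    have hp := (hpq' p).2 (Or.inl rfl)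
    have hq := (hpq' q).2 (Or.inr rfl)
    have h1 := cycle x y
    have h2 := ho.cycle x y
    rw [hsum c hc] at h1
    rw [hsum o ho.distinct] at h2
    have hgpq : g p x y = g q x y := by
      simp only [g]
      rw [show c q x y = -c p x y by linarith, show o q x y = -o p x y by linarith]
      ring
    rcases (hpq' z).1 ⟨hzx, hzy, hz⟩ with rfl | rfl <;>
      rcases (hpq' w).1 ⟨hwx, hwy, hw⟩ with rfl | rfl <;> simp [hgpq]
  -- The triangle function given by `g` has integer values while `hT.h2` concerns `ZMod 2`; it is
  -- applied to the indicator of each level set `P k`.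
  let P : ℤ → Tri T → Prop := fun k t => ∃ x y z, t.1 = {x, y, z} ∧ x ≠ y ∧ x ≠ z ∧ y ≠ z ∧ g x y z = k
  have hP : ∀ k (t : Tri T) x y z, t.1 = {x, y, z} → x ≠ y → x ≠ z → y ≠ z →
      (P k t ↔ g x y z = k) := by
    intro k t x y z ht hxy hxz hyz
    refine ⟨?_, fun h => ⟨x, y, z, ht, hxy, hxz, hyz, h⟩⟩
    rintro ⟨a, b, d, ht', hab, had, hbd, rfl⟩
    have hmem : ∀ v, v ∈ ({x, y, z} : Finset V) ↔ v ∈ ({a, b, d} : Finset V) := fun v => by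
      rw [← ht, ← ht']
    simp only [mem_insert, mem_singleton] at hmem
    have ha := (hmem a).2 (Or.inl rfl)
    have hb := (hmem b).2 (Or.inr (Or.inl rfl))
    have hd := (hmem d).2 (Or.inr (Or.inr rfl))
    have r1 := g1 x y z
    have r2 := g2 x y z
    have r3 := g2 y x z
    have r4 := g1 x z y
    have r5 := g2 z x y
    rcases ha with rfl | rfl | rfl <;> rcases hb with rfl | rfl | rfl <;>
      rcases hd with rfl | rfl | rfl <;> first
        | exact absurd rfl hab | exact absurd rfl had | exact absurd rfl hbd | linarith
  have hconst : ∀ k, ∀ t t', P k t → P k t' := by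
    intro k t t' ht
    obtain ⟨a, ha⟩ := hT.h2 (fun t => if P k t then 1 else 0) (by
      ext e
      refine (hT.vecMul_eq_zero_iff _ e).2 fun t t' h h' => ?_
      obtain ⟨x, y, hxy, he⟩ := e.exists_eq
      have third : ∀ s : Tri T, e.1 ⊆ s.1 → ∃ z, z ≠ x ∧ z ≠ y ∧ s.1 = {z, x, y} := by
        intro s hs
        obtain ⟨p, q, hp, hq, hpq, h⟩ := s.exists_eq_of_mem (v := x) (hs (by simp [he]))
        have hy : y ∈ ({x, p, q} : Finset V) := by rw [← h]; exact hs (by simp [he])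
        simp only [mem_insert, mem_singleton] at hy
        rcases hy with rfl | rfl | rfl
        · exact absurd rfl hxy
        · exact ⟨q, hq.symm, hpq.symm, by rw [h]; grind⟩
        · exact ⟨p, hp.symm, hpq, by rw [h]; grind⟩
      obtain ⟨z, hzx, hzy, hz⟩ := third t h
      obtain ⟨w, hwx, hwy, hw⟩ := third t' h'
      have h1 := hadj x y z w hxy hzx hzy hwx hwy (hz ▸ t.2.1) (hw ▸ t'.2.1)
      have h2 : P k t ↔ P k t' := by
        rw [hP k t z x y hz hzx hzy hxy, hP k t' w x y hw hwx hwy hxy, h1]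
      simp only [h2])
    have h1 := congrFun ha t
    have h2 := congrFun ha t'
    rw [if_pos ht] at h1
    by_contra h3
    rw [if_neg h3, ← h1] at h2
    exact zero_ne_one h2
  obtain ⟨t₀⟩ := hT.nonempty_tri
  obtain ⟨x₀, y₀, z₀, hxy, hxz, hyz, h₀⟩ := card_eq_three.1 t₀.2.2
  refine ⟨g x₀ y₀ z₀, fun x y z => ?_⟩
  by_cases h : x ≠ y ∧ x ≠ z ∧ y ≠ z ∧ {x, y, z} ∈ T.faces
  · have h1 := hconst _ t₀ ⟨_, h.2.2.2, card_eq_three.2 ⟨x, y, z, h.1, h.2.1, h.2.2.1, rfl⟩⟩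
      ⟨x₀, y₀, z₀, h₀, hxy, hxz, hyz, rfl⟩
    rw [hP _ _ x y z rfl h.1 h.2.1 h.2.2.1] at h1
    rw [← h1]
    simp only [g]
    rw [mul_assoc, hsq x y z h.1 h.2.1 h.2.2.1 h.2.2.2, mul_one]
  · have h1 : c x y z = 0 := by by_contra h'; exact h (hc x y z h')
    have h2 : o x y z = 0 := by by_contra h'; exact h (ho.distinct x y z h')
    rw [h1, h2, mul_zero]

end Orientation

/-! ### Oriented 2-chains and the fundamental class. -/

section Chains

open Finset Matrix

variable {V : Type*} [Fintype V] [DecidableEq V] {T : AbstractSimplicialComplex V}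

theorem image_fin_three (p : Fin 3 → V) : univ.image p = {p 0, p 1, p 2} := by
  ext v
  simp [Fin.exists_fin_succ, eq_comm]

theorem orientedChains_swap (c : orientedChains T 2) (x y z : V) :
    c.1 ![y, x, z] = -c.1 ![x, y, z] := by
  have h := c.2.2 ![x, y, z] (Equiv.swap 0 1)
  rw [Equiv.Perm.sign_swap (by decide)] at h
  have : ![x, y, z] ∘ Equiv.swap (0 : Fin 3) 1 = ![y, x, z] := by
    ext i
    fin_cases i <;> rfl
  rw [this] at h
  simpa using h

theorem orientedChains_swap' (c : orientedChains T 2) (x y z : V) :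
    c.1 ![x, z, y] = -c.1 ![x, y, z] := by
  have h := c.2.2 ![x, y, z] (Equiv.swap 1 2)
  rw [Equiv.Perm.sign_swap (by decide)] at h
  have : ![x, y, z] ∘ Equiv.swap (1 : Fin 3) 2 = ![x, z, y] := by
    ext i
    fin_cases i <;> rfl
  rw [this] at h
  simpa using h

theorem orientedChains_distinct (c : orientedChains T 2) (x y z : V) (h : c.1 ![x, y, z] ≠ 0) :
    x ≠ y ∧ x ≠ z ∧ y ≠ z ∧ {x, y, z} ∈ T.faces := by
  have hf := c.2.1 _ h
  rw [image_fin_three] at hf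
  refine ⟨?_, ?_, ?_, hf⟩
  · rintro rfl
    have := orientedChains_swap c x x z
    omega
  · rintro rfl
    have h1 := orientedChains_swap c x y x
    have h2 := orientedChains_swap' c x x y
    have h3 := orientedChains_swap c x x y
    omega
  · rintro rfl
    have := orientedChains_swap' c x y y
    omega

theorem mem_cycles_iff (c : orientedChains T 2) :
    c ∈ simplicialCycles T 2 ↔ ∀ x y, ∑ v, c.1 ![v, x, y] = 0 := by
  change chainBoundary T 1 c = 0 ↔ _
  constructor
  · intro h x y
    exact congrFun (congrArg Subtype.val h) ![x, y]
  · intro h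
    ext y
    have : y = ![y 0, y 1] := by ext i; fin_cases i <;> rfl
    rw [this]
    exact h _ _

/-- Faces have at most three vertices, so a 4-tuple in a face repeats an entry and an alternating
function vanishes on it. Hence no nonzero 2-cycle is a boundary. -/
theorem orientedChains_three_eq_zero (hT : IsMod2Sphere T) (c : orientedChains T 3) : c = 0 := by
  ext x
  by_contra h
  change c.1 x ≠ 0 at h
  have h1 := hT.card_le _ (c.2.1 x h)
  have h2 : ¬ Function.Injective x := fun hx => by
    rw [card_image_of_injective _ hx] at h1
    simp at h1
  simp only [Function.Injective, not_forall] at h2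
  obtain ⟨i, j, hij, hne⟩ := h2
  have h3 := c.2.2 x (Equiv.swap i j)
  rw [Equiv.Perm.sign_swap hne] at h3
  have : x ∘ Equiv.swap i j = x := by
    ext k
    simp only [Function.comp, Equiv.swap_apply_def]
    split_ifs with h h'
    · rw [h, hij]
    · rw [h', hij]
    · rfl
  rw [this] at h3
  push_cast at h3
  omega

/-- The chain given by an orientation. -/
def IsOrientation.chain {o : V → V → V → ℤ} (ho : IsOrientation T o) : orientedChains T 2 :=
  ⟨fun p => o (p 0) (p 1) (p 2), fun p hp => by
    rw [image_fin_three]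
    exact (ho.distinct _ _ _ hp).2.2.2, fun p σ => by
    -- The six permutations as words in the two adjacent transpositions, for which alternation is
    -- known.
    have key : ∀ σ : Equiv.Perm (Fin 3), σ = 1 ∨ σ = Equiv.swap 0 1 ∨ σ = Equiv.swap 1 2 ∨
      σ = Equiv.swap 0 1 * Equiv.swap 1 2 ∨ σ = Equiv.swap 1 2 * Equiv.swap 0 1 ∨
        σ = Equiv.swap 0 1 * Equiv.swap 1 2 * Equiv.swap 0 1 := by decide
    have h1 := ho.swap
    have h2 := ho.swap'
    have s1 : Equiv.Perm.sign (Equiv.swap (0 : Fin 3) 1) = -1 := Equiv.Perm.sign_swap (by decide)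
    have s2 : Equiv.Perm.sign (Equiv.swap (1 : Fin 3) 2) = -1 := Equiv.Perm.sign_swap (by decide)
    rcases key σ with rfl | rfl | rfl | rfl | rfl | rfl
    · simp
    · rw [s1]
      change o (p 1) (p 0) (p 2) = _
      simp [h1 (p 0) (p 1)]
    · rw [s2]
      change o (p 0) (p 2) (p 1) = _
      simp [h2 (p 0) (p 1)]
    · rw [Equiv.Perm.sign_mul, s1, s2]
      change o (p 1) (p 2) (p 0) = _
      rw [h2 (p 1) (p 0) (p 2), h1 (p 0) (p 1)]
      simp
    · rw [Equiv.Perm.sign_mul, s1, s2]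
      change o (p 2) (p 0) (p 1) = _
      rw [h1 (p 0) (p 2) (p 1), h2 (p 0) (p 1)]
      simp
    · rw [Equiv.Perm.sign_mul, Equiv.Perm.sign_mul, s1, s2]
      change o (p 2) (p 1) (p 0) = _
      rw [h1 (p 1) (p 2) (p 0), h2 (p 1) (p 0) (p 2), h1 (p 0) (p 1)]
      simp⟩

/-- The cycle given by an orientation. -/
def IsOrientation.fundamentalCycle {o : V → V → V → ℤ} (ho : IsOrientation T o) :
    simplicialCycles T 2 := ⟨ho.chain, (mem_cycles_iff _).2 ho.cycle⟩

theorem IsOrientation.exists_eq_smul (hT : IsMod2Sphere T) {o : V → V → V → ℤ}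
    (ho : IsOrientation T o) (c : simplicialCycles T 2) : ∃ k : ℤ, c = k • ho.fundamentalCycle := by
  obtain ⟨k, hk⟩ := hT.exists_eq_mul ho (orientedChains_distinct c.1) (orientedChains_swap c.1)
    (orientedChains_swap' c.1) ((mem_cycles_iff c.1).1 c.2)
  refine ⟨k, Subtype.ext (Subtype.ext (funext fun p => ?_))⟩
  have hp : p = ![p 0, p 1, p 2] := by ext i; fin_cases i <;> rfl
  have h := hk (p 0) (p 1) (p 2)
  rw [← hp] at h
  exact h

/-- Every cycle is a multiple of this one, there are no boundaries to divide out, and a nonzero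
value on some triangle shows that the class has infinite order. -/
theorem IsOrientation.isFundamentalClass (hT : IsMod2Sphere T) {o : V → V → V → ℤ}
    (ho : IsOrientation T o) :
    IsFundamentalClass 2 (QuotientAddGroup.mk ho.fundamentalCycle : SimplicialHomology T 2) := by
  constructor
  · intro k l hkl
    have h1 : (QuotientAddGroup.mk (k • ho.fundamentalCycle) : SimplicialHomology T 2) =
      QuotientAddGroup.mk (l • ho.fundamentalCycle) := hkl
    rw [QuotientAddGroup.eq] at h1
    obtain ⟨b, hb⟩ := h1
    rw [orientedChains_three_eq_zero hT b, map_zero] at hb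
    obtain ⟨t⟩ := hT.nonempty_tri
    obtain ⟨x, y, z, hxy, hxz, hyz, h⟩ := card_eq_three.1 t.2.2
    have h2 : 0 = -(k * o x y z) + l * o x y z := congrFun (congrArg Subtype.val hb) ![x, y, z]
    have h3 : o x y z ≠ 0 := by
      rcases ho.unit x y z hxy hxz hyz (h ▸ t.2.1) with h' | h' <;> rw [h'] <;> norm_num
    exact mul_right_cancel₀ h3 (by linarith)
  · intro b
    obtain ⟨c, rfl⟩ := QuotientAddGroup.mk_surjective b
    obtain ⟨k, rfl⟩ := ho.exists_eq_smul hT c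
    exact ⟨k, rfl⟩

end Chains

/-! ### The degree of the branch map. -/

section Degree

open Finset Matrix

variable {V₁ V₂ : Type*} [Fintype V₁] [DecidableEq V₁] [Fintype V₂] [DecidableEq V₂]
  {T₁ : AbstractSimplicialComplex V₁} {T₂ : AbstractSimplicialComplex V₂}

/-- This cancels the triples that `f` maps degenerately, with two vertices sent to the same point.
-/
theorem sum_eq_zero_of_antisymm {ι : Type*} [Fintype ι] (A : ι → Prop) [DecidablePred A]
    (F : ι → ι → ℤ) (hF : ∀ a b, F b a = -F a b) :
    ∑ a, ∑ b, (if A a ∧ A b then F a b else 0) = 0 := by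
  have h : ∑ a, ∑ b, (if A a ∧ A b then F a b else 0) =
      -∑ a, ∑ b, (if A a ∧ A b then F a b else 0) := by
    conv_rhs => rw [sum_comm]
    rw [← sum_neg_distrib]
    refine sum_congr rfl fun a _ => ?_
    rw [← sum_neg_distrib]
    refine sum_congr rfl fun b _ => ?_
    rw [hF b a]
    by_cases h : A a ∧ A b
    · rw [if_pos h, if_pos h.symm]
    · rw [if_neg h, if_neg fun h' => h h'.symm, neg_zero]
  omega

/-- Let `p` be a region at `s e₁`, with `e₁ = {x, y}`, and `z` the third vertex of its cell. Since
`τ` is injective, only triangles of `p` map onto that cell. So the coefficient at `(z, x, y)` comes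
from the part of the fundamental cycle in `p`, and equals the coefficient at `(x, y)` of the image
of its boundary. Over `{x, y}` this boundary is supported on the single edge `s e₁`. -/
theorem MinorModel.degree_eq (m : MinorModel T₁ T₂) (hT₁ : IsMod2Sphere T₁) (hT₂ : IsMod2Sphere T₂)
    {o₁ : V₁ → V₁ → V₁ → ℤ} {o₂ : V₂ → V₂ → V₂ → ℤ} (ho₁ : IsOrientation T₁ o₁)
    (ho₂ : IsOrientation T₂ o₂) (k : ℤ)
    (hk : ∀ x y z, ∑ u, ∑ w, ∑ a, (if m.f a = z ∧ m.f u = x ∧ m.f w = y then o₂ a u w else 0) =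
      k * o₁ z x y) : k = 1 ∨ k = -1 := by
  classical
  obtain ⟨τ, hτ, hedge, hinj⟩ := m.exists_faces hT₁ hT₂
  obtain ⟨v₀⟩ := hT₁.nonempty
  obtain ⟨e₁, -⟩ := hT₁.exists_edge v₀
  obtain ⟨t, t', htt', hfil⟩ := hT₂.exists_two (m.s e₁)
  have ht : (m.s e₁).1 ⊆ t.1 := by
    have : t ∈ (univ.filter fun t : Tri T₂ => (m.s e₁).1 ⊆ t.1) := by rw [hfil]; simp
    exact (mem_filter.1 this).2
  have ht' : (m.s e₁).1 ⊆ t'.1 := by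
    have : t' ∈ (univ.filter fun t : Tri T₂ => (m.s e₁).1 ⊆ t.1) := by rw [hfil]; simp
    exact (mem_filter.1 this).2
  have hreg := (m.card_region_edge hT₂ e₁).2 ((m.card_support hT₁ hT₂).2 e₁) t t' htt' ht ht'
  set p := m.region t with hp
  have hτp : e₁.1 ⊆ (τ p).1 := hedge p e₁ ⟨t, t', ht, ht', rfl, hreg.symm⟩
  obtain ⟨u₀, w₀, huw₀, hs⟩ := (m.s e₁).exists_eq
  set x := m.f u₀ with hx
  set y := m.f w₀ with hy
  have he₁ : e₁.1 = {x, y} := by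
    rw [← m.image_s, hs, image_insert, image_singleton]
  have hxy : x ≠ y := fun h => huw₀ (m.injOn_s e₁ (by simp [hs]) (by simp [hs]) h)
  obtain ⟨z, hzx, hzy, hz⟩ : ∃ z, z ≠ x ∧ z ≠ y ∧ (τ p).1 = {z, x, y} := by
    obtain ⟨a, b, ha, hb, hab, h⟩ := (τ p).exists_eq_of_mem (v := x) (hτp (by simp [he₁]))
    have hy' : y ∈ ({x, a, b} : Finset V₁) := by rw [← h]; exact hτp (by simp [he₁])
    simp only [mem_insert, mem_singleton] at hy'
    rcases hy' with h' | h' | h'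
    · exact absurd h'.symm hxy
    · exact ⟨b, hb.symm, by rw [h']; exact hab.symm, by rw [h, ← h']; grind⟩
    · exact ⟨a, ha.symm, by rw [h']; exact hab, by rw [h, ← h']; grind⟩
  -- the fundamental chain restricted to the region `p`
  let r : V₂ → V₂ → V₂ → Prop := fun a u w => ∃ t : Tri T₂, t.1 = {a, u, w} ∧ m.region t = p
  let F : V₂ → V₂ → V₂ → ℤ := fun a u w => if r a u w then o₂ a u w else 0
  have F1 : ∀ a u w, F u a w = -F a u w := by
    intro a u w
    have : r u a w ↔ r a u w := by simp only [r, insert_comm u a]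
    simp only [F, this, ho₂.swap a u w]
    split_ifs <;> simp
  have F2 : ∀ a u w, F w u a = -F a u w := by
    intro a u w
    have : r w u a ↔ r a u w := by
      have : ({w, u, a} : Finset V₂) = {a, u, w} := by grind
      simp only [r, this]
    simp only [F, this]
    rw [ho₂.swap u w a, ho₂.swap' u a w, ho₂.swap a u w]
    split_ifs <;> simp
  -- For `u` over `x` and `w` over `y`, the vertex `a` of a triangle of `p` lies over `z`, `x` or
  -- `y`. The first case is the coefficient sought; the other two are degenerate and will cancel.
  have hR1 : ∀ u w a, (if m.f u = x ∧ m.f w = y then F a u w else 0) =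
      (if m.f a = z ∧ m.f u = x ∧ m.f w = y then o₂ a u w else 0) +
      (if m.f w = y then (if m.f a = x ∧ m.f u = x then F a u w else 0) else 0) +
      (if m.f u = x then (if m.f a = y ∧ m.f w = y then F a u w else 0) else 0) := by
    intro u w a
    by_cases h : m.f u = x ∧ m.f w = y
    · rw [if_pos h, if_pos h.1, if_pos h.2]
      obtain ⟨h1, h2⟩ := h
      simp only [h1, h2, and_true]
      by_cases h0 : o₂ a u w = 0
      · have : F a u w = 0 := by simp only [F, h0, ite_self]
        simp [this, h0]
      · obtain ⟨d1, d2, d3, hf⟩ := ho₂.distinct _ _ _ h0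
        let t₁ : Tri T₂ := ⟨{a, u, w}, hf, card_eq_three.2 ⟨a, u, w, d1, d2, d3, rfl⟩⟩
        have hr : r a u w ↔ m.region t₁ = p := by
          constructor
          · rintro ⟨t₂, h3, h4⟩
            rw [← h4]
            exact congrArg m.region (Subtype.ext h3.symm)
          · intro h
            exact ⟨t₁, rfl, h⟩
        have himg : t₁.1.image m.f = {m.f a, x, y} := by
          simp only [t₁, image_insert, image_singleton, h1, h2]
        have hsub := hτ t₁
        rw [himg] at hsub
        by_cases haz : m.f a = z
        · have : r a u w := by
            rw [hr]
            apply hinj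
            apply Subtype.ext
            rw [hz, ← haz]
            exact (eq_of_subset_of_card_le hsub (by
              rw [(τ (m.region t₁)).2.2, card_eq_three.2
                ⟨m.f a, x, y, haz ▸ hzx, haz ▸ hzy, hxy, rfl⟩])).symm
          simp [F, this, haz, hzx, hzy]
        · by_cases hrp : r a u w
          · rw [hr.1 hrp, hz] at hsub
            have : m.f a ∈ ({z, x, y} : Finset V₁) := hsub (by simp)
            simp only [mem_insert, mem_singleton] at this
            rcases this with h' | h' | h'
            · exact absurd h' haz
            · simp [h', hzx.symm, hxy]
            · simp [h', hzy.symm, hxy.symm]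
          · have : F a u w = 0 := if_neg hrp
            simp [this, haz]
    · rw [if_neg h, if_neg (fun h' => h h'.2)]
      by_cases h1 : m.f u = x
      · have h2 : m.f w ≠ y := fun h2 => h ⟨h1, h2⟩
        simp [h2]
      · simp [h1]
  -- Sum over the third vertex of a triangle on `{u, w}`. An edge over `{x, y}` other than `s e₁`
  -- lies in `D`, so both its triangles are in `p` or neither is, and the cycle condition gives
  -- zero.
  have hR2 : ∀ u w, (∑ a, if m.f u = x ∧ m.f w = y then F a u w else 0) =
      if u = u₀ ∧ w = w₀ then ∑ a, F a u₀ w₀ else 0 := by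
    intro u w
    by_cases h : m.f u = x ∧ m.f w = y
    · by_cases h' : u = u₀ ∧ w = w₀
      · obtain ⟨rfl, rfl⟩ := h'
        simp only [h, and_self, if_true]
      · rw [if_neg h']
        simp only [h, and_self, if_true]
        have huw : u ≠ w := by rintro rfl; exact hxy (h.1.symm.trans h.2)
        by_cases hf : {u, w} ∈ T₂.faces
        · let e : Edg T₂ := ⟨{u, w}, hf, card_pair huw⟩
          have hC : e ∉ m.C := fun hC => hxy (h.1.symm.trans
            ((m.C_fiber e hC u (by simp [e]) w (by simp [e])).trans h.2))
          have hs' : ∀ e', m.s e' ≠ e := by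
            intro e' he'
            have h1 : e'.1 = e₁.1 := by
              rw [← m.image_s, he', he₁]
              simp only [e, image_insert, image_singleton, h]
            have h2 : e' = e₁ := Subtype.ext h1
            subst h2
            have h3 : u ∈ (m.s e').1 := by rw [he']; simp [e]
            have h4 : w ∈ (m.s e').1 := by rw [he']; simp [e]
            exact h' ⟨m.injOn_s e' h3 (by simp [hs]) h.1, m.injOn_s e' h4 (by simp [hs]) h.2⟩
          have hD : e ∈ m.D := m.mem_D.2 ⟨hC, hs'⟩
          have hrr : ∀ a b, o₂ a u w ≠ 0 → r b u w → r a u w := by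
            rintro a b ha ⟨t₁, h1, h2⟩
            obtain ⟨d1, d2, d3, hf⟩ := ho₂.distinct _ _ _ ha
            refine ⟨⟨{a, u, w}, hf, card_eq_three.2 ⟨a, u, w, d1, d2, d3, rfl⟩⟩, rfl, ?_⟩
            rw [← h2]
            exact m.region_eq hD (by simp [e]) (by rw [h1]; simp [e])
          by_cases hb : ∃ b, r b u w
          · obtain ⟨b, hb⟩ := hb
            rw [← ho₂.cycle u w]
            refine sum_congr rfl fun a _ => ?_
            by_cases ha : o₂ a u w = 0
            · simp [F, ha]
            · exact if_pos (hrr a b ha hb)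
          · exact sum_eq_zero fun a _ => if_neg fun h => hb ⟨a, h⟩
        · refine sum_eq_zero fun a _ => ?_
          by_contra hne
          have ha : o₂ a u w ≠ 0 := fun h0 => hne (by simp [F, h0])
          exact hf (mem_faces_of_subset (ho₂.distinct _ _ _ ha).2.2.2 (by simp) (by simp))
    · rw [if_neg, sum_congr rfl fun a _ => if_neg h, sum_const_zero]
      rintro ⟨rfl, rfl⟩
      exact h ⟨rfl, rfl⟩
  have hL : ∑ u, ∑ w, ∑ a, (if m.f u = x ∧ m.f w = y then F a u w else 0) = ∑ a, F a u₀ w₀ := by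
    rw [sum_congr rfl fun u _ => sum_congr rfl fun w _ => hR2 u w]
    simp [ite_and]
  have hA : ∑ u, ∑ w, ∑ a, (if m.f w = y then
      (if m.f a = x ∧ m.f u = x then F a u w else 0) else 0) = 0 := by
    rw [sum_comm]
    refine sum_eq_zero fun w _ => ?_
    by_cases hw : m.f w = y
    · simp only [hw, if_true]
      rw [sum_comm]
      exact sum_eq_zero_of_antisymm (fun a => m.f a = x) (fun a u => F a u w) fun a u => F1 a u w
    · simp [hw]
  have hB : ∑ u, ∑ w, ∑ a, (if m.f u = x then
      (if m.f a = y ∧ m.f w = y then F a u w else 0) else 0) = 0 := by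
    refine sum_eq_zero fun u _ => ?_
    by_cases hu : m.f u = x
    · simp only [hu, if_true]
      rw [sum_comm]
      exact sum_eq_zero_of_antisymm (fun a => m.f a = y) (fun a w => F a u w) fun a w => F2 a u w
    · simp [hu]
  have hmain : k * o₁ z x y = ∑ a, F a u₀ w₀ := by
    rw [← hL, ← hk x y z]
    simp only [hR1, sum_add_distrib, hA, hB, add_zero]
  have hthird : ∀ s : Tri T₂, (m.s e₁).1 ⊆ s.1 → ∃ a, a ≠ u₀ ∧ a ≠ w₀ ∧ s.1 = {a, u₀, w₀} := by
    intro s hs'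
    rw [hs] at hs'
    obtain ⟨a, b, ha, hb, hab, h⟩ := s.exists_eq_of_mem (v := u₀) (hs' (by simp))
    have hw : w₀ ∈ ({u₀, a, b} : Finset V₂) := by rw [← h]; exact hs' (by simp)
    simp only [mem_insert, mem_singleton] at hw
    rcases hw with h' | h' | h'
    · exact absurd h'.symm huw₀
    · exact ⟨b, hb.symm, by rw [h']; exact hab.symm, by rw [h, ← h']; grind⟩
    · exact ⟨a, ha.symm, by rw [h']; exact hab, by rw [h, ← h']; grind⟩
  obtain ⟨a₀, hau, haw, ha₀⟩ := hthird t ht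
  -- Of the two triangles at `s e₁`, only `t` lies in the region `p`.
  have hval : ∑ a, F a u₀ w₀ = o₂ a₀ u₀ w₀ := by
    rw [sum_eq_single a₀]
    · exact if_pos ⟨t, ha₀, rfl⟩
    · intro b _ hb
      by_contra hne
      have hrb : r b u₀ w₀ := by by_contra h; exact hne (if_neg h)
      obtain ⟨t₁, h1, h2⟩ := hrb
      have hmem : t₁ ∈ (univ.filter fun t : Tri T₂ => (m.s e₁).1 ⊆ t.1) := by
        simp [hs, h1]
      rw [hfil, mem_insert, mem_singleton] at hmem
      rcases hmem with rfl | rfl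
      · have hb0 : o₂ b u₀ w₀ ≠ 0 := fun h0 => hne (by simp [F, h0])
        have hd := ho₂.distinct _ _ _ hb0
        have : b ∈ ({a₀, u₀, w₀} : Finset V₂) := by rw [← ha₀, h1]; simp
        simp only [mem_insert, mem_singleton] at this
        tauto
      · exact hreg h2.symm
    · simp
  have hu1 := ho₁.unit z x y hzx hzy hxy (hz ▸ (τ p).2.1)
  have hu2 := ho₂.unit a₀ u₀ w₀ hau haw huw₀ (ha₀ ▸ t.2.1)
  rw [hval] at hmain
  rcases hu1 with h1 | h1 <;> rcases hu2 with h2 | h2 <;> rw [h1, h2] at hmain <;> omega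

/-- Entry `0` is summed innermost, because it is the one summed over by the boundary operator. -/
theorem sum_fin_three {W : Type*} [Fintype W] (G : (Fin 3 → W) → ℤ) :
    ∑ p, G p = ∑ u, ∑ w, ∑ a, G ![a, u, w] := by
  let φ : W × W × W ≃ (Fin 3 → W) :=
    { toFun := fun q => ![q.2.2, q.1, q.2.1]
      invFun := fun p => (p 1, p 2, p 0)
      left_inv := fun _ => rfl
      right_inv := fun p => by ext i; fin_cases i <;> rfl }
  rw [← Fintype.sum_equiv φ (fun q => G (φ q)) G fun _ => rfl, Fintype.sum_prod_type]
  exact sum_congr rfl fun u _ => Fintype.sum_prod_type _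

theorem MinorModel.exists_degree (m : MinorModel T₁ T₂) (hT₁ : IsMod2Sphere T₁)
    (hT₂ : IsMod2Sphere T₂) :
    ∃ d : ℤ, (d = 1 ∨ d = -1) ∧ (m.toSimplicialMap hT₁ hT₂).HasDegree 2 d := by
  obtain ⟨o₁, ho₁⟩ := hT₁.exists_orientation
  obtain ⟨o₂, ho₂⟩ := hT₂.exists_orientation
  obtain ⟨k, hk⟩ := ho₁.exists_eq_smul hT₁
    ((m.toSimplicialMap hT₁ hT₂).mapCycles 2 ho₂.fundamentalCycle)
  refine ⟨k, m.degree_eq hT₁ hT₂ ho₁ ho₂ k fun x y z => ?_, _, _, ho₂.isFundamentalClass hT₂,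
    ho₁.isFundamentalClass hT₁, ?_⟩
  · have h := congrFun (congrArg (fun c => c.1.1) hk) ![z, x, y]
    refine Eq.trans ?_ h
    refine Eq.trans ?_ (sum_fin_three _).symm
    refine sum_congr rfl fun u _ => sum_congr rfl fun w _ => sum_congr rfl fun a _ => ?_
    refine if_congr ?_ rfl rfl
    change _ ↔ m.f ∘ ![a, u, w] = ![z, x, y]
    simp [funext_iff, Fin.forall_fin_succ]
  · change QuotientAddGroup.mk _ = _
    rw [hk]
    rfl

end Degree

/-! ### Continuous logarithms. -/

section Logarithms

open Set Filter Topology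

/-- Maps from star-shaped sets lift to covering spaces. -/
theorem IsCoveringMap.exists_lift_of_starConvex {E X F : Type*} [TopologicalSpace E]
    [TopologicalSpace X] [AddCommGroup F] [Module ℝ F] [TopologicalSpace F] [IsTopologicalAddGroup F]
    [ContinuousSMul ℝ F] {p : E → X} (cov : IsCoveringMap p) {s : Set F} {q : F} (hq : q ∈ s)
    (hs : StarConvex ℝ q s) (g : C(s, X)) (e : E) (he : p e = g ⟨q, hq⟩) :
    ∃ L : C(s, E), ∀ y, p (L y) = g y := by
  have hmem : ∀ (t : unitInterval) (y : s), q + (t : ℝ) • (y.1 - q) ∈ s := fun t y =>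
    hs.add_smul_sub_mem y.2 t.2.1 t.2.2
  -- The radial contraction to `q` makes `g` homotopic to a constant. The homotopy lifts starting
  -- from the constant `e`, and its end lifts `g`.
  let H : C(unitInterval × s, X) := g.comp
    ⟨fun ty => ⟨q + (ty.1 : ℝ) • (ty.2.1 - q), hmem ty.1 ty.2⟩, by fun_prop⟩
  let L := cov.liftHomotopy H (ContinuousMap.const s e) (fun a => by
    rw [ContinuousMap.const_apply, he]
    change g _ = g _
    congr 1
    simp)
  refine ⟨L.comp ((ContinuousMap.const s 1).prodMk (ContinuousMap.id s)), fun y => ?_⟩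
  have h := congrFun (cov.liftHomotopy_lifts H (ContinuousMap.const s e) (fun a => by
    rw [ContinuousMap.const_apply, he]
    change g _ = g _
    congr 1
    simp)) (1, y)
  refine h.trans ?_
  change g _ = g _
  congr 1
  simp

variable {F : Type*} [TopologicalSpace F]

/-- Every nonvanishing continuous complex function on `s` has a continuous logarithm. -/
def HasLogs (s : Set F) : Prop :=
  ∀ g : F → ℂ, ContinuousOn g s → (∀ x ∈ s, g x ≠ 0) →
    ∃ L : F → ℂ, ContinuousOn L s ∧ ∀ x ∈ s, Complex.exp (L x) = g x

theorem exp_eqOn {s : Set F} (hs : IsPreconnected s) {L L' : F → ℂ} (hL : ContinuousOn L s)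
    (hL' : ContinuousOn L' s) (h : ∀ x ∈ s, Complex.exp (L x) = Complex.exp (L' x)) {a : F}
    (ha : a ∈ s) (haa : L a = L' a) : ∀ x ∈ s, L x = L' x :=
  Complex.isCoveringMap_exp.eqOn_of_comp_eqOn hs hL hL'
    (fun x hx => Subtype.ext (h x hx)) ha haa

theorem HasLogs.of_isEmpty {s : Set F} (hs : s = ∅) : HasLogs s := by
  subst hs
  exact fun g _ _ => ⟨g, continuousOn_empty _, fun x hx => hx.elim⟩

theorem HasLogs.of_starConvex {F : Type*} [AddCommGroup F] [Module ℝ F] [TopologicalSpace F]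
    [IsTopologicalAddGroup F] [ContinuousSMul ℝ F] {s : Set F} {q : F} (hs : StarConvex ℝ q s) :
    HasLogs s := by
  classical
  rcases s.eq_empty_or_nonempty with h | ⟨y, hy⟩
  · exact .of_isEmpty h
  have hq : q ∈ s := hs.mem ⟨y, hy⟩
  intro g hg h0
  let g' : C(s, {z : ℂ // z ≠ 0}) := ⟨fun x => ⟨g x, h0 x x.2⟩, by
    have := continuousOn_iff_continuous_domRestrict.1 hg
    exact this.subtype_mk _⟩
  obtain ⟨L, hL⟩ := Complex.isCoveringMap_exp.exists_lift_of_starConvex hq hs g'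
    (Complex.log (g q)) (Subtype.ext (Complex.exp_log (h0 q hq)))
  refine ⟨fun x => if h : x ∈ s then L ⟨x, h⟩ else 0, ?_, fun x hx => ?_⟩
  · rw [continuousOn_iff_continuous_domRestrict]
    convert! L.continuous using 1
    ext x
    simp
  · beta_reduce
    rw [dif_pos hx]
    exact congrArg Subtype.val (hL ⟨x, hx⟩)

/-- On the connected overlap two logarithms of the same function differ by a constant in `2πiℤ`.
Subtracting it makes them agree, so they glue. -/
theorem HasLogs.union {s O₁ O₂ : Set F} (h₁ : IsOpen O₁) (h₂ : IsOpen O₂) (hs : s ⊆ O₁ ∪ O₂)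
    (hl₁ : HasLogs (s ∩ O₁)) (hl₂ : HasLogs (s ∩ O₂)) (hc : IsPreconnected (s ∩ (O₁ ∩ O₂))) :
    HasLogs s := by
  classical
  intro g hg h0
  obtain ⟨L₁, c₁, e₁⟩ := hl₁ g (hg.mono inter_subset_left) fun x hx => h0 x hx.1
  obtain ⟨L₂, c₂, e₂⟩ := hl₂ g (hg.mono inter_subset_left) fun x hx => h0 x hx.1
  obtain ⟨c, hc0, hc⟩ : ∃ c : ℂ, (∀ x ∈ s ∩ O₂, Complex.exp (L₂ x + c) = g x) ∧
      ∀ x ∈ s ∩ (O₁ ∩ O₂), L₁ x = L₂ x + c := by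
    rcases (s ∩ (O₁ ∩ O₂)).eq_empty_or_nonempty with h | ⟨a, ha⟩
    · exact ⟨0, fun x hx => by rw [add_zero, e₂ x hx], by simp [h]⟩
    · have hexp : Complex.exp (L₁ a - L₂ a) = 1 := by
        rw [Complex.exp_sub, e₁ a ⟨ha.1, ha.2.1⟩, e₂ a ⟨ha.1, ha.2.2⟩, div_self (h0 a ha.1)]
      refine ⟨L₁ a - L₂ a, fun x hx => by rw [Complex.exp_add, e₂ x hx, hexp, mul_one], ?_⟩
      refine exp_eqOn hc (c₁.mono fun x hx => ⟨hx.1, hx.2.1⟩)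
        ((c₂.mono fun x hx => ⟨hx.1, hx.2.2⟩).add continuousOn_const) (fun x hx => ?_) ha (by ring)
      rw [Complex.exp_add, hexp, mul_one, e₁ x ⟨hx.1, hx.2.1⟩, e₂ x ⟨hx.1, hx.2.2⟩]
  have hL₂ : EqOn (fun x => if x ∈ O₁ then L₁ x else L₂ x + c) (fun x => L₂ x + c) (s ∩ O₂) := by
    intro x hx
    by_cases h : x ∈ O₁
    · simp only [if_pos h]
      exact hc x ⟨hx.1, h, hx.2⟩
    · simp only [if_neg h]
  have hL₁ : EqOn (fun x => if x ∈ O₁ then L₁ x else L₂ x + c) L₁ (s ∩ O₁) := fun x hx => by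
    simp only [if_pos hx.2]
  refine ⟨fun x => if x ∈ O₁ then L₁ x else L₂ x + c, ?_, fun x hx => ?_⟩
  · refine continuousOn_of_locally_continuousOn fun x hx => ?_
    rcases hs hx with h | h
    · exact ⟨O₁, h₁, h, c₁.congr hL₁⟩
    · exact ⟨O₂, h₂, h, (c₂.add continuousOn_const).congr hL₂⟩
  · rcases hs hx with h | h
    · rw [hL₁ ⟨hx, h⟩, e₁ x ⟨hx, h⟩]
    · rw [hL₂ ⟨hx, h⟩, hc0 x ⟨hx, h⟩]

end Logarithms

/-! ### Winding numbers. -/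

section Winding

open Set Filter Topology Complex

/-- The loop `γ : [0, 2π] → ℂ` winds `w` times around `0`. -/
def IsWinding (γ : ℝ → ℂ) (w : ℤ) : Prop :=
  ∃ Γ : ℝ → ℂ, Continuous Γ ∧ (∀ θ, exp (Γ θ) = γ θ) ∧ Γ (2 * Real.pi) = Γ 0 + w * (2 * Real.pi * I)

theorem IsWinding.unique {γ : ℝ → ℂ} {w w' : ℤ} (h : IsWinding γ w) (h' : IsWinding γ w') :
    w = w' := by
  obtain ⟨Γ, hc, he, hw⟩ := h
  obtain ⟨Γ', hc', he', hw'⟩ := h'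
  have h0 : exp (Γ 0 - Γ' 0) = 1 := by
    rw [exp_sub, he, he', div_self]
    rw [← he]; exact exp_ne_zero _
  have key := exp_eqOn (s := univ) isPreconnected_univ hc.continuousOn
    (L' := fun θ => Γ' θ + (Γ 0 - Γ' 0)) (hc'.add continuous_const).continuousOn
    (fun θ _ => by rw [exp_add, h0, mul_one, he, he']) (mem_univ 0) (by ring) (2 * Real.pi)
    (mem_univ _)
  rw [hw, hw'] at key
  have h1 : ((w : ℂ) - w') * (2 * Real.pi * I) = 0 := by linear_combination key
  have h2 := (mul_eq_zero.1 h1).resolve_right Complex.two_pi_I_ne_zero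
  exact_mod_cast sub_eq_zero.1 h2

theorem exists_isWinding {γ : ℝ → ℂ} (hc : Continuous γ) (h0 : ∀ θ, γ θ ≠ 0)
    (hp : γ (2 * Real.pi) = γ 0) : ∃ w, IsWinding γ w := by
  obtain ⟨Γ, hΓ, he⟩ := HasLogs.of_starConvex (q := (0 : ℝ)) (convex_univ.starConvex (mem_univ _)) γ
    hc.continuousOn fun θ _ => h0 θ
  have : exp (Γ (2 * Real.pi)) = exp (Γ 0) := by rw [he _ (mem_univ _), he _ (mem_univ _), hp]
  obtain ⟨n, hn⟩ := exp_eq_exp_iff_exists_int.1 this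
  exact ⟨n, Γ, continuousOn_univ.1 hΓ, fun θ => he θ (mem_univ _), hn⟩

theorem isWinding_circle {ρ : ℝ} (hρ : 0 < ρ) : IsWinding (fun θ => ρ * exp (θ * I)) 1 := by
  refine ⟨fun θ => Real.log ρ + θ * I, by fun_prop, fun θ => ?_, ?_⟩
  · rw [exp_add, ← ofReal_exp, Real.exp_log hρ]
  · push_cast; ring

theorem isWinding_zero_of_log {γ Γ : ℝ → ℂ} (hc : Continuous Γ) (he : ∀ θ, exp (Γ θ) = γ θ)
    (hp : Γ (2 * Real.pi) = Γ 0) : IsWinding γ 0 := ⟨Γ, hc, he, by simp [hp]⟩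

/-- The condition says that the loop avoids the closed ray from `0` through `-I`, off which a branch
of the logarithm exists. -/
theorem isWinding_zero_of_slitPlane {γ : ℝ → ℂ} (hc : Continuous γ)
    (hp : γ (2 * Real.pi) = γ 0) (h : ∀ θ, -I * γ θ ∈ slitPlane) : IsWinding γ 0 := by
  refine isWinding_zero_of_log (Γ := fun θ => log (-I * γ θ) + log I) ?_ (fun θ => ?_) ?_
  · exact ((continuous_const.mul hc).clog h).add continuous_const
  · rw [exp_add, exp_log (slitPlane_ne_zero (h θ)), exp_log I_ne_zero]
    linear_combination -γ θ * I_mul_I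
  · simp only [hp]

/-- A nonvanishing function on a punctured disc multiplies winding numbers by a constant. -/
theorem exists_winding_factor {r : ℝ} {g : ℂ → ℂ} (hg : ContinuousOn g (Metric.ball 0 r \ {0}))
    (h0 : ∀ z ∈ Metric.ball (0 : ℂ) r \ {0}, g z ≠ 0) :
    ∃ n : ℤ, ∀ (γ : ℝ → ℂ) (w : ℤ), (∀ θ, γ θ ∈ Metric.ball (0 : ℂ) r) → IsWinding γ w →
      IsWinding (g ∘ γ) (n * w) := by
  -- The half-plane `W` is the universal cover of the punctured disc under `exp`.
  let W : Set ℂ := {ζ | ζ.re ∈ Iio (Real.log r)}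
  rcases le_or_gt r 0 with hr | hr
  · refine ⟨0, fun γ w h _ => ?_⟩
    have := h 0
    rw [Metric.ball_eq_empty.2 hr] at this
    exact this.elim
  have hconv : Convex ℝ W := (convex_Iio _).linear_preimage reLm
  have hmem : ∀ ζ, ζ ∈ W ↔ exp ζ ∈ Metric.ball (0 : ℂ) r \ {0} := by
    intro ζ
    simp only [W, mem_ofPred_eq, mem_Iio, Set.mem_sdiff, Metric.mem_ball, dist_zero_right, norm_exp,
      mem_singleton_iff, exp_ne_zero, not_false_eq_true, and_true]
    exact Real.lt_log_iff_exp_lt hr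
  have hper : ∀ ζ ∈ W, ∀ n : ℤ, ζ + n * (2 * Real.pi * I) ∈ W := by
    intro ζ hζ n
    simpa [W] using hζ
  obtain ⟨ζ₀, hζ₀⟩ : ∃ ζ₀, ζ₀ ∈ W := ⟨(Real.log r - 1 : ℝ), by simp [W, -ofReal_sub]⟩
  obtain ⟨G, hG, hGe⟩ := HasLogs.of_starConvex (hconv.starConvex hζ₀) (g ∘ exp)
    (hg.comp continuous_exp.continuousOn fun ζ hζ => (hmem ζ).1 hζ)
    fun ζ hζ => h0 _ ((hmem ζ).1 hζ)
  -- The factor `n` is the monodromy of the logarithm `G` of `g ∘ exp` under translation by `2πi`.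
  have hstep : ∃ n : ℤ, ∀ ζ ∈ W, G (ζ + 2 * Real.pi * I) = G ζ + n * (2 * Real.pi * I) := by
    have hp1 : ∀ ζ ∈ W, ζ + 2 * Real.pi * I ∈ W := fun ζ hζ => by simpa using hper ζ hζ 1
    have hexp : ∀ ζ ∈ W, exp (G (ζ + 2 * Real.pi * I)) = exp (G ζ) := by
      intro ζ hζ
      rw [hGe _ (hp1 ζ hζ), hGe ζ hζ]
      exact congrArg g (exp_periodic ζ)
    obtain ⟨n, hn⟩ := exp_eq_exp_iff_exists_int.1 (hexp ζ₀ hζ₀)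
    refine ⟨n, exp_eqOn hconv.isPreconnected
      (hG.comp (by fun_prop) fun ζ hζ => hp1 ζ hζ) (hG.add continuousOn_const)
      (fun ζ hζ => ?_) hζ₀ hn⟩
    rw [exp_add, exp_int_mul_two_pi_mul_I, mul_one]
    exact hexp ζ hζ
  obtain ⟨n, hn⟩ := hstep
  have hall : ∀ w : ℤ, ∀ ζ ∈ W,
      G (ζ + w * (2 * Real.pi * I)) = G ζ + (n * w : ℤ) * (2 * Real.pi * I) := by
    intro w
    induction w using Int.induction_on with
    | zero => intro ζ _; simp
    | succ k ih =>
      intro ζ hζ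
      have h1 := hn _ (hper ζ hζ k)
      rw [show ζ + ((k : ℤ) : ℂ) * (2 * Real.pi * I) + 2 * Real.pi * I =
        ζ + ((k + 1 : ℤ) : ℂ) * (2 * Real.pi * I) by push_cast; ring] at h1
      rw [h1, ih ζ hζ]
      push_cast; ring
    | pred k ih =>
      intro ζ hζ
      have h1 := hn _ (hper ζ hζ (-k - 1))
      rw [show ζ + ((-k - 1 : ℤ) : ℂ) * (2 * Real.pi * I) + 2 * Real.pi * I =
        ζ + ((-k : ℤ) : ℂ) * (2 * Real.pi * I) by push_cast; ring, ih ζ hζ] at h1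
      push_cast at h1 ⊢
      linear_combination -h1
  refine ⟨n, fun γ w hγ ⟨Γ, hΓ, he, hw⟩ => ?_⟩
  have hΓW : ∀ θ, Γ θ ∈ W := fun θ => (hmem _).2 ⟨he θ ▸ hγ θ, exp_ne_zero _⟩
  refine ⟨fun θ => G (Γ θ), hG.comp_continuous hΓ hΓW, fun θ => ?_, ?_⟩
  · rw [hGe _ (hΓW θ), Function.comp, Function.comp, he]
  · simp only [hw]
    exact hall w _ (hΓW 0)

end Winding

/-! ### Points with planar neighbourhoods. -/

section PlanarPoints

open Set Filter Topology Complex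

/-- `X` is locally homeomorphic to the plane at `x`. -/
def IsPlanarAt {E : Type*} [PseudoMetricSpace E] (X : Set E) (x : E) : Prop :=
  ∃ (g : E → ℂ) (k : ℂ → E) (ε r : ℝ), 0 < ε ∧ 0 < r ∧ k 0 = x ∧
    ContinuousOn g (X ∩ Metric.ball x ε) ∧ ContinuousOn k (Metric.ball 0 r) ∧
    (∀ w ∈ Metric.ball 0 r, k w ∈ X ∧ g (k w) = w) ∧
    ∀ y ∈ X ∩ Metric.ball x ε, g y ∈ Metric.ball 0 r ∧ k (g y) = y

theorem norm_circle {ρ : ℝ} (hρ : 0 < ρ) (θ : ℝ) : ‖(ρ : ℂ) * exp (θ * I)‖ = ρ := by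
  rw [norm_mul, norm_exp_ofReal_mul_I, mul_one, norm_real, Real.norm_of_nonneg hρ.le]

theorem circle_periodic (ρ : ℝ) :
    (ρ : ℂ) * exp ((2 * Real.pi : ℝ) * I) = ρ * exp ((0 : ℝ) * I) := by
  push_cast
  rw [exp_two_pi_mul_I, zero_mul, exp_zero]

/-- Small punctured neighborhoods of planar points carry functions without logarithm. -/
theorem IsPlanarAt.not_hasLogs {E : Type*} [PseudoMetricSpace E] {X : Set E} {x : E}
    (hx : IsPlanarAt X x) : ∃ ε > 0, ∀ ε', 0 < ε' → ε' ≤ ε →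
      ¬ HasLogs ((X ∩ Metric.ball x ε') \ {x}) := by
  obtain ⟨g, k, ε, r, hε, hr, hk0, hg, hk, hgk, hkg⟩ := hx
  refine ⟨ε, hε, fun ε' hε' hle hlog => ?_⟩
  have hsub : X ∩ Metric.ball x ε' ⊆ X ∩ Metric.ball x ε :=
    inter_subset_inter_right _ (Metric.ball_subset_ball hle)
  obtain ⟨L, hL, hLe⟩ := hlog g (hg.mono (sdiff_subset.trans hsub)) (fun y hy h0 => hy.2 (by
    have := (hkg y (hsub hy.1)).2
    rw [h0, hk0] at this
    exact this.symm))
  have hcont : ContinuousAt k 0 := hk.continuousAt (Metric.ball_mem_nhds 0 hr)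
  obtain ⟨δ, hδ, hδ'⟩ := Metric.continuousAt_iff.1 hcont ε' hε'
  set ρ := min δ r / 2 with hρdef
  have hmin : 0 < min δ r := lt_min hδ hr
  have hρ : 0 < ρ := by positivity
  have hρδ : ρ < δ := by have := min_le_left δ r; linarith
  have hρr : ρ < r := by have := min_le_right δ r; linarith
  let γ : ℝ → ℂ := fun θ => ρ * exp (θ * I)
  have hγ : ∀ θ, ‖γ θ‖ = ρ := norm_circle hρ
  have hγr : ∀ θ, γ θ ∈ Metric.ball (0 : ℂ) r := fun θ => by
    rw [Metric.mem_ball, dist_zero_right, hγ]; exact hρr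
  have hmem : ∀ θ, k (γ θ) ∈ (X ∩ Metric.ball x ε') \ {x} := by
    refine fun θ => ⟨⟨(hgk _ (hγr θ)).1, ?_⟩, fun h => ?_⟩
    · have := hδ' (x := γ θ) (by rw [dist_zero_right, hγ]; exact hρδ)
      rwa [hk0] at this
    · have h1 := (hgk _ (hγr θ)).2
      have h2 := (hgk 0 (Metric.mem_ball_self hr)).2
      rw [mem_singleton_iff.1 h, ← hk0, h2] at h1
      have := hγ θ
      rw [← h1, norm_zero] at this
      exact hρ.ne this
  have hγc : Continuous γ := by fun_prop
  -- A logarithm of the chart `g`, followed along the image of a small circle, returns to its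
  -- initial value; the circle would have winding number `0` instead of `1`.
  refine absurd ((isWinding_zero_of_log (γ := γ) (Γ := fun θ => L (k (γ θ))) ?_ (fun θ => ?_)
    ?_).unique (isWinding_circle hρ)) (by norm_num)
  · exact hL.comp_continuous (hk.comp_continuous hγc hγr) hmem
  · rw [hLe _ (hmem θ), (hgk _ (hγr θ)).2]
  · simp only [γ]
    rw [circle_periodic]

/-- The winding numbers of loops around a planar point have rank one. -/
theorem IsPlanarAt.false_of_windings {E : Type*} [MetricSpace E] {X : Set E} {x : E}
    (hx : IsPlanarAt X x) {G G' : E → ℂ} {ε₀ : ℝ} (hε₀ : 0 < ε₀)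
    (hG : ContinuousOn G (X ∩ Metric.ball x ε₀)) (hG' : ContinuousOn G' (X ∩ Metric.ball x ε₀))
    (hG0 : ∀ y ∈ X ∩ Metric.ball x ε₀, y ≠ x → G y ≠ 0)
    (hG0' : ∀ y ∈ X ∩ Metric.ball x ε₀, y ≠ x → G' y ≠ 0)
    (hloops : ∀ ε > 0, ∃ l l' : ℝ → E, Continuous l ∧ Continuous l' ∧
      (∀ θ, l θ ∈ (X ∩ Metric.ball x ε) \ {x}) ∧ (∀ θ, l' θ ∈ (X ∩ Metric.ball x ε) \ {x}) ∧
      l (2 * Real.pi) = l 0 ∧ l' (2 * Real.pi) = l' 0 ∧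
      IsWinding (G ∘ l) 1 ∧ IsWinding (G' ∘ l) 0 ∧ IsWinding (G' ∘ l') 1) : False := by
  obtain ⟨g, k, ε, r, hε, hr, hk0, hg, hk, hgk, hkg⟩ := hx
  have hg0 : g x = 0 := by
    rw [← hk0]; exact (hgk 0 (Metric.mem_ball_self hr)).2
  have hxX : x ∈ X := hk0 ▸ (hgk 0 (Metric.mem_ball_self hr)).1
  have hcont : ContinuousAt k 0 := hk.continuousAt (Metric.ball_mem_nhds 0 hr)
  obtain ⟨δ, hδ, hδ'⟩ := Metric.continuousAt_iff.1 hcont ε₀ hε₀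
  set ρ := min δ r with hρdef
  have hρ : 0 < ρ := lt_min hδ hr
  have hρr : Metric.ball (0 : ℂ) ρ ⊆ Metric.ball 0 r := Metric.ball_subset_ball (min_le_right _ _)
  have hkmem : ∀ w ∈ Metric.ball (0 : ℂ) ρ, k w ∈ X ∩ Metric.ball x ε₀ := fun w hw =>
    ⟨(hgk w (hρr hw)).1, by
      have := hδ' (x := w) (lt_of_lt_of_le hw (min_le_left _ _))
      rwa [hk0] at this⟩
  have hkne : ∀ w ∈ Metric.ball (0 : ℂ) ρ \ {0}, k w ≠ x := fun w hw h => hw.2 (by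
    have := (hgk w (hρr hw.1)).2
    rw [h, hg0] at this
    exact this.symm)
  have hkc := hk.mono (sdiff_subset.trans hρr : Metric.ball (0 : ℂ) ρ \ {0} ⊆ _)
  have hfac : ∀ H : E → ℂ, ContinuousOn H (X ∩ Metric.ball x ε₀) →
      (∀ y ∈ X ∩ Metric.ball x ε₀, y ≠ x → H y ≠ 0) →
      ∃ n : ℤ, ∀ (γ : ℝ → ℂ) (w : ℤ), (∀ θ, γ θ ∈ Metric.ball (0 : ℂ) ρ) → IsWinding γ w →
        IsWinding ((H ∘ k) ∘ γ) (n * w) := fun H hH hH0 =>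
    exists_winding_factor (hH.comp hkc fun w hw => hkmem w hw.1)
      fun w hw => hH0 _ (hkmem w hw.1) (hkne w hw)
  obtain ⟨n, hn⟩ := hfac G hG hG0
  obtain ⟨n', hn'⟩ := hfac G' hG' hG0'
  have hgc : ContinuousWithinAt g (X ∩ Metric.ball x ε) x := hg x ⟨hxX, Metric.mem_ball_self hε⟩
  obtain ⟨η, hη, hη'⟩ := Metric.continuousWithinAt_iff.1 hgc ρ hρ
  obtain ⟨l, l', hl, hl', hlX, hlX', hp, hp', w1, w2, w3⟩ := hloops (min η ε) (lt_min hη hε)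
  have key : ∀ l : ℝ → E, Continuous l → (∀ θ, l θ ∈ (X ∩ Metric.ball x (min η ε)) \ {x}) →
      l (2 * Real.pi) = l 0 → ∃ w, (∀ θ, (g ∘ l) θ ∈ Metric.ball (0 : ℂ) ρ) ∧ IsWinding (g ∘ l) w ∧
        ∀ H : E → ℂ, (H ∘ k) ∘ (g ∘ l) = H ∘ l := by
    intro l hl hlX hp
    have hmem : ∀ θ, l θ ∈ X ∩ Metric.ball x ε := fun θ =>
      ⟨(hlX θ).1.1, Metric.ball_subset_ball (min_le_right _ _) (hlX θ).1.2⟩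
    obtain ⟨w, hw⟩ := exists_isWinding (γ := g ∘ l) (hg.comp_continuous hl hmem)
      (fun θ h0 => (hlX θ).2 (by
        have := (hkg _ (hmem θ)).2
        rw [Function.comp_apply] at h0
        rw [h0, hk0] at this
        exact this.symm)) (by simp [hp])
    refine ⟨w, fun θ => ?_, hw, fun H => ?_⟩
    · have := hη' (hmem θ) (lt_of_lt_of_le (hlX θ).1.2 (min_le_left _ _))
      rwa [hg0] at this
    · ext θ
      simp only [Function.comp_apply, (hkg _ (hmem θ)).2]
  obtain ⟨w, hb, hw, he⟩ := key l hl hlX hp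
  obtain ⟨w', hb', hw', he'⟩ := key l' hl' hlX' hp'
  -- The three equations are `n * w = 1`, `n' * w = 0` and `n' * w' = 1`, which are incompatible.
  have e1 := (he G ▸ hn _ _ hb hw).unique w1
  have e2 := (he G' ▸ hn' _ _ hb hw).unique w2
  have e3 := (he' G' ▸ hn' _ _ hb' hw').unique w3
  rcases mul_eq_zero.1 e2 with h | h
  · rw [h, zero_mul] at e3; exact zero_ne_one e3
  · rw [h, mul_zero] at e1; exact zero_ne_one e1

theorem isPlanarAt_of_homeomorph {E : Type*} [PseudoMetricSpace E] {X : Set E}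
    (h : X ≃ₜ Metric.sphere (0 : EuclideanSpace ℝ (Fin (2 + 1))) 1) {x : E} (hx : x ∈ X) :
    IsPlanarAt X x := by
  classical
  have : Fact (Module.finrank ℝ (EuclideanSpace ℝ (Fin (2 + 1))) = 2 + 1) := ⟨by simp⟩
  -- Stereographic projection from the antipode of `h x`, so that `x` is in the domain; a
  -- translation then moves `x` to `0`.
  let e₀ : OpenPartialHomeomorph X ℂ := h.toOpenPartialHomeomorph.trans
    ((stereographic' 2 (-h ⟨x, hx⟩)).trans
      Complex.orthonormalBasisOneI.repr.symm.toHomeomorph.toOpenPartialHomeomorph)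
  let e : OpenPartialHomeomorph X ℂ :=
    e₀.trans (Homeomorph.addRight (-e₀ ⟨x, hx⟩)).toOpenPartialHomeomorph
  have hxe : (⟨x, hx⟩ : X) ∈ e.source := by
    have : h ⟨x, hx⟩ ≠ -h ⟨x, hx⟩ := ne_neg_of_mem_unit_sphere ℝ _
    simp [e, e₀, this]
  have he0 : e ⟨x, hx⟩ = 0 := by simp [e]
  have h0t : (0 : ℂ) ∈ e.target := he0 ▸ e.map_source hxe
  obtain ⟨r, hr, hrt⟩ := Metric.isOpen_iff.1 e.open_target 0 h0t
  have hU : IsOpen (e.source ∩ e ⁻¹' Metric.ball 0 r) :=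
    e.isOpen_inter_preimage Metric.isOpen_ball
  obtain ⟨ε, hε, hεU⟩ := Metric.isOpen_iff.1 hU ⟨x, hx⟩
    ⟨hxe, by simp [he0, hr]⟩
  have hball : ∀ y (hy : y ∈ X), y ∈ Metric.ball x ε →
      (⟨y, hy⟩ : X) ∈ e.source ∩ e ⁻¹' Metric.ball 0 r := fun y hy hyb => hεU hyb
  refine ⟨fun y => if hy : y ∈ X then e ⟨y, hy⟩ else 0, fun w => (e.symm w).1, ε, r, hε, hr, ?_, ?_,
    ?_, fun w hw => ⟨(e.symm w).2, ?_⟩, fun y hy => ⟨?_, ?_⟩⟩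
  · simp only [← he0, e.left_inv hxe]
  · rw [continuousOn_iff_continuous_domRestrict]
    have hc : Continuous fun y : (X ∩ Metric.ball x ε : Set E) => e ⟨y.1, y.2.1⟩ :=
      e.continuousOn.comp_continuous (by fun_prop) fun y => (hball y.1 y.2.1 y.2.2).1
    convert! hc using 1
    ext y
    simp [y.2.1]
  · exact continuous_subtype_val.comp_continuousOn (e.symm.continuousOn.mono hrt)
  · simp [e.right_inv (hrt hw)]
  · simp only [dif_pos hy.1]
    exact (hball y hy.1 hy.2).2
  · simp only [dif_pos hy.1]
    rw [e.left_inv (hball y hy.1 hy.2).1]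

end PlanarPoints

/-! ### No isolated vertices, no free edges, no faces above triangles. -/

section LocalStructure

open Set Filter Topology

/-- If a set is star-shaped with respect to points on both sides of `x`, and connected off the line
through them, then the complement of `x` has logarithms. -/
theorem HasLogs.of_starConvex_off_line {E : Type*} [NormedAddCommGroup E] [NormedSpace ℝ E]
    {N : Set E} {x d : E} {f : E →L[ℝ] ℝ} (hd : f d = 1) {δ : ℝ} (hδ : 0 < δ)
    (hp : StarConvex ℝ (x - δ • d) N) (hq : StarConvex ℝ (x + δ • d) N)
    (hc : IsPreconnected {y | y ∈ N ∧ y ≠ x + (f y - f x) • d}) : HasLogs (N \ {x}) := by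
  -- `R` and `R'` are the two closed rays from `x` along the line. Off `R` the set is star-shaped
  -- about the point on the opposite ray, and similarly off `R'`. These two open pieces cover `N \
  -- {x}` and meet in the connected complement of the line.
  let R : Set E := {y | y = x + (f y - f x) • d ∧ f x ≤ f y}
  let R' : Set E := {y | y = x + (f y - f x) • d ∧ f y ≤ f x}
  have hR : IsClosed R := (isClosed_eq continuous_id (by fun_prop)).inter
    (isClosed_le continuous_const f.continuous)
  have hR' : IsClosed R' := (isClosed_eq continuous_id (by fun_prop)).inter
    (isClosed_le f.continuous continuous_const)
  have hxR : x ∈ R := ⟨by simp, le_rfl⟩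
  have hxR' : x ∈ R' := ⟨by simp, le_rfl⟩
  refine HasLogs.union hR.isOpen_compl hR'.isOpen_compl (fun y hy => ?_)
    (HasLogs.of_starConvex (q := x - δ • d) ?_) (HasLogs.of_starConvex (q := x + δ • d) ?_) ?_
  · by_contra h
    simp only [mem_union, mem_compl_iff, not_or, not_not] at h
    refine hy.2 ?_
    have h1 : f y = f x := le_antisymm h.2.2 h.1.2
    have h2 := h.1.1
    rw [h1, sub_self, zero_smul, add_zero] at h2
    exact h2
  · intro y hy a b ha hb hab
    have hz : a • (x - δ • d) + b • y ∉ R := by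
      rintro ⟨h1, h2⟩
      have hf : f (a • (x - δ • d) + b • y) - f x = b * (f y - f x) - a * δ := by
        simp only [map_add, map_smul, map_sub, smul_eq_mul, hd]
        linear_combination (f x) * hab
      rcases hb.eq_or_lt with rfl | hb
      · have : a = 1 := by linarith
        subst this
        have : f (1 • (x - δ • d) + (0 : ℝ) • y) - f x = 0 * (f y - f x) - 1 * δ := by
          simpa using hf
        have h3 : 0 ≤ f ((1 : ℝ) • (x - δ • d) + (0 : ℝ) • y) - f x := sub_nonneg.2 h2
        rw [hf] at h3
        linarith
      · rw [hf] at h1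
        have h3 : b • y = b • (x + (f y - f x) • d) := by
          have : b • y = x + (b * (f y - f x) - a * δ) • d - a • (x - δ • d) :=
            eq_sub_of_add_eq' h1
          rw [this, show a = 1 - b by linarith]
          module
        have h4 := smul_right_injective E hb.ne' h3
        have h5 : 0 ≤ b * (f y - f x) - a * δ := by rw [← hf]; linarith
        refine hy.2 ⟨h4, ?_⟩
        have : 0 ≤ b * (f y - f x) := by
          have := mul_nonneg ha hδ.le
          linarith
        linarith [nonneg_of_mul_nonneg_right this hb]
    exact ⟨⟨hp hy.1.1 ha hb hab, fun h => hz (by rw [mem_singleton_iff.1 h]; exact hxR)⟩, hz⟩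
  · intro y hy a b ha hb hab
    have hz : a • (x + δ • d) + b • y ∉ R' := by
      rintro ⟨h1, h2⟩
      have hf : f (a • (x + δ • d) + b • y) - f x = b * (f y - f x) + a * δ := by
        simp only [map_add, map_smul, smul_eq_mul, hd]
        linear_combination (f x) * hab
      rcases hb.eq_or_lt with rfl | hb
      · have : a = 1 := by linarith
        subst this
        have h3 : f ((1 : ℝ) • (x + δ • d) + (0 : ℝ) • y) - f x ≤ 0 := sub_nonpos.2 h2
        rw [hf] at h3
        linarith
      · rw [hf] at h1
        have h3 : b • y = b • (x + (f y - f x) • d) := by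
          have : b • y = x + (b * (f y - f x) + a * δ) • d - a • (x + δ • d) :=
            eq_sub_of_add_eq' h1
          rw [this, show a = 1 - b by linarith]
          module
        have h4 := smul_right_injective E hb.ne' h3
        have h5 : b * (f y - f x) + a * δ ≤ 0 := by rw [← hf]; linarith
        refine hy.2 ⟨h4, ?_⟩
        have : 0 ≤ b * (f x - f y) := by
          have := mul_nonneg ha hδ.le
          linarith
        linarith [nonneg_of_mul_nonneg_right this hb]
    exact ⟨⟨hq hy.1.1 ha hb hab, fun h => hz (by rw [mem_singleton_iff.1 h]; exact hxR')⟩, hz⟩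
  · convert! hc using 1
    ext y
    simp only [mem_inter_iff, Set.mem_sdiff, mem_singleton_iff, mem_compl_iff, mem_ofPred_eq, R, R']
    constructor
    · rintro ⟨⟨h1, h2⟩, h3, h4⟩
      refine ⟨h1, fun h => ?_⟩
      rcases le_total (f x) (f y) with h' | h'
      · exact h3 ⟨h, h'⟩
      · exact h4 ⟨h, h'⟩
    · rintro ⟨h1, h2⟩
      refine ⟨⟨h1, ?_⟩, fun h => h2 h.1, fun h => h2 h.1⟩
      rintro rfl
      exact h2 (by simp)

variable {V : Type*} [Fintype V] [DecidableEq V] {T : AbstractSimplicialComplex V}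

/-- The barycenter of a face. -/
noncomputable def barycenter (s : Finset V) : V → ℝ := fun v => if v ∈ s then (s.card : ℝ)⁻¹ else 0

theorem barycenter_of_mem {s : Finset V} {v : V} (h : v ∈ s) :
    barycenter s v = (s.card : ℝ)⁻¹ := if_pos h

theorem barycenter_of_notMem {s : Finset V} {v : V} (h : v ∉ s) : barycenter s v = 0 := if_neg h

theorem sum_barycenter {s : Finset V} (hs : s.Nonempty) : ∑ v, barycenter s v = 1 := by
  have : (s.card : ℝ) ≠ 0 := Nat.cast_ne_zero.2 hs.card_ne_zero
  simp [barycenter, Finset.sum_ite_mem, this]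

theorem mem_geometricRealization_of_face {s : Finset V} (hs : s ∈ T.faces) {x : V → ℝ}
    (h0 : ∀ v, 0 ≤ x v) (h1 : ∑ v, x v = 1) (hx : ∀ v, v ∉ s → x v = 0) :
    x ∈ geometricRealization T := ⟨⟨h0, h1⟩, s, hs, hx⟩

theorem barycenter_mem {s : Finset V} (hs : s ∈ T.faces) :
    barycenter s ∈ geometricRealization T := by
  refine mem_geometricRealization_of_face hs (fun v => ?_)
    (sum_barycenter (T.isRelLowerSet_faces hs).1) fun v hv => barycenter_of_notMem hv
  unfold barycenter
  split_ifs <;> positivity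

/-- Near the barycenter of `s`, all points lie in faces containing `s`. -/
theorem exists_face_of_mem_ball {s : Finset V} {ε : ℝ} (hε : ε ≤ (s.card : ℝ)⁻¹) {y : V → ℝ}
    (hy : y ∈ geometricRealization T ∩ Metric.ball (barycenter s) ε) :
    (∀ v ∈ s, 0 < y v) ∧ ∃ t ∈ T.faces, s ⊆ t ∧ ∀ v, v ∉ t → y v = 0 := by
  have hpos : ∀ v ∈ s, 0 < y v := fun v hv => by
    have h1 := (dist_le_pi_dist y (barycenter s) v).trans_lt hy.2
    rw [barycenter_of_mem hv, Real.dist_eq] at h1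
    linarith [(abs_lt.1 h1).1]
  obtain ⟨-, t, ht, hyt⟩ := hy.1
  refine ⟨hpos, t, ht, fun v hv => ?_, hyt⟩
  by_contra h
  exact (hpos v hv).ne' (hyt v h)

/-- A point near the barycenter lies in a face containing `s`, and that face contains the segment to
`p`. -/
theorem starConvex_of_support {s : Finset V} {ε : ℝ} (hε : ε ≤ (s.card : ℝ)⁻¹) {p : V → ℝ}
    (h0 : ∀ v, 0 ≤ p v) (h1 : ∑ v, p v = 1) (hp : ∀ v, v ∉ s → p v = 0)
    (hpb : p ∈ Metric.ball (barycenter s) ε) :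
    StarConvex ℝ p (geometricRealization T ∩ Metric.ball (barycenter s) ε) := by
  intro y hy a b ha hb hab
  obtain ⟨-, t, ht, hst, hyt⟩ := exists_face_of_mem_ball hε hy
  refine ⟨⟨convex_stdSimplex ℝ V ⟨h0, h1⟩ hy.1.1 ha hb hab, t, ht, fun v hv => ?_⟩,
    convex_ball _ _ hpb hy.2 ha hb hab⟩
  simp [hp v fun h => hv (hst h), hyt v hv]

/-- Moving the barycenter of `s` by `t` towards `v` and away from `u`. -/
theorem shift_barycenter {s : Finset V} {u v : V} (hu : u ∈ s) (huv : u ≠ v) {t : ℝ} (ht : 0 ≤ t)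
    (hts : t ≤ (s.card : ℝ)⁻¹) :
    let p := barycenter s + t • (Pi.single v 1 - Pi.single u 1 : V → ℝ)
    (∀ w, 0 ≤ p w) ∧ ∑ w, p w = 1 ∧ (∀ w, w ∉ s → w ≠ v → p w = 0) ∧ dist p (barycenter s) ≤ t := by
  intro p
  have hpu : p u = (s.card : ℝ)⁻¹ - t := by
    simp [p, barycenter_of_mem hu, huv]; ring
  have hpv : p v = barycenter s v + t := by simp [p, huv.symm]
  have hpw : ∀ w, w ≠ u → w ≠ v → p w = barycenter s w := fun w h1 h2 => by simp [p, h1, h2]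
  have hb : ∀ w, 0 ≤ barycenter s w := fun w => by
    unfold barycenter; split_ifs <;> positivity
  refine ⟨fun w => ?_, ?_, fun w h1 h2 => ?_, ?_⟩
  · by_cases h1 : w = u
    · subst h1; rw [hpu]; linarith
    by_cases h2 : w = v
    · subst h2; rw [hpv]; linarith [hb w]
    · rw [hpw w h1 h2]; exact hb w
  · simp only [p, Pi.add_apply, Pi.smul_apply, Pi.sub_apply, smul_eq_mul, Finset.sum_add_distrib,
      ← Finset.mul_sum, Finset.sum_sub_distrib, sum_barycenter ⟨u, hu⟩]
    simp
  · rw [hpw w (by rintro rfl; exact h1 hu) h2, barycenter_of_notMem h1]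
  · refine (dist_pi_le_iff ht).2 fun w => ?_
    by_cases h1 : w = u
    · subst h1; rw [hpu, barycenter_of_mem hu, Real.dist_eq, sub_sub_cancel_left, abs_neg,
        abs_of_nonneg ht]
    by_cases h2 : w = v
    · subst h2; rw [hpv, Real.dist_eq, add_sub_cancel_left, abs_of_nonneg ht]
    · rw [hpw w h1 h2, dist_self]; exact ht

/-- The line used is parallel to the edge `{u, v}` of `s`; moving a little along it in either
direction stays in `s`, so both centres are admissible. -/
theorem hasLogs_punctured {s : Finset V} {u v : V} (hu : u ∈ s) (hv : v ∈ s) (huv : u ≠ v)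
    {ε : ℝ} (hε0 : 0 < ε) (hε : ε ≤ (s.card : ℝ)⁻¹)
    (hc : IsPreconnected {y | y ∈ geometricRealization T ∩ Metric.ball (barycenter s) ε ∧
      y ≠ barycenter s + (y u - barycenter s u) • (Pi.single u 1 - Pi.single v 1 : V → ℝ)}) :
    HasLogs ((geometricRealization T ∩ Metric.ball (barycenter s) ε) \ {barycenter s}) := by
  refine HasLogs.of_starConvex_off_line (d := Pi.single u 1 - Pi.single v 1)
    (f := ContinuousLinearMap.proj u) (δ := ε / 2) (by simp [huv]) (by linarith) ?_ ?_ hc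
  · obtain ⟨h1, h2, h3, h4⟩ := shift_barycenter hu huv (t := ε / 2) (by linarith) (by linarith)
    have : barycenter s - (ε / 2) • (Pi.single u 1 - Pi.single v 1 : V → ℝ) =
        barycenter s + (ε / 2) • (Pi.single v 1 - Pi.single u 1 : V → ℝ) := by module
    rw [this]
    exact starConvex_of_support hε h1 h2 (fun w hw => h3 w hw (by rintro rfl; exact hw hv))
      (lt_of_le_of_lt h4 (by linarith))
  · obtain ⟨h1, h2, h3, h4⟩ := shift_barycenter hv huv.symm (t := ε / 2) (by linarith) (by linarith)
    exact starConvex_of_support hε h1 h2 (fun w hw => h3 w hw (by rintro rfl; exact hw hu))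
      (lt_of_le_of_lt h4 (by linarith))

/-- Faces of triangles are not contained in larger faces. -/
theorem triangle_maximal (hX : ∀ x ∈ geometricRealization T, IsPlanarAt (geometricRealization T) x)
    {s t : Finset V} (hs : s.card = 3) (ht : t ∈ T.faces) (hst : s ⊆ t) : s = t := by
  classical
  by_contra hne
  have hs0 : s.Nonempty := by rw [← Finset.card_pos]; omega
  have hsf : s ∈ T.faces := mem_faces_of_subset ht hst hs0
  obtain ⟨c, hct, hcs⟩ : ∃ c ∈ t, c ∉ s := by
    by_contra! h
    exact hne (Finset.Subset.antisymm hst h)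
  obtain ⟨u, v, w, huv, huw, hvw, rfl⟩ := Finset.card_eq_three.1 hs
  obtain ⟨ε₀, hε₀, hlog⟩ := (hX _ (barycenter_mem hsf)).not_hasLogs
  have hcard : ((({u, v, w} : Finset V).card : ℝ))⁻¹ = 1 / 3 := by rw [hs]; norm_num
  set β := barycenter ({u, v, w} : Finset V) with hβ
  set ε := min ε₀ (1 / 3) with hεd
  have hε : 0 < ε := lt_min hε₀ (by norm_num)
  have hε3 : ε ≤ ((({u, v, w} : Finset V).card : ℝ))⁻¹ := by rw [hcard]; exact min_le_right _ _
  have hβu : β u = 1 / 3 := by rw [hβ, barycenter_of_mem (by simp), hcard]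
  have hβv : β v = 1 / 3 := by rw [hβ, barycenter_of_mem (by simp), hcard]
  have hβw : β w = 1 / 3 := by rw [hβ, barycenter_of_mem (by simp), hcard]
  have hβc : β c = 0 := by rw [hβ, barycenter_of_notMem hcs]
  simp only [Finset.mem_insert, Finset.mem_singleton, not_or] at hcs
  refine hlog ε hε (min_le_left _ _) (hasLogs_punctured (u := u) (v := v) (by simp) (by simp) huv hε
    hε3 ?_)
  set N := geometricRealization T ∩ Metric.ball β ε with hN
  have hoff : ∀ y, y ∈ N → (y w ≠ 1 / 3 ∨ 0 < y c) →
      y ≠ β + (y u - β u) • (Pi.single u 1 - Pi.single v 1 : V → ℝ) := by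
    rintro y - h hy
    have h1 := congrFun hy w
    have h2 := congrFun hy c
    simp [huw.symm, hvw.symm, hβw] at h1
    simp [hcs, hβc] at h2
    rcases h with h | h
    · exact h (by rw [h1]; norm_num)
    · exact h.ne' h2
  -- points of the line are determined by two coordinates
  have hon : ∀ y, y ∈ N → y ≠ β + (y u - β u) • (Pi.single u 1 - Pi.single v 1 : V → ℝ) →
      y w = 1 / 3 → ∃ b, b ≠ u ∧ b ≠ v ∧ b ≠ w ∧ 0 < y b := by
    intro y hy hne hyw
    by_contra! hb
    have hb' : ∀ b, b ≠ u → b ≠ v → b ≠ w → y b = 0 := fun b h1 h2 h3 =>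
      le_antisymm (hb b h1 h2 h3) (hy.1.1.1 b)
    have hsum : y u + (y v + y w) = 1 := by
      rw [← hy.1.1.2, ← Finset.sum_subset (Finset.subset_univ {u, v, w}),
        Finset.sum_insert (by simp [huv, huw]), Finset.sum_pair hvw]
      intro b _ hb
      simp only [Finset.mem_insert, Finset.mem_singleton, not_or] at hb
      exact hb' b hb.1 hb.2.1 hb.2.2
    refine hne (funext fun b => ?_)
    by_cases h1 : b = u
    · subst h1; simp [huv]
    by_cases h2 : b = v
    · subst h2; simp [huv.symm, hβu, hβv]; linarith
    by_cases h3 : b = w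
    · subst h3; simp [huw.symm, hvw.symm, hyw, hβw]
    · rw [hb' b h1 h2 h3]
      simp [h1, h2, hβ, barycenter, h3]
  -- In the triangle, `p` and `m` lie on the two sides of the line, and `q` is displaced towards the
  -- extra vertex `c`. Everything off the line is joined to `q` through `p` or `m`, which is
  -- possible since there is room outside the triangle.
  obtain ⟨p1, p2, p3, p4⟩ := shift_barycenter (s := {u, v, w}) (u := u) (v := w) (by simp) huw
    (t := ε / 2) (by linarith) (by linarith)
  obtain ⟨m1, m2, m3, m4⟩ := shift_barycenter (s := {u, v, w}) (u := w) (v := u) (by simp) huw.symm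
    (t := ε / 2) (by linarith) (by linarith)
  obtain ⟨q1, q2, q3, q4⟩ := shift_barycenter (s := {u, v, w}) (u := u) (v := c) (by simp)
    (Ne.symm hcs.1) (t := ε / 2) (by linarith) (by linarith)
  set p := β + (ε / 2) • (Pi.single w 1 - Pi.single u 1 : V → ℝ) with hp
  set m := β + (ε / 2) • (Pi.single u 1 - Pi.single w 1 : V → ℝ) with hm
  set q := β + (ε / 2) • (Pi.single c 1 - Pi.single u 1 : V → ℝ) with hq
  have hpN := starConvex_of_support (T := T) hε3 p1 p2
    (fun b hb => p3 b hb (by rintro rfl; simp at hb)) (lt_of_le_of_lt p4 (by linarith))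
  have hmN := starConvex_of_support (T := T) hε3 m1 m2
    (fun b hb => m3 b hb (by rintro rfl; simp at hb)) (lt_of_le_of_lt m4 (by linarith))
  have hqN : q ∈ N := ⟨mem_geometricRealization_of_face ht q1 q2 fun b hb =>
    q3 b (fun h => hb (hst h)) (by rintro rfl; exact hb hct), lt_of_le_of_lt q4 (by linarith)⟩
  have hpw : p w = 1 / 3 + ε / 2 := by simp [hp, hβw, huw.symm]
  have hmw : m w = 1 / 3 - ε / 2 := by simp [hm, hβw, huw.symm]; ring
  have hpc : p c = 0 := by simp [hp, hβc, hcs]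
  have hmc : m c = 0 := by simp [hm, hβc, hcs]
  have hqc : q c = ε / 2 := by simp [hq, hβc, hcs]
  set S := {y | y ∈ N ∧ y ≠ β + (y u - β u) • (Pi.single u 1 - Pi.single v 1 : V → ℝ)} with hS
  have key : ∀ r : V → ℝ, StarConvex ℝ r N → r w ≠ 1 / 3 → r c = 0 → ∀ y ∈ S,
      (∀ a b : ℝ, 0 < a → 0 ≤ b → a + b = 1 → a * r w + b * y w ≠ 1 / 3) →
      ∃ t ⊆ S, q ∈ t ∧ y ∈ t ∧ IsPreconnected t := by
    intro r hr hrw hrc y hy hav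
    refine ⟨segment ℝ r q ∪ segment ℝ r y, union_subset ?_ ?_, Or.inl (right_mem_segment _ _ _),
      Or.inr (right_mem_segment _ _ _), ?_⟩
    · rintro z ⟨a, b, ha, hb, hab, rfl⟩
      have hz := hr hqN ha hb hab
      refine ⟨hz, hoff _ hz ?_⟩
      rcases hb.eq_or_lt with rfl | hb
      · left
        have : a = 1 := by linarith
        simpa [this] using hrw
      · right
        simp only [Pi.add_apply, Pi.smul_apply, smul_eq_mul, hrc, hqc]
        positivity
    · rintro z ⟨a, b, ha, hb, hab, rfl⟩
      rcases ha.eq_or_lt with rfl | ha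
      · have : b = 1 := by linarith
        simpa [this] using hy
      · have hz := hr hy.1 ha.le hb hab
        exact ⟨hz, hoff _ hz (Or.inl (by simpa using hav a b ha hb hab))⟩
    · exact (convex_segment r q).isPreconnected.union r (left_mem_segment _ _ _)
        (left_mem_segment _ _ _) (convex_segment r y).isPreconnected
  refine isPreconnected_of_forall q fun y hy => ?_
  rcases le_or_gt (1 / 3) (y w) with h | h
  · refine key p hpN (by rw [hpw]; linarith) hpc y hy fun a b ha hb hab => ?_
    rw [hpw]
    have h1 : b * (1 / 3) ≤ b * y w := mul_le_mul_of_nonneg_left h hb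
    have h2 : 0 < a * (ε / 2) := by positivity
    have h3 : a * (1 / 3) + b * (1 / 3) = 1 / 3 := by rw [← add_mul, hab, one_mul]
    have h4 : a * (1 / 3 + ε / 2) = a * (1 / 3) + a * (ε / 2) := mul_add _ _ _
    linarith
  · refine key m hmN (by rw [hmw]; linarith) hmc y hy fun a b ha hb hab => ?_
    rw [hmw]
    have h1 : b * y w ≤ b * (1 / 3) := mul_le_mul_of_nonneg_left h.le hb
    have h2 : 0 < a * (ε / 2) := by positivity
    have h3 : a * (1 / 3) + b * (1 / 3) = 1 / 3 := by rw [← add_mul, hab, one_mul]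
    have h4 : a * (1 / 3 - ε / 2) = a * (1 / 3) - a * (ε / 2) := mul_sub _ _ _
    linarith

/-- The faces containing an edge are not all contained in a single triangle. -/
theorem edge_not_free (hX : ∀ x ∈ geometricRealization T, IsPlanarAt (geometricRealization T) x)
    {u v : V} (huv : u ≠ v) (hf : {u, v} ∈ T.faces) (c : V)
    (hc : ∀ t ∈ T.faces, {u, v} ⊆ t → t ⊆ {u, v, c}) : False := by
  classical
  obtain ⟨ε₀, hε₀, hlog⟩ := (hX _ (barycenter_mem hf)).not_hasLogs
  have hcard : ((({u, v} : Finset V).card : ℝ))⁻¹ = 1 / 2 := by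
    rw [Finset.card_pair huv]; norm_num
  set β := barycenter ({u, v} : Finset V) with hβ
  set ε := min ε₀ (1 / 2) with hεd
  have hε : 0 < ε := lt_min hε₀ (by norm_num)
  have hε3 : ε ≤ ((({u, v} : Finset V).card : ℝ))⁻¹ := by rw [hcard]; exact min_le_right _ _
  have hβu : β u = 1 / 2 := by rw [hβ, barycenter_of_mem (by simp), hcard]
  have hβv : β v = 1 / 2 := by rw [hβ, barycenter_of_mem (by simp), hcard]
  refine hlog ε hε (min_le_left _ _) (hasLogs_punctured (u := u) (v := v) (by simp) (by simp) huv hε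
    hε3 (Convex.isPreconnected ?_))
  set N := geometricRealization T ∩ Metric.ball β ε with hN
  have hsupp : ∀ y ∈ N, ∀ b, b ∉ ({u, v, c} : Finset V) → y b = 0 := by
    intro y hy b hb
    obtain ⟨-, t, ht, hst, hyt⟩ := exists_face_of_mem_ball hε3 hy
    exact hyt b fun h => hb (hc t ht hst h)
  -- Leaving the line means having a positive coordinate at `c`, a convex condition; it is void when
  -- `c` is `u` or `v`.
  have hoff : ∀ y ∈ N, y ≠ β + (y u - β u) • (Pi.single u 1 - Pi.single v 1 : V → ℝ) ↔
      (c ≠ u ∧ c ≠ v ∧ 0 < y c) := by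
    intro y hy
    constructor
    · intro hne
      by_contra! h
      have hb' : ∀ b, b ≠ u → b ≠ v → y b = 0 := fun b h1 h2 => by
        by_cases hbc : b = c
        · subst hbc; exact le_antisymm (h h1 h2) (hy.1.1.1 b)
        · exact hsupp y hy b (by simp [h1, h2, hbc])
      have hsum : y u + y v = 1 := by
        rw [← hy.1.1.2, ← Finset.sum_subset (Finset.subset_univ {u, v}), Finset.sum_pair huv]
        intro b _ hb
        simp only [Finset.mem_insert, Finset.mem_singleton, not_or] at hb
        exact hb' b hb.1 hb.2
      refine hne (funext fun b => ?_)
      by_cases h1 : b = u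
      · subst h1; simp [huv]
      by_cases h2 : b = v
      · subst h2; simp [huv.symm, hβu, hβv]; linarith
      · rw [hb' b h1 h2]
        simp [h1, h2, hβ, barycenter]
    · rintro ⟨h1, h2, h3⟩ h
      have := congrFun h c
      simp [h1, h2, hβ, barycenter] at this
      exact h3.ne' this
  intro y hy z hz a b ha hb hab
  have hyc := (hoff y hy.1).1 hy.2
  have hzc := (hoff z hz.1).1 hz.2
  have hmem : a • y + b • z ∈ N := by
    obtain ⟨-, t, ht, hst, hyt⟩ := exists_face_of_mem_ball hε3 hy.1
    have hct : c ∈ t := by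
      by_contra h
      exact hyc.2.2.ne' (hyt c h)
    refine ⟨⟨convex_stdSimplex ℝ V hy.1.1.1 hz.1.1.1 ha hb hab, t, ht, fun w hw => ?_⟩,
      convex_ball _ _ hy.1.2 hz.1.2 ha hb hab⟩
    have hzw : z w = 0 := hsupp z hz.1 w fun h => hw (by
      simp only [Finset.mem_insert, Finset.mem_singleton] at h
      rcases h with rfl | rfl | rfl
      · exact hst (by simp)
      · exact hst (by simp)
      · exact hct)
    simp [hyt w hw, hzw]
  refine ⟨hmem, (hoff _ hmem).2 ⟨hyc.1, hyc.2.1, ?_⟩⟩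
  rw [Pi.add_apply, Pi.smul_apply, Pi.smul_apply, smul_eq_mul, smul_eq_mul]
  rcases ha.eq_or_lt with rfl | ha
  · have : b = 1 := by linarith
    simpa [this] using hzc.2.2
  · have := mul_pos ha hyc.2.2
    have := mul_nonneg hb hzc.2.2.le
    linarith

/-- An isolated vertex would have an empty punctured neighbourhood, on which logarithms exist
vacuously. -/
theorem exists_edge_at (hX : ∀ x ∈ geometricRealization T, IsPlanarAt (geometricRealization T) x)
    (v : V) : ∃ w, v ≠ w ∧ {v, w} ∈ T.faces := by
  classical
  by_contra! hno
  have hv : {v} ∈ T.faces := T.singleton_mem v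
  obtain ⟨ε₀, hε₀, hlog⟩ := (hX _ (barycenter_mem hv)).not_hasLogs
  have hcard : ((({v} : Finset V).card : ℝ))⁻¹ = 1 := by simp
  refine hlog (min ε₀ 1) (lt_min hε₀ one_pos) (min_le_left _ _) (HasLogs.of_isEmpty ?_)
  refine eq_empty_of_forall_notMem fun y hy => hy.2 ?_
  obtain ⟨-, t, ht, hst, hyt⟩ := exists_face_of_mem_ball
    (by rw [hcard]; exact min_le_right _ _) hy.1
  have ht' : ∀ b, b ≠ v → y b = 0 := fun b hb => hyt b fun hbt => hno b hb.symm
    (mem_faces_of_subset ht (by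
      simp only [Finset.insert_subset_iff, Finset.singleton_subset_iff]
      exact ⟨hst (by simp), hbt⟩) (by simp))
  have hyv : y v = 1 := by
    rw [← hy.1.1.1.2, Finset.sum_eq_single v (fun b _ hb => ht' b hb) (by simp)]
  rw [mem_singleton_iff]
  ext b
  by_cases hb : b = v
  · subst hb; rw [hyv, barycenter_of_mem (by simp), hcard]
  · rw [ht' b hb, barycenter_of_notMem (by simpa using hb)]

end LocalStructure

/-! ### No edge lies in three triangles. -/

section Branching

open Set Filter Topology

variable {V : Type*} [Fintype V] [DecidableEq V] {T : AbstractSimplicialComplex V}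

/-- A loop around the barycenter of the edge `{u, v}`, in the triangles with third vertices `c`
and `c'`. -/
noncomputable def edgeLoop (u v c c' : V) (η θ : ℝ) : V → ℝ :=
  (1 / 2 + η / 2 * Real.cos θ - η / 2 * |Real.sin θ|) • (Pi.single u 1 : V → ℝ) +
    (1 / 2 - η / 2 * Real.cos θ - η / 2 * |Real.sin θ|) • (Pi.single v 1 : V → ℝ) +
    (η * max (-Real.sin θ) 0) • (Pi.single c 1 : V → ℝ) +
    (η * max (Real.sin θ) 0) • (Pi.single c' 1 : V → ℝ)

theorem continuous_edgeLoop (u v c c' : V) (η : ℝ) : Continuous (edgeLoop u v c c' η) := by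
  unfold edgeLoop
  fun_prop

theorem edgeLoop_two_pi (u v c c' : V) (η : ℝ) :
    edgeLoop u v c c' η (2 * Real.pi) = edgeLoop u v c c' η 0 := by
  simp [edgeLoop]

theorem max_add_max_neg (s : ℝ) : max (-s) 0 + max s 0 = |s| := by
  rcases le_total 0 s with h | h
  · rw [max_eq_right (by linarith), max_eq_left h, abs_of_nonneg h]; ring
  · rw [max_eq_left (by linarith), max_eq_right h, abs_of_nonpos h]; ring

section

variable {u v c c' : V} (huv : u ≠ v) (hcu : c ≠ u) (hcv : c ≠ v) (hcu' : c' ≠ u) (hcv' : c' ≠ v)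
  (hcc : c ≠ c') (η θ : ℝ)

include huv hcu hcu' in
theorem edgeLoop_fst : edgeLoop u v c c' η θ u =
    1 / 2 + η / 2 * Real.cos θ - η / 2 * |Real.sin θ| := by
  simp [edgeLoop, huv, hcu.symm, hcu'.symm]

include huv hcv hcv' in
theorem edgeLoop_snd : edgeLoop u v c c' η θ v =
    1 / 2 - η / 2 * Real.cos θ - η / 2 * |Real.sin θ| := by
  simp [edgeLoop, huv.symm, hcv.symm, hcv'.symm]

include hcu hcv hcc in
theorem edgeLoop_neg : edgeLoop u v c c' η θ c = η * max (-Real.sin θ) 0 := by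
  simp [edgeLoop, hcu, hcv, hcc]

include hcu' hcv' hcc in
theorem edgeLoop_pos : edgeLoop u v c c' η θ c' = η * max (Real.sin θ) 0 := by
  simp [edgeLoop, hcu', hcv', hcc.symm]

theorem edgeLoop_of_ne {b : V} (h₁ : b ≠ u) (h₂ : b ≠ v) (h₃ : b ≠ c) (h₄ : b ≠ c') :
    edgeLoop u v c c' η θ b = 0 := by
  simp [edgeLoop, h₁, h₂, h₃, h₄]

theorem sum_edgeLoop : ∑ b, edgeLoop u v c c' η θ b = 1 := by
  simp only [edgeLoop, Pi.add_apply, Pi.smul_apply, smul_eq_mul, Finset.sum_add_distrib,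
    ← Finset.mul_sum, Finset.sum_pi_single', Finset.mem_univ, if_true]
  have := max_add_max_neg (Real.sin θ)
  linear_combination η * this

include huv hcu hcv hcu' hcv' hcc in
theorem edgeLoop_mem (hf : {u, v, c} ∈ T.faces) (hf' : {u, v, c'} ∈ T.faces) {ε : ℝ}
    (hη : 0 < η) (hη' : η ≤ 1 / 2) (hηε : η < ε) :
    edgeLoop u v c c' η θ ∈
      (geometricRealization T ∩ Metric.ball (barycenter {u, v}) ε) \ {barycenter {u, v}} := by
  have hcard : ((({u, v} : Finset V).card : ℝ))⁻¹ = 1 / 2 := by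
    rw [Finset.card_pair huv]; norm_num
  have h1 := edgeLoop_fst (v := v) huv hcu hcu' η θ
  have h2 := edgeLoop_snd (u := u) huv hcv hcv' η θ
  have h3 := edgeLoop_neg (u := u) (v := v) hcu hcv hcc η θ
  have h4 := edgeLoop_pos (u := u) (v := v) hcu' hcv' hcc η θ
  have hβu : barycenter {u, v} u = 1 / 2 := by rw [barycenter_of_mem (by simp), hcard]
  have hβv : barycenter {u, v} v = 1 / 2 := by rw [barycenter_of_mem (by simp), hcard]
  have hβ : ∀ b, b ≠ u → b ≠ v → barycenter {u, v} b = 0 := fun b hb hb' =>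
    barycenter_of_notMem (by simp [hb, hb'])
  have hcos := abs_le.1 (Real.abs_cos_le_one θ)
  have hsin := abs_le.1 (Real.abs_sin_le_one θ)
  have hsin' := Real.abs_sin_le_one θ
  have hsin0 := abs_nonneg (Real.sin θ)
  have m1 : 0 ≤ max (-Real.sin θ) 0 := le_max_right _ _
  have m2 : 0 ≤ max (Real.sin θ) 0 := le_max_right _ _
  have m3 : max (-Real.sin θ) 0 ≤ 1 := max_le (by linarith) zero_le_one
  have m4 : max (Real.sin θ) 0 ≤ 1 := max_le (by linarith) zero_le_one
  have a1 : η / 2 * Real.cos θ ≤ η / 2 := by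
    simpa using mul_le_mul_of_nonneg_left hcos.2 (by linarith : 0 ≤ η / 2)
  have a2 : -(η / 2) ≤ η / 2 * Real.cos θ := by
    simpa using mul_le_mul_of_nonneg_left hcos.1 (by linarith : 0 ≤ η / 2)
  have a3 : η / 2 * |Real.sin θ| ≤ η / 2 := by
    simpa using mul_le_mul_of_nonneg_left hsin' (by linarith : 0 ≤ η / 2)
  have a4 : 0 ≤ η / 2 * |Real.sin θ| := by positivity
  have a5 : η * max (-Real.sin θ) 0 ≤ η := by simpa using mul_le_mul_of_nonneg_left m3 hη.le
  have a6 : η * max (Real.sin θ) 0 ≤ η := by simpa using mul_le_mul_of_nonneg_left m4 hη.le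
  have a7 : 0 ≤ η * max (-Real.sin θ) 0 := by positivity
  have a8 : 0 ≤ η * max (Real.sin θ) 0 := by positivity
  have hcases : ∀ b, (b = u ∨ b = v ∨ b = c ∨ b = c') ∨ (b ≠ u ∧ b ≠ v ∧ b ≠ c ∧ b ≠ c') := by
    intro b; tauto
  have h0 : ∀ b, 0 ≤ edgeLoop u v c c' η θ b := by
    intro b
    rcases hcases b with (rfl | rfl | rfl | rfl) | ⟨hb1, hb2, hb3, hb4⟩
    · rw [h1]; linarith
    · rw [h2]; linarith
    · rw [h3]; exact a7
    · rw [h4]; exact a8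
    · rw [edgeLoop_of_ne η θ hb1 hb2 hb3 hb4]
  refine ⟨⟨?_, ?_⟩, fun h => ?_⟩
  · rcases le_total 0 (Real.sin θ) with h | h
    · refine mem_geometricRealization_of_face hf' h0 (sum_edgeLoop η θ) fun b hb => ?_
      simp only [Finset.mem_insert, Finset.mem_singleton, not_or] at hb
      rcases hcases b with (rfl | rfl | rfl | rfl) | ⟨hb1, hb2, hb3, hb4⟩
      · exact absurd rfl hb.1
      · exact absurd rfl hb.2.1
      · rw [h3, max_eq_right (by linarith), mul_zero]
      · exact absurd rfl hb.2.2
      · exact edgeLoop_of_ne η θ hb1 hb2 hb3 hb4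
    · refine mem_geometricRealization_of_face hf h0 (sum_edgeLoop η θ) fun b hb => ?_
      simp only [Finset.mem_insert, Finset.mem_singleton, not_or] at hb
      rcases hcases b with (rfl | rfl | rfl | rfl) | ⟨hb1, hb2, hb3, hb4⟩
      · exact absurd rfl hb.1
      · exact absurd rfl hb.2.1
      · exact absurd rfl hb.2.2
      · rw [h4, max_eq_right h, mul_zero]
      · exact edgeLoop_of_ne η θ hb1 hb2 hb3 hb4
  · rw [Metric.mem_ball]
    refine lt_of_le_of_lt ((dist_pi_le_iff hη.le).2 fun b => ?_) hηε
    rw [Real.dist_eq, abs_le]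
    rcases hcases b with (rfl | rfl | rfl | rfl) | ⟨hb1, hb2, hb3, hb4⟩
    · rw [h1, hβu]; constructor <;> linarith
    · rw [h2, hβv]; constructor <;> linarith
    · rw [h3, hβ _ hcu hcv]; constructor <;> linarith
    · rw [h4, hβ _ hcu' hcv']; constructor <;> linarith
    · rw [edgeLoop_of_ne η θ hb1 hb2 hb3 hb4, hβ _ hb1 hb2]; constructor <;> linarith
  · rw [mem_singleton_iff] at h
    rw [h, hβu] at h1
    rw [h, hβv] at h2
    have hc : η * Real.cos θ = 0 := by linarith
    have hs : η * |Real.sin θ| = 0 := by linarith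
    have hc' : Real.cos θ = 0 := (mul_eq_zero.1 hc).resolve_left hη.ne'
    have hs' : Real.sin θ = 0 := abs_eq_zero.1 ((mul_eq_zero.1 hs).resolve_left hη.ne')
    have := Real.sin_sq_add_cos_sq θ
    rw [hc', hs'] at this
    norm_num at this

end

/-- Near the barycenter of `{u, v}`, a planar coordinate that is injective on the union of the
triangle with third vertex `c` and any other triangle. -/
noncomputable def foldCoord (u v c : V) (y : V → ℝ) : ℂ :=
  ⟨y u - y v, 1 - y u - y v - 2 * y c⟩

theorem continuous_foldCoord (u v c : V) : Continuous (foldCoord u v c) :=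
  Complex.equivRealProdCLM.symm.continuous.comp
    (f := fun y : V → ℝ => (y u - y v, 1 - y u - y v - 2 * y c)) (by fun_prop)

/-- The imaginary part is `-y c` on the triangle `{u, v, c}` and the total mass off `u` and `v` on
every other face at the edge. If it vanishes, all mass is at `u` and `v`, and the real part makes it
equal. -/
theorem foldCoord_ne_zero (hcard : ∀ t ∈ T.faces, t.card ≤ 3) {u v c : V} (huv : u ≠ v)
    (hcu : c ≠ u) (hcv : c ≠ v) {ε : ℝ} (hε : ε ≤ 1 / 2) {y : V → ℝ}
    (hy : y ∈ geometricRealization T ∩ Metric.ball (barycenter {u, v}) ε)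
    (hne : y ≠ barycenter {u, v}) : foldCoord u v c y ≠ 0 := by
  intro h
  have hcard2 : ((({u, v} : Finset V).card : ℝ))⁻¹ = 1 / 2 := by
    rw [Finset.card_pair huv]; norm_num
  have h1 : y u - y v = 0 := congrArg Complex.re h
  have h2 : 1 - y u - y v - 2 * y c = 0 := congrArg Complex.im h
  obtain ⟨-, t, ht, hst, hyt⟩ := exists_face_of_mem_ball (hcard2 ▸ hε) hy
  have hsum := hy.1.1.2
  have hyc : y c = 0 := by
    by_cases hct : c ∈ t
    · have h3 : ({u, v, c} : Finset V).card = 3 := Finset.card_eq_three.2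
        ⟨u, v, c, huv, hcu.symm, hcv.symm, rfl⟩
      have hsub : ({u, v, c} : Finset V) ⊆ t := by
        intro b hb
        simp only [Finset.mem_insert, Finset.mem_singleton] at hb
        rcases hb with rfl | rfl | rfl
        · exact hst (by simp)
        · exact hst (by simp)
        · exact hct
      have ht3 : ({u, v, c} : Finset V) = t :=
        Finset.eq_of_subset_of_card_le hsub (by rw [h3]; exact hcard t ht)
      rw [← Finset.sum_subset (Finset.subset_univ t) (fun b _ hb => hyt b hb), ← ht3,
        Finset.sum_insert (by simp [huv, hcu.symm]), Finset.sum_pair hcv.symm] at hsum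
      linarith
    · exact hyt c hct
  have hrest : ∑ b ∈ Finset.univ \ {u, v}, y b = 0 := by
    have := Finset.sum_sdiff (f := y) (Finset.subset_univ {u, v})
    rw [hsum, Finset.sum_pair huv] at this
    linarith
  rw [Finset.sum_eq_zero_iff_of_nonneg fun b _ => hy.1.1.1 b] at hrest
  refine hne (funext fun b => ?_)
  by_cases hb : b = u
  · subst hb; rw [barycenter_of_mem (by simp), hcard2]; linarith
  by_cases hb' : b = v
  · subst hb'; rw [barycenter_of_mem (by simp), hcard2]; linarith
  · rw [hrest b (by simp [hb, hb']), barycenter_of_notMem (by simp [hb, hb'])]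

/-- An edge is not contained in three triangles. -/
theorem edge_not_branching
    (hX : ∀ x ∈ geometricRealization T, IsPlanarAt (geometricRealization T) x)
    (hcard : ∀ t ∈ T.faces, t.card ≤ 3) {u v c₁ c₂ c₃ : V} (huv : u ≠ v)
    (h1 : c₁ ≠ u ∧ c₁ ≠ v) (h2 : c₂ ≠ u ∧ c₂ ≠ v) (h3 : c₃ ≠ u ∧ c₃ ≠ v)
    (h12 : c₁ ≠ c₂) (h13 : c₁ ≠ c₃) (h23 : c₂ ≠ c₃) (hf₁ : {u, v, c₁} ∈ T.faces)
    (hf₂ : {u, v, c₂} ∈ T.faces) (hf₃ : {u, v, c₃} ∈ T.faces) : False := by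
  have hf : {u, v} ∈ T.faces := mem_faces_of_subset hf₁ (by
    intro b hb
    simp only [Finset.mem_insert, Finset.mem_singleton] at hb ⊢
    tauto) (by simp)
  have hcirc : ∀ {c : V}, c ≠ u ∧ c ≠ v → c ≠ c₃ → ∀ {η : ℝ}, 0 < η →
      IsWinding (foldCoord u v c ∘ edgeLoop u v c c₃ η) 1 := by
    intro c hc hc3 η hη
    convert! isWinding_circle hη using 1
    funext θ
    have hm : max (-Real.sin θ) 0 - max (Real.sin θ) 0 = -Real.sin θ := by
      rcases le_total 0 (Real.sin θ) with h | h
      · rw [max_eq_right (by linarith), max_eq_left h]; ring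
      · rw [max_eq_left (by linarith), max_eq_right h]; ring
    have hm' := max_add_max_neg (Real.sin θ)
    rw [Function.comp_apply, foldCoord, edgeLoop_fst huv hc.1 h3.1, edgeLoop_snd huv hc.2 h3.2,
      edgeLoop_neg hc.1 hc.2 hc3]
    apply Complex.ext
    · simp [Complex.exp_ofReal_mul_I_re]; ring
    · simp only [Complex.im_ofReal_mul, Complex.exp_ofReal_mul_I_im]
      linear_combination -η * hm' - η * hm
  -- The loop through `c₁` and `c₃` winds once for the coordinate that singles out `c₁`, but not for
  -- the one that singles out `c₂`, which folds both its halves into the upper half-plane. The loop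
  -- through `c₂` and `c₃` winds once for the latter.
  refine (hX _ (barycenter_mem hf)).false_of_windings (G := foldCoord u v c₁)
    (G' := foldCoord u v c₂) (ε₀ := 1 / 2) (by norm_num)
    (continuous_foldCoord u v c₁).continuousOn (continuous_foldCoord u v c₂).continuousOn
    (fun y hy => foldCoord_ne_zero hcard huv h1.1 h1.2 le_rfl hy)
    (fun y hy => foldCoord_ne_zero hcard huv h2.1 h2.2 le_rfl hy) fun ε hε => ?_
  obtain ⟨η, hη, hη', hηε⟩ : ∃ η : ℝ, 0 < η ∧ η ≤ 1 / 2 ∧ η < ε :=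
    ⟨min ε (1 / 2) / 2, by positivity, by linarith [min_le_right ε (1 / 2)],
      by linarith [min_le_left ε (1 / 2)]⟩
  refine ⟨edgeLoop u v c₁ c₃ η, edgeLoop u v c₂ c₃ η, continuous_edgeLoop _ _ _ _ _,
    continuous_edgeLoop _ _ _ _ _,
    fun θ => edgeLoop_mem huv h1.1 h1.2 h3.1 h3.2 h13 η θ hf₁ hf₃ hη hη' hηε,
    fun θ => edgeLoop_mem huv h2.1 h2.2 h3.1 h3.2 h23 η θ hf₂ hf₃ hη hη' hηε,
    edgeLoop_two_pi _ _ _ _ _, edgeLoop_two_pi _ _ _ _ _, hcirc h1 h13 hη, ?_, hcirc h2 h23 hη⟩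
  have hval : ∀ θ, (foldCoord u v c₂ ∘ edgeLoop u v c₁ c₃ η) θ =
      ⟨η * Real.cos θ, η * |Real.sin θ|⟩ := by
    intro θ
    rw [Function.comp_apply, foldCoord, edgeLoop_fst huv h1.1 h3.1, edgeLoop_snd huv h1.2 h3.2,
      edgeLoop_of_ne η θ h2.1 h2.2 h12.symm h23]
    apply Complex.ext
    · simp only; ring
    · simp only; ring
  refine isWinding_zero_of_slitPlane ((continuous_foldCoord u v c₂).comp
    (continuous_edgeLoop _ _ _ _ _)) (by simp [edgeLoop_two_pi]) fun θ => ?_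
  rw [hval, Complex.mem_slitPlane_iff]
  by_cases hs : Real.sin θ = 0
  · right
    have hc : Real.cos θ ≠ 0 := fun hc => by
      have := Real.sin_sq_add_cos_sq θ
      rw [hc, hs] at this
      norm_num at this
    simp [hη.ne', hc]
  · left
    simp [hη, hs]

theorem card_le_three (hX : ∀ x ∈ geometricRealization T, IsPlanarAt (geometricRealization T) x)
    {t : Finset V} (ht : t ∈ T.faces) : t.card ≤ 3 := by
  by_contra! h
  obtain ⟨s, hs, hs3⟩ := Finset.exists_subset_card_eq h.le
  have := triangle_maximal hX hs3 ht hs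
  subst this
  omega

/-- Every edge is contained in exactly two triangles. -/
theorem card_triangles_of_edge
    (hX : ∀ x ∈ geometricRealization T, IsPlanarAt (geometricRealization T) x) (e : Edg T) :
    (Finset.univ.filter fun t : Tri T => e.1 ⊆ t.1).card = 2 := by
  have hcard : ∀ t ∈ T.faces, t.card ≤ 3 := fun t ht => card_le_three hX ht
  obtain ⟨u, v, huv, he⟩ := Finset.card_eq_two.1 e.2.2
  have third : ∀ t : Tri T, e.1 ⊆ t.1 → ∃ c, (c ≠ u ∧ c ≠ v) ∧ t.1 = {u, v, c} := by
    intro t ht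
    obtain ⟨c, hc⟩ := Finset.card_eq_one.1
      (show (t.1 \ e.1).card = 1 by rw [Finset.card_sdiff_of_subset ht, t.2.2, e.2.2])
    have hc' : c ∉ e.1 := (Finset.mem_sdiff.1 (hc ▸ Finset.mem_singleton_self c)).2
    refine ⟨c, by simpa [he] using hc', ?_⟩
    rw [← Finset.union_sdiff_of_subset ht, hc, he]
    ext b
    simp
  refine le_antisymm (not_lt.1 fun h => ?_) (not_lt.1 fun h => ?_)
  · obtain ⟨t₁, h1, t₂, h2, t₃, h3, h12, h13, h23⟩ := Finset.two_lt_card.1 h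
    simp only [Finset.mem_filter, Finset.mem_univ, true_and] at h1 h2 h3
    obtain ⟨c₁, hc₁, e₁⟩ := third t₁ h1
    obtain ⟨c₂, hc₂, e₂⟩ := third t₂ h2
    obtain ⟨c₃, hc₃, e₃⟩ := third t₃ h3
    refine edge_not_branching hX hcard huv hc₁ hc₂ hc₃ ?_ ?_ ?_ (e₁ ▸ t₁.2.1) (e₂ ▸ t₂.2.1)
      (e₃ ▸ t₃.2.1)
    · rintro rfl; exact h12 (Subtype.ext (e₁.trans e₂.symm))
    · rintro rfl; exact h13 (Subtype.ext (e₁.trans e₃.symm))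
    · rintro rfl; exact h23 (Subtype.ext (e₂.trans e₃.symm))
  -- With one triangle at the edge, `c` is its third vertex; with none, `u` serves as a dummy.
  · obtain ⟨c, hc⟩ : ∃ c, ∀ t : Tri T, e.1 ⊆ t.1 → t.1 ⊆ {u, v, c} := by
      by_cases hex : ∃ t : Tri T, e.1 ⊆ t.1
      · obtain ⟨t₀, ht₀⟩ := hex
        obtain ⟨c, -, hc⟩ := third t₀ ht₀
        refine ⟨c, fun t ht => ?_⟩
        rw [← hc, Finset.card_le_one.1 (Nat.le_of_lt_succ h) t (by simpa using ht) t₀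
          (by simpa using ht₀)]
      · exact ⟨u, fun t ht => absurd ⟨t, ht⟩ hex⟩
    refine edge_not_free hX huv (he ▸ e.2.1) c fun t ht hst => ?_
    rcases (hcard t ht).eq_or_lt with h3 | h3
    · exact hc ⟨t, ht, h3⟩ (he ▸ hst)
    · rw [← Finset.eq_of_subset_of_card_le hst (by rw [Finset.card_pair huv]; omega)]
      intro b hb
      simp only [Finset.mem_insert, Finset.mem_singleton] at hb ⊢
      tauto

end Branching

/-! ### Connectedness of the sphere minus finitely many points. -/

section GlobalTopology

open Set Filter Topology Matrix

/-- The complement of a point in a space homeomorphic to the sphere is homeomorphic to the plane. -/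
theorem exists_punctured_chart {X : Type*} [TopologicalSpace X]
    (h : X ≃ₜ Metric.sphere (0 : EuclideanSpace ℝ (Fin (2 + 1))) 1) (x : X) :
    ∃ e : OpenPartialHomeomorph X ℂ, e.source = {x}ᶜ ∧ e.target = univ := by
  have : Fact (Module.finrank ℝ (EuclideanSpace ℝ (Fin (2 + 1))) = 2 + 1) := ⟨by simp⟩
  refine ⟨h.toOpenPartialHomeomorph.trans ((stereographic' 2 (h x)).trans
    Complex.orthonormalBasisOneI.repr.symm.toHomeomorph.toOpenPartialHomeomorph), ?_, ?_⟩
  · ext y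
    simp
  · simp

/-- Removing one point of `s` leaves a plane, in which the complement of a countable set is
connected. -/
theorem isPreconnected_compl_finite {X : Type*} [TopologicalSpace X]
    (h : X ≃ₜ Metric.sphere (0 : EuclideanSpace ℝ (Fin (2 + 1))) 1) {s : Set X} (hs : s.Finite)
    (h0 : s.Nonempty) : IsPreconnected sᶜ := by
  obtain ⟨x, hx⟩ := h0
  obtain ⟨e, hes, het⟩ := exists_punctured_chart h x
  have hc : Continuous e.symm := by
    have := e.symm.continuousOn
    rwa [e.symm_source, het, continuousOn_univ] at this
  have hinj : Function.Injective e.symm := by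
    rw [← injOn_univ, ← het, ← e.symm_source]
    exact e.symm.injOn
  have himg : sᶜ = e.symm '' (e.symm ⁻¹' s)ᶜ := by
    ext y
    constructor
    · intro hy
      have hys : y ∈ e.source := by
        rw [hes]
        rintro rfl
        exact hy hx
      exact ⟨e y, by simpa [e.left_inv hys] using hy, e.left_inv hys⟩
    · rintro ⟨z, hz, rfl⟩
      exact hz
  rw [himg]
  exact ((hs.preimage hinj.injOn).countable.isConnected_compl_of_one_lt_rank
    (by simp)).isPreconnected.image _ hc.continuousOn

variable {V : Type*} [Fintype V] [DecidableEq V] {T : AbstractSimplicialComplex V}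

theorem mem_faces_of_ne_zero {x : V → ℝ} (hx : x ∈ geometricRealization T) {s : Finset V}
    (hs : s.Nonempty) (h : ∀ v ∈ s, x v ≠ 0) : s ∈ T.faces := by
  obtain ⟨-, t, ht, hxt⟩ := hx
  exact mem_faces_of_subset ht (fun v hv => by_contra fun hvt => h v hv (hxt v hvt)) hs

theorem exists_pos_of_mem {x : V → ℝ} (hx : x ∈ geometricRealization T) : ∃ v, 0 < x v := by
  by_contra! h
  have : ∑ v, x v ≤ 0 := Finset.sum_nonpos fun v _ => h v
  rw [hx.1.2] at this
  norm_num at this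

theorem single_mem (v : V) : (Pi.single v 1 : V → ℝ) ∈ geometricRealization T := by
  refine mem_geometricRealization_of_face (T.singleton_mem v) (fun w => ?_) (by simp) fun w hw => ?_
  · rw [Pi.single_apply]
    split_ifs <;> norm_num
  · simp only [Finset.mem_singleton] at hw
    simp [hw]

/-- A vertex function that agrees at the ends of each edge is constant. -/
theorem eq_const_of_edge (hX : IsPreconnected (geometricRealization T)) (g : V → ZMod 2)
    (hg : ∀ u v, u ≠ v → {u, v} ∈ T.faces → g u = g v) : ∃ a, g = fun _ => a := by
  by_contra! hne
  obtain ⟨u, hu⟩ : ∃ u, g u = 1 := by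
    by_contra! h
    exact hne 0 (funext fun v => (zmod2_cases _).resolve_right (h v))
  obtain ⟨v, hv⟩ : ∃ v, g v = 0 := by
    by_contra! h
    exact hne 1 (funext fun v => zmod2_eq_one (h v))
  -- The mass on the vertices with `g = 1`. It is `0` or `1` at each point of the realization, since
  -- `g` is constant on faces, so it cannot take the intermediate value `1 / 2`.
  let F : (V → ℝ) → ℝ := fun x => ∑ w, if g w = 1 then x w else 0
  have hF : ContinuousOn F (geometricRealization T) := by
    refine Continuous.continuousOn (continuous_finsetSum _ fun w _ => ?_)
    split_ifs <;> fun_prop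
  have hFu : F (Pi.single u 1) = 1 := by
    simp only [F]
    rw [Finset.sum_eq_single u (fun w _ hw => by simp [hw]) (by simp)]
    simp [hu]
  have hFv : F (Pi.single v 1) = 0 := by
    simp only [F]
    rw [Finset.sum_eq_single v (fun w _ hw => by simp [hw]) (by simp)]
    simp [hv]
  obtain ⟨x, hx, hFx⟩ := hX.intermediate_value (single_mem v) (single_mem u) hF
    (show (1 / 2 : ℝ) ∈ Icc _ _ by rw [hFu, hFv]; norm_num)
  have hval : ∀ w w', x w ≠ 0 → x w' ≠ 0 → g w = g w' := fun w w' h h' => by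
    by_cases hww : w = w'
    · rw [hww]
    · exact hg w w' hww (mem_faces_of_ne_zero hx (by simp) (by simp [h, h']))
  obtain ⟨w, hw⟩ := exists_pos_of_mem hx
  rcases zmod2_cases (g w) with h | h
  · have : F x = 0 := Finset.sum_eq_zero fun w' _ => by
      split_ifs with h'
      · by_contra h0
        rw [hval w w' hw.ne' h0, h'] at h
        exact one_ne_zero h
      · rfl
    rw [this] at hFx
    norm_num at hFx
  · have : F x = ∑ w, x w := Finset.sum_congr rfl fun w' _ => by
      split_ifs with h'
      · rfl
      · by_contra h0
        exact h' ((hval w w' hw.ne' (Ne.symm h0)).symm.trans h)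
    rw [this, hx.1.2] at hFx
    norm_num at hFx

/-- A triangle function that agrees on adjacent triangles is constant. -/
theorem IsPseudosurface.eq_const_of_adjacent (hT : IsPseudosurface T)
    (hX : IsPreconnected (geometricRealization T \ range fun v => (Pi.single v 1 : V → ℝ)))
    (c : Tri T → ZMod 2)
    (hc : ∀ (e : Edg T) (t t' : Tri T), e.1 ⊆ t.1 → e.1 ⊆ t'.1 → c t = c t') :
    ∃ a, c = fun _ => a := by
  by_contra! hne
  obtain ⟨t₁, ht₁⟩ : ∃ t, c t = 1 := by
    by_contra! h
    exact hne 0 (funext fun v => (zmod2_cases _).resolve_right (h v))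
  obtain ⟨t₀, ht₀⟩ : ∃ t, c t = 0 := by
    by_contra! h
    exact hne 1 (funext fun v => zmod2_eq_one (h v))
  -- The union of the triangles on which `c` has the value `a`. The two unions are closed and cover
  -- a connected set, so they meet off the vertices; a common point has two nonzero coordinates and
  -- thus yields a common edge.
  let C : ZMod 2 → Set (V → ℝ) := fun a =>
    ⋃ t : Tri T, {x | c t = a ∧ ∀ v, v ∉ t.1 → x v = 0}
  have hC : ∀ a, IsClosed (C a) := fun a => isClosed_iUnion_of_finite fun t => by
    by_cases h : c t = a
    · simp only [h, true_and, ofPred_forall]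
      exact isClosed_iInter fun v => isClosed_iInter fun _ =>
        isClosed_eq (continuous_apply v) continuous_const
    · simp [h]
  have hbary : ∀ t : Tri T, barycenter t.1 ∈
      geometricRealization T \ range fun v => (Pi.single v 1 : V → ℝ) := fun t => by
    refine ⟨barycenter_mem t.2.1, ?_⟩
    rintro ⟨v, hv⟩
    obtain ⟨w, hw, hwv⟩ := Finset.exists_mem_ne (s := t.1) (by rw [t.2.2]; norm_num) v
    have := congrFun hv w
    simp only [Pi.single_apply, hwv, if_false, barycenter_of_mem hw, t.2.2] at this
    norm_num at this
  obtain ⟨x, ⟨hx, hxv⟩, h1, h0⟩ := isPreconnected_closed_iff.1 hX (C 1) (C 0) (hC 1) (hC 0)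
    (fun x hx => by
      obtain ⟨-, s, hs, hxs⟩ := hx.1
      obtain ⟨t, ht⟩ := hT.exists_tri_of_face hs
      have hxt : ∀ v, v ∉ t.1 → x v = 0 := fun v hv => hxs v fun h => hv (ht h)
      rcases zmod2_cases (c t) with h | h
      · exact Or.inr (mem_iUnion.2 ⟨t, h, hxt⟩)
      · exact Or.inl (mem_iUnion.2 ⟨t, h, hxt⟩))
    ⟨_, hbary t₁, mem_iUnion.2 ⟨t₁, ht₁, fun v hv => barycenter_of_notMem hv⟩⟩
    ⟨_, hbary t₀, mem_iUnion.2 ⟨t₀, ht₀, fun v hv => barycenter_of_notMem hv⟩⟩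
  obtain ⟨t, htc, ht⟩ := mem_iUnion.1 h1
  obtain ⟨t', htc', ht'⟩ := mem_iUnion.1 h0
  obtain ⟨u, hu⟩ := exists_pos_of_mem hx
  obtain ⟨w, hwu, hw⟩ : ∃ w, w ≠ u ∧ x w ≠ 0 := by
    by_contra! h
    refine hxv ⟨u, ?_⟩
    have hxu : x u = 1 := by
      rw [← hx.1.2, Finset.sum_eq_single u (fun w _ hw => h w hw) (by simp)]
    funext w
    by_cases hw : w = u
    · subst hw; simp [hxu]
    · simp [hw, h w hw]
  have hmem : ∀ t : Tri T, (∀ v, v ∉ t.1 → x v = 0) → {u, w} ⊆ t.1 := fun t ht v hv => by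
    simp only [Finset.mem_insert, Finset.mem_singleton] at hv
    by_contra h
    rcases hv with rfl | rfl
    · exact hu.ne' (ht _ h)
    · exact hw (ht _ h)
  have := hc ⟨{u, w}, mem_faces_of_ne_zero hx (by simp) (by simp [hu.ne', hw]),
    Finset.card_pair hwu.symm⟩ t t' (hmem t ht) (hmem t' ht')
  rw [htc, htc'] at this
  exact one_ne_zero this

end GlobalTopology

/-! ### Double covers and vanishing of `H¹` mod 2. -/

section SignCovering

open Set Filter Topology Matrix

variable {V : Type*} [Fintype V] [DecidableEq V] {T : AbstractSimplicialComplex V}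

/-- Signs on the pairs of adjacent vertices of a complex whose product over the edges of each
triangle is trivial. -/
structure IsSignCocycle (T : AbstractSimplicialComplex V) (s : V → V → ℝ) : Prop where
  abs_eq_one : ∀ u v, |s u v| = 1
  self : ∀ u, s u u = 1
  comm : ∀ u v, s u v = s v u
  mul : ∀ u v w, {u, v, w} ∈ T.faces → s u v * s v w = s u w

/-- The total space of the double covering of the realization of `T` associated with a sign
cocycle. -/
def signCover (T : AbstractSimplicialComplex V) (s : V → V → ℝ) : Set (V → ℝ) :=
  {y | |y| ∈ geometricRealization T ∧ ∀ u v, 0 ≤ s u v * (y u * y v)}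

/-- The projection of the double covering associated with a sign cocycle. -/
def signCoverProj (T : AbstractSimplicialComplex V) (s : V → V → ℝ) :
    signCover T s → geometricRealization T := fun y => ⟨|y.1|, y.2.1⟩

/-- The sign `1` or `-1`. -/
def boolSign (b : Bool) : ℝ := if b then 1 else -1

theorem continuous_signCoverProj (s : V → V → ℝ) : Continuous (signCoverProj T s) :=
  Continuous.subtype_mk (continuous_pi fun v => by
    exact ((continuous_apply v).comp continuous_subtype_val).abs) _

/-- The points of the double covering over points with nonzero coordinate `v`. -/
theorem IsSignCocycle.section_mem {s : V → V → ℝ} (hs : IsSignCocycle T s) {x : V → ℝ}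
    (hx : x ∈ geometricRealization T) {v : V} (hv : 0 < x v) (b : Bool) :
    (fun w => boolSign b * s v w * x w) ∈ signCover T s ∧
      |fun w => boolSign b * s v w * x w| = x := by
  have habs : |fun w => boolSign b * s v w * x w| = x := by
    funext w
    rw [Pi.abs_apply, abs_mul, abs_mul, hs.abs_eq_one, abs_of_nonneg (hx.1.1 w)]
    cases b <;> simp [boolSign]
  refine ⟨⟨habs.symm ▸ hx, fun u w => ?_⟩, habs⟩
  have hb : boolSign b * boolSign b = 1 := by cases b <;> simp [boolSign]
  rcases (hx.1.1 u).eq_or_lt with hu | hu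
  · simp [← hu]
  rcases (hx.1.1 w).eq_or_lt with hw | hw
  · simp [← hw]
  have hm := hs.mul u v w (mem_faces_of_ne_zero hx (by simp) (by simp [hu.ne', hv.ne', hw.ne']))
  have h1 : s u w * s u w = 1 := by rw [← abs_mul_abs_self, hs.abs_eq_one, one_mul]
  have : s u w * (boolSign b * s v u * x u * (boolSign b * s v w * x w)) = x u * x w := by
    rw [hs.comm v u]
    calc _ = (boolSign b * boolSign b) * (s u w * (s u v * s v w)) * (x u * x w) := by ring
      _ = x u * x w := by rw [hb, hm, h1, one_mul, one_mul]
  rw [this]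
  positivity

/-- Where `x v` is positive, the sign of `y v` labels the two sheets, and the cocycle then
determines the signs of all other coordinates. These open sets cover the realization. -/
theorem IsSignCocycle.isCoveringMap {s : V → V → ℝ} (hs : IsSignCocycle T s) :
    IsCoveringMap (signCoverProj T s) := by
  intro x
  obtain ⟨v, hv⟩ := exists_pos_of_mem x.2
  have hU : IsOpen {x : geometricRealization T | 0 < x.1 v} :=
    isOpen_lt continuous_const ((continuous_apply v).comp continuous_subtype_val)
  have hcv : ∀ w, Continuous fun y : signCoverProj T s ⁻¹' {x | 0 < x.1 v} => y.1.1 w := fun w =>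
    (continuous_apply w).comp (continuous_subtype_val.comp continuous_subtype_val)
  refine IsEvenlyCovered.to_isEvenlyCovered_preimage (I := Bool) ⟨inferInstance,
    {x | 0 < x.1 v}, hv, hU, hU.preimage (continuous_signCoverProj s), ?_⟩
  have hne : ∀ y : signCoverProj T s ⁻¹' {x | 0 < x.1 v}, y.1.1 v ≠ 0 := fun y =>
    abs_pos.1 y.2
  refine ⟨⟨⟨fun y => (⟨signCoverProj T s y.1, y.2⟩, decide (0 < y.1.1 v)),
    fun z => ⟨⟨_, (hs.section_mem z.1.1.2 z.1.2 z.2).1⟩, by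
      change 0 < |fun w => boolSign z.2 * s v w * z.1.1.1 w| v
      rw [(hs.section_mem z.1.1.2 z.1.2 z.2).2]
      exact z.1.2⟩, fun y => ?_, fun z => ?_⟩, ?_, ?_⟩, fun _ => rfl⟩
  · refine Subtype.ext (Subtype.ext (funext fun w => ?_))
    change boolSign (decide (0 < y.1.1 v)) * s v w * |y.1.1 w| = y.1.1 w
    have h := y.1.2.2 v w
    have hs1 : s v w = 1 ∨ s v w = -1 := eq_or_eq_neg_of_abs_eq (hs.abs_eq_one v w)
    rcases (hne y).lt_or_gt with h0 | h0
    · rw [decide_eq_false h0.not_gt]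
      rcases hs1 with h1 | h1 <;> rw [h1] at h ⊢
      · rw [abs_of_nonpos (by nlinarith)]; simp [boolSign]
      · rw [abs_of_nonneg (by nlinarith)]; simp [boolSign]
    · rw [decide_eq_true h0]
      rcases hs1 with h1 | h1 <;> rw [h1] at h ⊢
      · rw [abs_of_nonneg (by nlinarith)]; simp [boolSign]
      · rw [abs_of_nonpos (by nlinarith)]; simp [boolSign]
  · refine Prod.ext (Subtype.ext (Subtype.ext (hs.section_mem z.1.1.2 z.1.2 z.2).2)) ?_
    have hz : 0 < z.1.1.1 v := z.1.2
    change decide (0 < boolSign z.2 * s v v * z.1.1.1 v) = z.2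
    rw [hs.self]
    cases z.2 <;> simp [boolSign, hz, hz.le]
  · refine Continuous.prodMk (Continuous.subtype_mk
      ((continuous_signCoverProj s).comp continuous_subtype_val) _) ?_
    rw [continuous_bool_rng true]
    constructor
    · have : (fun y : signCoverProj T s ⁻¹' {x | 0 < x.1 v} => decide (0 < y.1.1 v)) ⁻¹' {true} =
          {y | 0 ≤ y.1.1 v} := by
        ext y
        simpa using ⟨le_of_lt, fun h => h.lt_of_ne (hne y).symm⟩
      rw [this]
      exact isClosed_le continuous_const (hcv v)
    · have : (fun y : signCoverProj T s ⁻¹' {x | 0 < x.1 v} => decide (0 < y.1.1 v)) ⁻¹' {true} =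
          {y | 0 < y.1.1 v} := by
        ext y
        simp
      rw [this]
      exact isOpen_lt continuous_const (hcv v)
  · refine Continuous.subtype_mk (Continuous.subtype_mk (continuous_pi fun w => ?_) _) _
    have hb : Continuous boolSign := continuous_of_discreteTopology
    exact ((hb.comp continuous_snd).mul continuous_const).mul ((continuous_apply w).comp
      (continuous_subtype_val.comp (continuous_subtype_val.comp continuous_fst)))

/-- Sign cocycles on a complex which is the plane off a point in the interior of a triangle are
coboundaries. -/
theorem IsSignCocycle.exists_coboundary {s : V → V → ℝ} (hs : IsSignCocycle T s) {t : Tri T}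
    (e : OpenPartialHomeomorph (geometricRealization T) ℂ)
    (he : e.source = {⟨barycenter t.1, barycenter_mem t.2.1⟩}ᶜ) (he' : e.target = univ) :
    ∃ a : V → ℝ, (∀ v, a v ≠ 0) ∧ ∀ u v, u ≠ v → {u, v} ∈ T.faces → 0 < s u v * (a u * a v) := by
  have hc : Continuous e.symm := by
    have := e.symm.continuousOn
    rwa [e.symm_source, he', continuousOn_univ] at this
  obtain ⟨v₀, hv₀⟩ := exists_pos_of_mem (e.symm 0).2
  obtain ⟨hy₀, hp₀⟩ := hs.section_mem (e.symm 0).2 hv₀ true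
  -- The inverse chart from the plane lifts to the double cover, giving a section `M` off the
  -- barycenter of `t`. Vertices and edges avoid that point, so `M` is continuous along the whole
  -- 1-skeleton.
  obtain ⟨L, hL⟩ := hs.isCoveringMap.exists_lift_of_starConvex (mem_univ (0 : ℂ))
    (starConvex_univ 0) ⟨fun z => e.symm z.1, by fun_prop⟩ ⟨_, hy₀⟩ (Subtype.ext hp₀)
  let M : geometricRealization T → V → ℝ := fun x => (L ⟨e x, mem_univ _⟩).1
  have hM : ContinuousOn M e.source := continuous_subtype_val.comp_continuousOn
    ((L.continuous.comp (continuous_id.subtype_mk fun _ => mem_univ _)).comp_continuousOn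
      e.continuousOn)
  have habs : ∀ x ∈ e.source, ∀ v, |M x v| = x.1 v := fun x hx v => by
    have := congrArg Subtype.val (hL ⟨e x, mem_univ _⟩)
    change |M x| = (e.symm (e x)).1 at this
    rw [e.left_inv hx] at this
    exact congrFun this v
  have hmid : ∀ u v, {u, v} ∈ T.faces → ∀ r ∈ Icc (0 : ℝ) (1 / 2),
      (1 - r) • (Pi.single u 1 : V → ℝ) + r • (Pi.single v 1 : V → ℝ) ∈
        geometricRealization T := by
    intro u v hf r hr
    refine mem_geometricRealization_of_face hf (fun w => ?_) ?_ fun w hw => ?_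
    · have h1 : (0 : ℝ) ≤ (Pi.single u 1 : V → ℝ) w := by
        rw [Pi.single_apply]; split_ifs <;> norm_num
      have h2 : (0 : ℝ) ≤ (Pi.single v 1 : V → ℝ) w := by
        rw [Pi.single_apply]; split_ifs <;> norm_num
      have h3 : (0 : ℝ) ≤ 1 - r := by linarith [hr.2]
      have h4 := hr.1
      simp only [Pi.add_apply, Pi.smul_apply, smul_eq_mul]
      positivity
    · simp [Finset.sum_add_distrib, ← Finset.mul_sum]
    · simp only [Finset.mem_insert, Finset.mem_singleton, not_or] at hw
      simp [hw.1, hw.2]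
  have hsrc : ∀ x : geometricRealization T, ∀ u v, (∀ w, w ≠ u → w ≠ v → x.1 w = 0) →
      x ∈ e.source := by
    intro x u v hx
    rw [he]
    rintro rfl
    obtain ⟨w, hw, hw'⟩ := Finset.exists_mem_notMem_of_card_lt_card
      (show ({u, v} : Finset V).card < t.1.card by
        rw [t.2.2]; exact lt_of_le_of_lt Finset.card_le_two (by norm_num))
    simp only [Finset.mem_insert, Finset.mem_singleton, not_or] at hw'
    have := hx w hw'.1 hw'.2
    simp only [barycenter_of_mem hw, t.2.2] at this
    norm_num at this
  -- From the vertex `u` to the midpoint of `{u, v}` the coordinate at `u` stays nonzero, so its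
  -- sign does not change. At the midpoint the defining inequality of the cover compares the signs
  -- at `u` and `v`.
  have hhalf : ∀ u v, u ≠ v → ∀ hf : {u, v} ∈ T.faces,
      0 < M ⟨_, single_mem u⟩ u * M ⟨_, hmid u v hf (1 / 2) (by norm_num)⟩ u := by
    intro u v huv hf
    let γ : Icc (0 : ℝ) (1 / 2) → geometricRealization T := fun r => ⟨_, hmid u v hf r.1 r.2⟩
    have hγ : Continuous γ := Continuous.subtype_mk (by fun_prop) _
    have hγs : ∀ r, γ r ∈ e.source := fun r => hsrc _ u v fun w hwu hwv => by
      simp [γ, hwu, hwv]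
    have hcont : Continuous fun r => M (γ r) u :=
      (continuous_apply u).comp (hM.comp_continuous hγ hγs)
    have hne : ∀ r, M (γ r) u ≠ 0 := fun r => by
      rw [← abs_pos, habs _ (hγs r)]
      have := r.2.2
      simp [γ, huv]
      linarith
    have h0 : γ ⟨0, by norm_num⟩ = ⟨_, single_mem u⟩ := Subtype.ext (by simp [γ])
    rw [← h0]
    change 0 < M (γ _) u * M (γ ⟨1 / 2, by norm_num⟩) u
    have hpc : PreconnectedSpace (Icc (0 : ℝ) (1 / 2)) :=
      Subtype.preconnectedSpace isPreconnected_Icc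
    by_contra! hle
    have hz : (0 : ℝ) ∈ range fun r => M (γ r) u := by
      rcases mul_nonpos_iff.1 hle with ⟨h1, h2⟩ | ⟨h1, h2⟩
      · exact intermediate_value_univ _ _ hcont ⟨h2, h1⟩
      · exact intermediate_value_univ _ _ hcont ⟨h1, h2⟩
    obtain ⟨r, hr⟩ := hz
    exact hne r hr
  refine ⟨fun v => M ⟨_, single_mem v⟩ v, fun v => ?_, fun u v huv hf => ?_⟩
  · rw [← abs_pos, habs _ (hsrc _ v v fun w hw _ => by simp [hw])]
    simp
  · have h1 := hhalf u v huv hf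
    have h2 := hhalf v u huv.symm (Finset.pair_comm u v ▸ hf)
    have hm : (⟨_, hmid v u (Finset.pair_comm u v ▸ hf) (1 / 2) (by norm_num)⟩ :
        geometricRealization T) = ⟨_, hmid u v hf (1 / 2) (by norm_num)⟩ := by
      refine Subtype.ext ?_
      change (1 - (1 / 2 : ℝ)) • _ + (1 / 2 : ℝ) • _ = (1 - (1 / 2 : ℝ)) • _ + (1 / 2 : ℝ) • _
      norm_num [add_comm]
    rw [hm] at h2
    set m : geometricRealization T := ⟨_, hmid u v hf (1 / 2) (by norm_num)⟩
    have h3 : 0 ≤ s u v * (M m u * M m v) := (L ⟨e m, mem_univ _⟩).2.2 u v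
    have h4 : s u v ≠ 0 := by
      rw [← abs_pos, hs.abs_eq_one]
      exact one_pos
    have h5 : 0 < s u v * (M m u * M m v) := h3.lt_of_ne' (mul_ne_zero h4
      (mul_ne_zero (right_ne_zero_of_mul h1.ne') (right_ne_zero_of_mul h2.ne')))
    have h6 : M m u * M m u ≠ 0 := mul_self_ne_zero.2 (right_ne_zero_of_mul h1.ne')
    have h7 : M m v * M m v ≠ 0 := mul_self_ne_zero.2 (right_ne_zero_of_mul h2.ne')
    have h8 : 0 < (M m u * M m u) * (M m v * M m v) :=
      mul_pos (h6.lt_of_le' (mul_self_nonneg _)) (h7.lt_of_le' (mul_self_nonneg _))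
    refine pos_of_mul_pos_left ?_ h8.le
    calc 0 < (M ⟨_, single_mem u⟩ u * M m u) * (M ⟨_, single_mem v⟩ v * M m v) *
          (s u v * (M m u * M m v)) := mul_pos (mul_pos h1 h2) h5
      _ = _ := by ring

/-- The sign of an element of `ZMod 2`. -/
noncomputable def zmod2Sign (a : ZMod 2) : ℝ := if a = 0 then 1 else -1

theorem zmod2Sign_add (a b : ZMod 2) : zmod2Sign (a + b) = zmod2Sign a * zmod2Sign b := by
  have : (1 : ZMod 2) + 1 = 0 := by decide
  rcases zmod2_cases a with rfl | rfl <;> rcases zmod2_cases b with rfl | rfl <;>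
    simp [zmod2Sign, this]

/-- The sphere is connected, which gives `conn`, and stays connected without the vertices, which
gives `h2`. For `h1`, a mod 2 cocycle defines a double cover, trivial over the sphere minus a point,
and the signs of a section at the vertices form a potential. -/
theorem IsTriangulationOfSphere.isMod2Sphere (hT : IsTriangulationOfSphere 2 T) :
    IsMod2Sphere T := by
  obtain ⟨h⟩ := hT
  have hX : ∀ x ∈ geometricRealization T, IsPlanarAt (geometricRealization T) x :=
    fun x hx => isPlanarAt_of_homeomorph h hx
  have hP : IsPseudosurface T :=
    { card_le := fun s hs => card_le_three hX hs
      exists_edge := fun v => by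
        obtain ⟨w, hvw, hf⟩ := exists_edge_at hX v
        exact ⟨⟨_, hf, Finset.card_pair hvw⟩, by simp⟩
      two := card_triangles_of_edge hX }
  have hne : Nonempty V := by
    obtain ⟨x, hx⟩ := (NormedSpace.sphere_nonempty (E := EuclideanSpace ℝ (Fin (2 + 1)))
      (x := 0) (r := 1)).2 zero_le_one
    obtain ⟨v, -⟩ := exists_pos_of_mem (h.symm ⟨x, hx⟩).2
    exact ⟨v⟩
  refine { hP with nonempty := hne, conn := fun g hg => ?_, h1 := fun φ hφ => ?_, h2 := ?_ }
  · refine eq_const_of_edge (T := T) ?_ g fun u v huv hf => ?_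
    · have hS : IsPreconnected (Metric.sphere (0 : EuclideanSpace ℝ (Fin (2 + 1))) 1) :=
        isPreconnected_sphere (by
          rw [rank_eq_card_basis (EuclideanSpace.basisFun (Fin (2 + 1)) ℝ).toBasis]; simp) _ _
      rw [isPreconnected_iff_preconnectedSpace] at hS ⊢
      exact ⟨by
        rw [← h.symm.surjective.range_eq, ← image_univ]
        exact isPreconnected_univ.image _ h.symm.continuous.continuousOn⟩
    · have := congrFun hg ⟨{u, v}, hf, Finset.card_pair huv⟩
      rwa [edgeVertexMatrix_mulVec, Finset.sum_pair huv, Pi.zero_apply,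
        zmod2_add_eq_zero] at this
  · obtain ⟨t, -⟩ := hP.exists_tri_of_face (T.singleton_mem hne.some)
    obtain ⟨e, he, he'⟩ := exists_punctured_chart h ⟨barycenter t.1, barycenter_mem t.2.1⟩
    classical
    let Ψ : Finset V → ZMod 2 := fun p => if hp : p ∈ T.faces ∧ p.card = 2 then φ ⟨p, hp⟩ else 0
    let ψ : V → V → ZMod 2 := fun u v => Ψ {u, v}
    have hψ : ∀ u v (hf : {u, v} ∈ T.faces ∧ ({u, v} : Finset V).card = 2),
        ψ u v = φ ⟨{u, v}, hf⟩ := fun u v hf => dif_pos hf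
    have hself : ∀ u, ψ u u = 0 := fun u => dif_neg (by simp)
    have hcomm : ∀ u v, ψ u v = ψ v u := fun u v => by
      simp only [ψ, Finset.pair_comm]
    have hs : IsSignCocycle T fun u v => zmod2Sign (ψ u v) :=
      { abs_eq_one := fun u v => by
          unfold zmod2Sign
          split_ifs <;> simp
        self := fun u => by simp [hself, zmod2Sign]
        comm := fun u v => by rw [hcomm]
        mul := fun u v w hf => by
          rw [← zmod2Sign_add]
          congr 1
          by_cases huv : u = v
          · rw [huv, hself, zero_add]
          by_cases hvw : v = w
          · rw [hvw, hself, add_zero]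
          by_cases huw : u = w
          · rw [huw, hself, hcomm v w, zmod2_add_eq_zero]
          let τ : Tri T := ⟨{u, v, w}, hf, Finset.card_eq_three.2 ⟨u, v, w, huv, huw, hvw, rfl⟩⟩
          have := congrFun hφ τ
          rw [triEdgeMatrix_mulVec, sum_edges_of_tri φ τ huv huw hvw rfl, Pi.zero_apply] at this
          rw [hψ u v (τ.edge (by simp [τ]) (by simp [τ]) huv).2,
            hψ v w (τ.edge (by simp [τ]) (by simp [τ]) hvw).2,
            hψ u w (τ.edge (by simp [τ]) (by simp [τ]) huw).2, ← zmod2_add_eq_zero, ← this]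
          simp only [Tri.edge]
          ring }
    obtain ⟨a, ha0, ha⟩ := hs.exists_coboundary e he he'
    refine ⟨fun v => if 0 < a v then 0 else 1, funext fun E => ?_⟩
    obtain ⟨u, v, huv, hE⟩ := E.exists_eq
    obtain ⟨E, hE2⟩ := E
    subst hE
    rw [edgeVertexMatrix_mulVec, Finset.sum_pair huv, ← hψ u v hE2]
    have hpos := ha u v huv hE2.1
    have h11 : (1 : ZMod 2) + 1 = 0 := by decide
    rcases (ha0 u).lt_or_gt with hu | hu <;> rcases (ha0 v).lt_or_gt with hv | hv
    · rw [if_neg hu.not_gt, if_neg hv.not_gt, h11]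
      by_contra hne
      rw [zmod2Sign, if_neg hne] at hpos
      nlinarith [mul_pos_of_neg_of_neg hu hv]
    · rw [if_neg hu.not_gt, if_pos hv, add_zero]
      refine zmod2_eq_one fun h0 => ?_
      rw [zmod2Sign, if_pos h0] at hpos
      nlinarith [mul_neg_of_neg_of_pos hu hv]
    · rw [if_pos hu, if_neg hv.not_gt, zero_add]
      refine zmod2_eq_one fun h0 => ?_
      rw [zmod2Sign, if_pos h0] at hpos
      nlinarith [mul_neg_of_pos_of_neg hu hv]
    · rw [if_pos hu, if_pos hv, add_zero]
      by_contra hne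
      rw [zmod2Sign, if_neg hne] at hpos
      nlinarith [mul_pos hu hv]
  · intro c hc
    refine hP.eq_const_of_adjacent ?_ c fun E => (hP.vecMul_eq_zero_iff c E).1 (congrFun hc E)
    have hfin : (Subtype.val ⁻¹' range fun v => (Pi.single v 1 : V → ℝ) :
        Set (geometricRealization T)).Finite :=
      (finite_range _).preimage Subtype.val_injective.injOn
    have := (isPreconnected_compl_finite h hfin
      ⟨⟨_, single_mem hne.some⟩, hne.some, rfl⟩).image _ continuous_subtype_val.continuousOn
    rwa [← preimage_compl, Subtype.image_preimage_coe] at this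

end SignCovering

theorem proposition6p3 {V₁ : Type*} {V₂ : Type*} [Fintype V₁] [DecidableEq V₁]
    [Fintype V₂] [DecidableEq V₂]
    (T₁ : AbstractSimplicialComplex V₁) (T₂ : AbstractSimplicialComplex V₂)
    (hT₁ : IsTriangulationOfSphere 2 T₁) (hT₂ : IsTriangulationOfSphere 2 T₂)
    (hminor : IsGraphMinor (oneSkeleton T₁) (oneSkeleton T₂)) :
    (∃ (f : SimplicialMap T₂ T₁) (d : ℤ), (d = 1 ∨ d = -1) ∧ f.HasDegree 2 d) ∧
      SphereDominates 2 T₂ T₁ := by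
  obtain ⟨m⟩ := nonempty_minorModel hT₁.isMod2Sphere hT₂.isMod2Sphere hminor
  obtain ⟨d, hd, hdeg⟩ := m.exists_degree hT₁.isMod2Sphere hT₂.isMod2Sphere
  refine ⟨⟨_, d, hd, hdeg⟩, _, d, ?_, hdeg⟩
  rcases hd with rfl | rfl <;> norm_num
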